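/- **Setting.** Let $\mathcal H=\{u\in H^1(0,1):\int_0^1u\,d\xi=0\}$ with norm $\|u\|_{\mathcal H}=\|u'\|_{L^2(0,1)}$, and let $X$ be the dual space of $\mathcal H$ with the dual norm, which is a Hilbert norm. For $r\ge 1$, a function $x\in L^r(0,1)$ with $\int_0^1x\,d\xi=0$ is identified with the element $y\mapsto\int_0^1x(\xi)y(\xi)\,d\xi$ of $X$. Let $B:\mathcal H\to X$, $Bu(y)=\int_0^1u'(\xi)y'(\xi)\,d\xi$, be the canonical isometry, regarded also as an unbounded operator in $X$ with domain $\mathcal H$, and let $A=-B^2$. Let $\mu$ be the Gaussian measure on $X$ with mean $0$ and covariance $Q=-\frac12A^{-1}=\frac12B^{-2}$. The functions $e_k(\xi)=\sqrt2\cos(k\pi\xi)/(k\pi)$, $k\ge1$, form an orthonormal basis of $\mathcal H$, the $f_k=Be_k$ form an orthonormal basis of $X$, and $Qf_k=\lambda_kf_k$ with $\lambda_k=1/(2k^4\pi^4)$. For $\theta\in\mathbb R$ and $q>1$, $W^{1,q}_\theta(X,\mu)$ is the domain of the closure in $L^q(X,\mu)$ of the operator $Q^\theta D$, defined on the cylindrical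 functions $\varphi(x)=\phi(\langle x,f_1\rangle_X,\dots,\langle x,f_n\rangle_X)$, $n\in\mathbb N$, $\phi\in C^1_b(\mathbb R^n)$, by $Q^\theta D\varphi=\sum_k\lambda_k^\theta\,(D_k\varphi)f_k$, where $D_k$ is the derivative in the direction $f_k$. Its norm is given by $\|\varphi\|^q=\int_X(|\varphi|^q+\|Q^\theta D\varphi\|_X^q)\,d\mu$. **Lemma.** Let $\Phi\in C^2(\mathbb R)$ be convex and bounded from below, and let $|\Phi''(t)|\le K(1+|t|^{p-2})$ for all $t\in\mathbb R$, for some $K>0$ and $p\ge2$. Let $U:X\to\mathbb R\cup\{+\infty\}$ be defined by $U(x)=\int_0^1\Phi(x(\xi))\,d\xi$ if $x$ is (identified with) a function in $L^p(0,1)$ with zero average, and $U(x)=+\infty$ otherwise. For $\alpha>0$ let $$\Phi_\alpha(r)=\inf_{s\in\mathbb R}\Big\{\Phi(s)+\frac{(r-s)^2}{2\alpha}\Big\},\qquad U_\alpha(x)=\int_0^1\Phi_\alpha\big(((I+\alpha B)^{-1}x)(\xi)\big)\,d\xi,\quad x\in X.$$ Then $U$ is convex, and the following holds. 1. For every $\alpha>0$,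 $U_\alpha:X\to\mathbb R$ is convex and differentiable at every point of $X$, and its gradient $DU_\alpha:X\to X$ is Lipschitz continuous. 2. There is $C\in\mathbb R$ such that for every $\alpha>0$, $C\le U_\alpha(x)\le U(x)$ for $\mu$-a.e. $x\in X$. 3. There is $p_0>2$ such that $U_\alpha\to U$ in $W^{1,p_0}_{1/2}(X,\mu)$ as $\alpha\to0^+$; in fact $U_\alpha\to U$ in $W^{1,q}_{1/2}(X,\mu)$ as $\alpha\to0^+$ for every $q\in(1,\infty)$. (This includes that $U$ is finite $\mu$-a.e. and that $U$ and all $U_\alpha$ belong to the space.) -/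

import Mathlib

open MeasureTheory Filter Topology Set
open scoped ENNReal NNReal ContDiff RealInnerProductSpace

namespace CahnHilliard
noncomputable section

section
variable {H : Type*} [NormedAddCommGroup H] [InnerProductSpace ℝ H]

/-- `φ` is a cylindrical function of class `C¹_b` with respect to the orthonormal family `b`:
`φ(x) = ϕ(x_1, …, x_n)`, where `x_i = ⟪x, b i⟫` and `ϕ ∈ C¹_b(ℝⁿ)`. -/
def IsCylindrical (b : ℕ → H) (φ : H → ℝ) : Prop :=
  ∃ (n : ℕ) (ϕ : (Fin n → ℝ) → ℝ), ContDiff ℝ 1 ϕ ∧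
    (∃ M : ℝ, ∀ z, |ϕ z| ≤ M ∧ ‖fderiv ℝ ϕ z‖ ≤ M) ∧ ∀ x, φ x = ϕ fun i => ⟪x, b i⟫

/-- The vector `Q^θ Dφ(x) = ∑ₖ λₖ^θ D_kφ(x) bₖ`, where `Q bₖ = λₖ bₖ`. For a cylindrical function
the sum is finite. -/
def weightedGradient (b : ℕ → H) (lam : ℕ → ℝ) (θ : ℝ) (φ : H → ℝ) (x : H) : H :=
  ∑' k, (lam k ^ θ * fderiv ℝ φ x (b k)) • b k

/-- `u ∈ W^{1,q}_θ(H, μ)` with `Q^θ Du = F`: the pair `(u, F)` belongs to the closure in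
`L^q(H, μ) × L^q(H, μ; H)` of the graph of `Q^θ D`, defined on the cylindrical `C¹_b` functions. -/
def HasSobolevGradient [MeasurableSpace H] (μ : Measure H) (b : ℕ → H) (lam : ℕ → ℝ) (θ q : ℝ)
    (u : H → ℝ) (F : H → H) : Prop :=
  MemLp u (ENNReal.ofReal q) μ ∧ MemLp F (ENNReal.ofReal q) μ ∧
  ∃ φ : ℕ → H → ℝ, (∀ n, IsCylindrical b (φ n)) ∧
    Tendsto (fun n => eLpNorm (fun x => φ n x - u x) (ENNReal.ofReal q) μ) atTop (𝓝 0) ∧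
    Tendsto (fun n => eLpNorm (fun x => weightedGradient b lam θ (φ n) x - F x)
      (ENNReal.ofReal q) μ) atTop (𝓝 0)

/-- `Uₐ → U` in `W^{1,q}_θ(H, μ)` as `a → 0⁺`, for a function `U` with values in `ℝ ∪ {+∞}`: `U` is
finite almost everywhere, `U` and all `Uₐ` belong to `W^{1,q}_θ(H, μ)`, and `Uₐ → U` in `L^q` and
`Q^θ DUₐ → Q^θ DU` in `L^q`. -/
def TendstoSobolev [MeasurableSpace H] (μ : Measure H) (b : ℕ → H) (lam : ℕ → ℝ) (θ q : ℝ)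
    (Ua : ℝ → H → ℝ) (U : H → EReal) : Prop :=
  (∀ᵐ x ∂μ, U x ≠ ⊤ ∧ U x ≠ ⊥) ∧
  ∃ (Fa : ℝ → H → H) (F : H → H),
    (∀ α > 0, HasSobolevGradient μ b lam θ q (Ua α) (Fa α)) ∧
    HasSobolevGradient μ b lam θ q (fun x => (U x).toReal) F ∧
    Tendsto (fun α => eLpNorm (fun x => Ua α x - (U x).toReal) (ENNReal.ofReal q) μ)
      (𝓝[>] 0) (𝓝 0) ∧
    Tendsto (fun α => eLpNorm (fun x => Fa α x - F x) (ENNReal.ofReal q) μ) (𝓝[>] 0) (𝓝 0)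

/-- The functions `Uₐ`, `a > 0`, approximate the convex function `U : H → ℝ ∪ {+∞}`. Convexity of `U`
is convexity of its epigraph; `gradient` is the Riesz representative of the Fréchet derivative. -/
structure ApproximationHypothesis [CompleteSpace H] [MeasurableSpace H] (μ : Measure H)
    (b : ℕ → H) (lam : ℕ → ℝ) (U : H → EReal) (Ua : ℝ → H → ℝ) : Prop where
  ne_bot : ∀ x, U x ≠ ⊥
  convex : Convex ℝ {z : H × ℝ | U z.1 ≤ (z.2 : EReal)}
  convex_approx : ∀ α > 0, ConvexOn ℝ univ (Ua α)
  differentiable_approx : ∀ α > 0, Differentiable ℝ (Ua α)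
  lipschitz_gradient : ∀ α > 0, ∃ L : ℝ≥0, LipschitzWith L (gradient (Ua α))
  bounds : ∃ C : ℝ, ∀ α > 0, ∀ᵐ x ∂μ, C ≤ Ua α x ∧ (Ua α x : EReal) ≤ U x
  tendsto : ∃ p₀ > 2, TendstoSobolev μ b lam (1 / 2) p₀ Ua U

/-- `μ` is the Gaussian measure `N(0, Q)` of mean `0` and covariance operator `Q`. -/
structure IsGaussianMeasure [MeasurableSpace H] [BorelSpace H] (μ : Measure H) (Q : H →L[ℝ] H) :
    Prop where
  isGaussian : ProbabilityTheory.IsGaussian μ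
  mean_zero : ∫ x, x ∂μ = 0
  covariance : ∀ h k : H, ProbabilityTheory.covarianceBilin μ h k = ⟪Q h, k⟫

end

/-- Lebesgue measure on the interval `(0,1)`. -/
abbrev leb : Measure ℝ := volume.restrict (Ioo (0 : ℝ) 1)

/-- The space `L²(0,1)`. -/
abbrev L2 : Type := Lp ℝ 2 leb

/-- Test functions: the elements of `C_c^∞(0,1)`. -/
def IsTest (φ : ℝ → ℝ) : Prop :=
  ContDiff ℝ ∞ φ ∧ HasCompactSupport φ ∧ tsupport φ ⊆ Ioo (0 : ℝ) 1

/-- `v ∈ L²(0,1)` is the weak derivative of `u ∈ L²(0,1)`. -/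
def IsWeakDeriv (u v : L2) : Prop :=
  ∀ φ : ℝ → ℝ, IsTest φ → ∫ ξ, u ξ * deriv φ ξ ∂leb = - ∫ ξ, v ξ * φ ξ ∂leb

theorem IsTest.bdd {φ : ℝ → ℝ} (h : IsTest φ) : ∃ M, ∀ ξ, ‖φ ξ‖ ≤ M :=
  h.1.continuous.bounded_above_of_compact_support h.2.1

theorem IsTest.deriv {φ : ℝ → ℝ} (h : IsTest φ) : IsTest (deriv φ) := by
  refine ⟨?_, h.2.1.deriv, (tsupport_deriv_subset).trans h.2.2⟩
  exact (contDiff_infty_iff_deriv.1 h.1).2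

theorem integrable_mul_test {g φ : ℝ → ℝ} (hg : Integrable g leb) (h : IsTest φ) :
    Integrable (fun ξ => g ξ * φ ξ) leb := by
  obtain ⟨M, hM⟩ := h.bdd
  exact hg.mul_bdd (c := M) h.1.continuous.aestronglyMeasurable (Eventually.of_forall hM)

theorem setIntegral_test {φ : ℝ → ℝ} (h : IsTest φ) (g : ℝ → ℝ) :
    ∫ ξ, g ξ * φ ξ ∂leb = ∫ ξ, φ ξ • g ξ := by
  rw [setIntegral_eq_integral_of_forall_compl_eq_zero]
  · exact integral_congr_ae (Eventually.of_forall fun x => by simp [mul_comm])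
  · intro x hx
    rw [image_eq_zero_of_notMem_tsupport (fun hh => hx (h.2.2 hh)), mul_zero]

theorem ae_zero_of_test {g : ℝ → ℝ} (hg : Integrable g leb)
    (h : ∀ φ, IsTest φ → ∫ ξ, g ξ * φ ξ ∂leb = 0) : g =ᵐ[leb] 0 := by
  have h1 : LocallyIntegrableOn g (Ioo (0:ℝ) 1) volume :=
    IntegrableOn.locallyIntegrableOn hg
  have := isOpen_Ioo.ae_eq_zero_of_integral_contDiff_smul_eq_zero h1
    (fun φ a b c => by rw [← setIntegral_test ⟨a, b, c⟩]; exact h φ ⟨a, b, c⟩)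
  exact (ae_restrict_iff' measurableSet_Ioo).2 this

theorem exists_primitive_test {θ : ℝ → ℝ} (h : IsTest θ) (h0 : ∫ ξ, θ ξ ∂leb = 0) :
    ∃ φ, IsTest φ ∧ deriv φ = θ := by
  have hd : ∀ t, HasDerivAt (fun t => ∫ s in (0:ℝ)..t, θ s) (θ t) t := fun t =>
    intervalIntegral.integral_hasDerivAt_right (h.1.continuous.intervalIntegrable _ _)
      (h.1.continuous.stronglyMeasurableAtFilter _ _) h.1.continuous.continuousAt
  have hde : deriv (fun t => ∫ s in (0:ℝ)..t, θ s) = θ := funext fun t => (hd t).deriv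
  have h01 : ∫ s in (0:ℝ)..1, θ s = 0 := by
    rw [intervalIntegral.integral_of_le zero_le_one, integral_Ioc_eq_integral_Ioo]; exact h0
  have hz : ∀ ξ, ξ ∉ Ioo (0:ℝ) 1 → θ ξ = 0 := fun ξ hx =>
    image_eq_zero_of_notMem_tsupport (fun hh => hx (h.2.2 hh))
  -- support inside a compact subinterval
  obtain ⟨a, b, ha, hb, hab⟩ : ∃ a b : ℝ, 0 < a ∧ b < 1 ∧ tsupport θ ⊆ Icc a b := by
    rcases (tsupport θ).eq_empty_or_nonempty with he | hne
    · exact ⟨1/2, 1/2, by norm_num, by norm_num, by simp [he]⟩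
    · obtain ⟨a, ha, ha'⟩ := h.2.1.isCompact.exists_isLeast hne
      obtain ⟨b, hb, hb'⟩ := h.2.1.isCompact.exists_isGreatest hne
      exact ⟨a, b, (h.2.2 ha).1, (h.2.2 hb).2, fun x hx => ⟨ha' hx, hb' hx⟩⟩
  have hz' : ∀ ξ, ξ ∉ Icc a b → θ ξ = 0 := fun ξ hx =>
    image_eq_zero_of_notMem_tsupport (fun hh => hx (hab hh))
  have hsupp : Function.support (fun t => ∫ s in (0:ℝ)..t, θ s) ⊆ Icc a b := by
    intro t ht
    by_contra hc
    apply ht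
    show ∫ s in (0:ℝ)..t, θ s = 0
    rw [mem_Icc, not_and_or, not_le, not_le] at hc
    rcases hc with hc | hc
    · rw [intervalIntegral.integral_congr (g := fun _ => 0), intervalIntegral.integral_zero]
      intro s hs
      refine hz' s fun hh => ?_
      have := hs.2
      have h2 : max 0 t < a := max_lt ha hc
      linarith [hh.1]
    · have hcomb := intervalIntegral.integral_add_adjacent_intervals
        (h.1.continuous.intervalIntegrable (μ := volume) 0 1)
        (h.1.continuous.intervalIntegrable (μ := volume) 1 t)
      rw [← hcomb, h01, zero_add,
        intervalIntegral.integral_congr (g := fun _ => 0), intervalIntegral.integral_zero]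
      intro s hs
      refine hz' s fun hh => ?_
      have := hs.1
      have h2 : b < min 1 t := lt_min hb hc
      linarith [hh.2]
  have hts : tsupport (fun t => ∫ s in (0:ℝ)..t, θ s) ⊆ Icc a b :=
    closure_minimal hsupp isClosed_Icc
  refine ⟨fun t => ∫ s in (0:ℝ)..t, θ s, ⟨?_, ?_, ?_⟩, hde⟩
  · rw [contDiff_infty_iff_deriv]
    exact ⟨fun t => (hd t).differentiableAt, by rw [hde]; exact h.1⟩
  · exact HasCompactSupport.of_support_subset_isCompact isCompact_Icc hsupp
  · exact fun t ht => ⟨ha.trans_le (hts ht).1, (hts ht).2.trans_lt hb⟩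

theorem exists_test_integral_one : ∃ η, IsTest η ∧ ∫ ξ, η ξ ∂leb = 1 := by
  let b : ContDiffBump (1/2 : ℝ) := ⟨1/8, 1/4, by norm_num, by norm_num⟩
  have ht : IsTest (b.normed volume) := by
    refine ⟨b.contDiff_normed, b.hasCompactSupport_normed, ?_⟩
    rw [b.tsupport_normed_eq, Real.closedBall_eq_Icc]
    intro x hx
    simp only [b] at hx
    constructor <;> linarith [hx.1, hx.2]
  refine ⟨_, ht, ?_⟩
  have := setIntegral_test ht (fun _ => 1)
  simp only [one_mul, smul_eq_mul, mul_one] at this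
  rw [this, b.integral_normed]

/-- du Bois-Reymond's lemma. -/
theorem ae_const_of_test {g : ℝ → ℝ} (hg : Integrable g leb)
    (h : ∀ φ, IsTest φ → ∫ ξ, g ξ * deriv φ ξ ∂leb = 0) : ∃ c : ℝ, g =ᵐ[leb] fun _ => c := by
  obtain ⟨η, hη, hη1⟩ := exists_test_integral_one
  set c := ∫ ξ, g ξ * η ξ ∂leb with hc
  have hint : ∀ {φ}, IsTest φ → Integrable φ leb := fun {φ} hφ => by
    simpa using integrable_mul_test (integrable_const (1:ℝ)) hφ
  refine ⟨c, ?_⟩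
  have key : (fun ξ => g ξ - c) =ᵐ[leb] 0 := by
    refine ae_zero_of_test (hg.sub (integrable_const c)) fun ψ hψ => ?_
    have hθ : IsTest (fun ξ => ψ ξ - (∫ s, ψ s ∂leb) * η ξ) := by
      have hsub : tsupport (fun ξ => ψ ξ - (∫ s, ψ s ∂leb) * η ξ) ⊆ tsupport ψ ∪ tsupport η := by
        refine closure_minimal ?_ ((isClosed_tsupport _).union (isClosed_tsupport _))
        intro x hx
        by_contra hcon
        simp only [mem_union, not_or] at hcon
        apply hx
        simp [image_eq_zero_of_notMem_tsupport hcon.1, image_eq_zero_of_notMem_tsupport hcon.2]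
      exact ⟨hψ.1.sub (contDiff_const.mul hη.1),
        (hψ.2.1.isCompact.union hη.2.1.isCompact).of_isClosed_subset (isClosed_tsupport _) hsub,
        hsub.trans (union_subset hψ.2.2 hη.2.2)⟩
    obtain ⟨φ, hφ, hφd⟩ := exists_primitive_test hθ (by
      rw [integral_sub (hint hψ) ((hint hη).const_mul _), integral_const_mul, hη1]; ring)
    have h1 := h φ hφ
    rw [hφd] at h1
    have e1 : ∫ ξ, g ξ * (ψ ξ - (∫ s, ψ s ∂leb) * η ξ) ∂leb =
        ∫ ξ, g ξ * ψ ξ ∂leb - (∫ s, ψ s ∂leb) * c := by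
      rw [hc, ← integral_const_mul, ← integral_sub (integrable_mul_test hg hψ)
        ((integrable_mul_test hg hη).const_mul _)]
      congr 1; ext ξ; ring
    have e2 : ∫ ξ, (g ξ - c) * ψ ξ ∂leb = ∫ ξ, g ξ * ψ ξ ∂leb - (∫ s, ψ s ∂leb) * c := by
      rw [mul_comm _ c, ← integral_const_mul, ← integral_sub (integrable_mul_test hg hψ)
        ((hint hψ).const_mul _)]
      congr 1; ext ξ; ring
    rw [e2, ← e1, h1]
  filter_upwards [key] with ξ hξ
  simpa [sub_eq_zero] using hξ

theorem L2.integrable (u : L2) : Integrable u leb := (Lp.memLp u).integrable one_le_two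

theorem L2.integral_mul (u v : L2) : ∫ ξ, u ξ * v ξ ∂leb = ⟪u, v⟫ := by
  rw [L2.inner_def]
  exact integral_congr_ae (Eventually.of_forall fun x => by simp [mul_comm])

theorem IsWeakDeriv.unique {u v w : L2} (hv : IsWeakDeriv u v) (hw : IsWeakDeriv u w) :
    v = w := by
  have h : (fun ξ => v ξ - w ξ) =ᵐ[leb] 0 := by
    refine ae_zero_of_test ((L2.integrable v).sub (L2.integrable w)) fun φ hφ => ?_
    have h1 := hv φ hφ
    have h2 := hw φ hφ
    simp_rw [sub_mul]
    rw [integral_sub (integrable_mul_test (L2.integrable v) hφ)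
      (integrable_mul_test (L2.integrable w) hφ)]
    linarith
  refine Lp.ext ?_
  filter_upwards [h] with ξ hξ
  simpa [sub_eq_zero] using hξ

theorem IsWeakDeriv.add {u v u' v' : L2} (h : IsWeakDeriv u u') (k : IsWeakDeriv v v') :
    IsWeakDeriv (u + v) (u' + v') := by
  intro φ hφ
  have e1 : ∀ (a b : L2) (ψ : ℝ → ℝ), IsTest ψ → ∫ ξ, (a + b : L2) ξ * ψ ξ ∂leb =
      ∫ ξ, a ξ * ψ ξ ∂leb + ∫ ξ, b ξ * ψ ξ ∂leb := by
    intro a b ψ hψ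
    rw [← integral_add (integrable_mul_test (L2.integrable a) hψ)
      (integrable_mul_test (L2.integrable b) hψ)]
    refine integral_congr_ae ?_
    filter_upwards [Lp.coeFn_add a b] with ξ hξ
    rw [hξ, Pi.add_apply, add_mul]
  rw [e1 _ _ _ hφ.deriv, e1 _ _ _ hφ, h φ hφ, k φ hφ]; ring

theorem IsWeakDeriv.smul {u u' : L2} (c : ℝ) (h : IsWeakDeriv u u') :
    IsWeakDeriv (c • u) (c • u') := by
  intro φ hφ
  have e1 : ∀ (a : L2) (ψ : ℝ → ℝ), ∫ ξ, (c • a : L2) ξ * ψ ξ ∂leb =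
      c * ∫ ξ, a ξ * ψ ξ ∂leb := by
    intro a ψ
    rw [← integral_const_mul]
    refine integral_congr_ae ?_
    filter_upwards [Lp.coeFn_smul c a] with ξ hξ
    rw [hξ, Pi.smul_apply, smul_eq_mul, mul_assoc]
  rw [e1, e1, h φ hφ]; ring

/-- The elements of `H¹(0,1)` with zero average, as a subspace of `L²(0,1)`. -/
def meanZeroH1Submodule : Submodule ℝ L2 where
  carrier := {u | (∫ ξ, u ξ ∂leb = 0) ∧ ∃ v, IsWeakDeriv u v}
  add_mem' := by
    rintro u v ⟨hu, u', hu'⟩ ⟨hv, v', hv'⟩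
    refine ⟨?_, _, hu'.add hv'⟩
    rw [integral_congr_ae (Lp.coeFn_add u v)]
    simp only [Pi.add_apply]
    rw [integral_add (L2.integrable u) (L2.integrable v), hu, hv, add_zero]
  zero_mem' := by
    refine ⟨?_, 0, ?_⟩
    · rw [integral_congr_ae (Lp.coeFn_zero ℝ 2 leb)]; simp
    · intro φ hφ
      have e : ∀ ψ : ℝ → ℝ, ∫ ξ, (0 : L2) ξ * ψ ξ ∂leb = 0 := fun ψ => by
        rw [← integral_zero ℝ ℝ (μ := leb)]
        refine integral_congr_ae ?_
        filter_upwards [Lp.coeFn_zero ℝ 2 leb] with ξ hξ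
        rw [hξ, Pi.zero_apply, zero_mul]
      rw [e, e, neg_zero]
  smul_mem' := by
    rintro c u ⟨hu, u', hu'⟩
    refine ⟨?_, _, hu'.smul c⟩
    rw [integral_congr_ae (Lp.coeFn_smul c u)]
    simp only [Pi.smul_apply, integral_smul, hu, smul_zero]

/-- The space `{u ∈ H¹(0,1) : ∫ u = 0}`. It is a type of its own because its norm is not the norm of
`L²(0,1)` but the `L²` norm of the weak derivative. -/
def MeanZeroH1 : Type := meanZeroH1Submodule

instance : AddCommGroup MeanZeroH1 := inferInstanceAs (AddCommGroup meanZeroH1Submodule)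
instance : Module ℝ MeanZeroH1 := inferInstanceAs (Module ℝ meanZeroH1Submodule)

/-- The function underlying an element of `MeanZeroH1`. -/
def MeanZeroH1.toL2 : MeanZeroH1 →ₗ[ℝ] L2 := meanZeroH1Submodule.subtype

/-- The weak derivative of an element of `MeanZeroH1`. -/
def MeanZeroH1.weakDeriv : MeanZeroH1 →ₗ[ℝ] L2 where
  toFun u := u.2.2.choose
  map_add' u v := (u + v).2.2.choose_spec.unique (u.2.2.choose_spec.add v.2.2.choose_spec)
  map_smul' c u := (c • u).2.2.choose_spec.unique (u.2.2.choose_spec.smul c)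

theorem MeanZeroH1.isWeakDeriv (u : MeanZeroH1) : IsWeakDeriv u.toL2 u.weakDeriv :=
  u.2.2.choose_spec

theorem MeanZeroH1.integral_eq_zero (u : MeanZeroH1) : ∫ ξ, u.toL2 ξ ∂leb = 0 := u.2.1

theorem MeanZeroH1.toL2_injective : Function.Injective MeanZeroH1.toL2 := Subtype.val_injective

theorem MeanZeroH1.weakDeriv_injective : Function.Injective MeanZeroH1.weakDeriv := by
  refine (injective_iff_map_eq_zero _).2 fun u hu => ?_
  have h := u.isWeakDeriv
  rw [hu] at h
  obtain ⟨c, hc⟩ := ae_const_of_test (L2.integrable u.toL2) fun φ hφ => by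
    rw [h φ hφ, neg_eq_zero, ← integral_zero ℝ ℝ (μ := leb)]
    refine integral_congr_ae ?_
    filter_upwards [Lp.coeFn_zero ℝ 2 leb] with ξ hξ
    rw [hξ, Pi.zero_apply, zero_mul]
  have h0 := u.integral_eq_zero
  rw [integral_congr_ae hc] at h0
  simp at h0
  refine MeanZeroH1.toL2_injective (Lp.ext ?_)
  rw [map_zero]
  filter_upwards [hc, Lp.coeFn_zero ℝ 2 leb] with ξ h1 h2
  rw [h1, h2, h0]; rfl


theorem abs_primitive_le (v : L2) {t : ℝ} (ht : t ∈ Icc (0 : ℝ) 1) :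
    |∫ s in (0:ℝ)..t, v s| ≤ ‖v‖ := by
  have h1 : |∫ s in (0:ℝ)..t, v s| ≤ ∫ s, ‖v s‖ ∂leb := by
    rw [intervalIntegral.integral_of_le ht.1, integral_Ioc_eq_integral_Ioo, ← Real.norm_eq_abs]
    refine (norm_integral_le_integral_norm _).trans ?_
    exact setIntegral_mono_set (L2.integrable v).norm
      (Eventually.of_forall fun _ => norm_nonneg _)
      (LE.le.eventuallyLE (Ioo_subset_Ioo_right ht.2))
  have h2 : ∫ s, ‖v s‖ ∂leb ≤ ‖v‖ := by
    have : IsProbabilityMeasure leb := ⟨by simp⟩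
    rw [integral_norm_eq_lintegral_enorm (Lp.aestronglyMeasurable v),
      ← eLpNorm_one_eq_lintegral_enorm, Lp.norm_def]
    exact ENNReal.toReal_mono (Lp.eLpNorm_ne_top v)
      (eLpNorm_le_eLpNorm_of_exponent_le one_le_two (Lp.aestronglyMeasurable v))
  exact h1.trans h2

theorem exists_isWeakDeriv (v : L2) : ∃ u : MeanZeroH1, u.weakDeriv = v ∧ ‖u.toL2‖ ≤ 2 * ‖v‖ ∧
    ∀ φ : ℝ → ℝ, ContDiff ℝ 1 φ → φ 0 = 0 → φ 1 = 0 →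
      ∫ ξ, u.toL2 ξ * deriv φ ξ ∂leb = - ∫ ξ, v ξ * φ ξ ∂leb := by
  have hvi : IntervalIntegrable v volume 0 1 := by
    rw [intervalIntegrable_iff_integrableOn_Ioo_of_le zero_le_one]
    exact L2.integrable v
  set V : ℝ → ℝ := fun t => ∫ s in (0:ℝ)..t, v s with hV
  have hac : AbsolutelyContinuousOnInterval V 0 1 :=
    hvi.absolutelyContinuousOnInterval_intervalIntegral (c := 0) (by simp)
  have hVc : ContinuousOn V (Icc 0 1) := by
    have := hac.continuousOn
    rwa [uIcc_of_le zero_le_one] at this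
  set c := ∫ t, V t ∂leb with hc
  have hVm : AEStronglyMeasurable V leb :=
    (hVc.mono Ioo_subset_Icc_self).aestronglyMeasurable measurableSet_Ioo
  have hVb : ∀ᵐ t ∂leb, ‖V t‖ ≤ ‖v‖ := by
    refine (ae_restrict_iff' measurableSet_Ioo).2 (Eventually.of_forall fun t ht => ?_)
    exact abs_primitive_le v (Ioo_subset_Icc_self ht)
  have hVi : Integrable V leb := Integrable.of_bound hVm _ hVb
  have hcb : |c| ≤ ‖v‖ := by
    have := norm_integral_le_of_norm_le_const hVb
    simpa using this
  have hb : ∀ᵐ t ∂leb, ‖V t - c‖ ≤ 2 * ‖v‖ := by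
    filter_upwards [hVb] with t ht
    refine (norm_sub_le _ _).trans ?_
    rw [Real.norm_eq_abs c]; linarith
  have hm : MemLp (fun t => V t - c) 2 leb :=
    MemLp.of_bound (hVm.sub aestronglyMeasurable_const) _ hb
  have hco := hm.coeFn_toLp
  have hw' : ∀ φ : ℝ → ℝ, ContDiff ℝ 1 φ → φ 0 = 0 → φ 1 = 0 →
      ∫ ξ, (hm.toLp _ : L2) ξ * deriv φ ξ ∂leb = - ∫ ξ, v ξ * φ ξ ∂leb := by
    intro φ hφ h0 h1
    have hdc : Continuous (deriv φ) := hφ.continuous_deriv le_rfl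
    have hφac : AbsolutelyContinuousOnInterval φ 0 1 := by
      have hi : IntervalIntegrable (deriv φ) volume 0 1 :=
        hdc.intervalIntegrable _ _
      have := hi.absolutelyContinuousOnInterval_intervalIntegral (c := 0) (by simp)
      convert this using 1
      ext t
      rw [intervalIntegral.integral_deriv_eq_sub
        (fun x _ => (hφ.differentiable (by simp)).differentiableAt)
        (hdc.intervalIntegrable _ _), h0, sub_zero]
    have hcac : AbsolutelyContinuousOnInterval (fun t => V t - c) 0 1 := by
      have hcc : AbsolutelyContinuousOnInterval (fun _ : ℝ => c) 0 1 := by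
        exact (LipschitzWith.const c).lipschitzOnWith.absolutelyContinuousOnInterval
      exact hac.fun_sub hcc
    have hparts := hcac.integral_mul_deriv_eq_deriv_mul hφac
    rw [h0, h1] at hparts
    have e1 : ∫ ξ, (hm.toLp _ : L2) ξ * deriv φ ξ ∂leb = ∫ t in (0:ℝ)..1, (V t - c) * deriv φ t := by
      rw [intervalIntegral.integral_of_le zero_le_one, integral_Ioc_eq_integral_Ioo]
      refine integral_congr_ae ?_
      filter_upwards [hco] with ξ hξ
      rw [hξ]
    have e2 : ∫ ξ, v ξ * φ ξ ∂leb = ∫ t in (0:ℝ)..1, deriv (fun t => V t - c) t * φ t := by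
      rw [intervalIntegral.integral_of_le zero_le_one, integral_Ioc_eq_integral_Ioo]
      refine integral_congr_ae ?_
      refine (ae_restrict_iff' measurableSet_Ioo).2 ?_
      filter_upwards [hvi.ae_hasDerivAt_integral] with x hx hx'
      rw [uIcc_of_le zero_le_one] at hx
      rw [((hx (Ioo_subset_Icc_self hx') 0 (by simp)).sub_const c).deriv]
    rw [e1, e2, hparts]; ring
  have hw : IsWeakDeriv (hm.toLp _) v := fun φ hφ =>
    hw' φ (hφ.1.of_le (by simp))
      (image_eq_zero_of_notMem_tsupport (fun hh => by simpa using hφ.2.2 hh))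
      (image_eq_zero_of_notMem_tsupport (fun hh => by simpa using hφ.2.2 hh))
  have hz : ∫ ξ, (hm.toLp _ : L2) ξ ∂leb = 0 := by
    rw [integral_congr_ae hco, integral_sub hVi (integrable_const c)]
    simp [hc]
  let u : MeanZeroH1 := ⟨hm.toLp _, hz, v, hw⟩
  refine ⟨u, u.isWeakDeriv.unique hw, ?_, hw'⟩
  have := Lp.norm_le_of_ae_bound (f := (hm.toLp _ : L2)) (C := 2 * ‖v‖) (by positivity) (by
    filter_upwards [hco, hb] with ξ h1 h2
    rw [h1]; exact h2)
  refine this.trans (le_of_eq ?_)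
  simp [measureUnivNNReal]

/-- A Poincaré inequality. -/
theorem MeanZeroH1.norm_toL2_le (u : MeanZeroH1) : ‖u.toL2‖ ≤ 2 * ‖u.weakDeriv‖ := by
  obtain ⟨w, hw, hb, -⟩ := exists_isWeakDeriv u.weakDeriv
  rwa [MeanZeroH1.weakDeriv_injective hw] at hb

/-- Integration by parts against a `C¹` function that vanishes at the end points. -/
theorem MeanZeroH1.integral_mul_deriv (u : MeanZeroH1) {φ : ℝ → ℝ} (hφ : ContDiff ℝ 1 φ)
    (h0 : φ 0 = 0) (h1 : φ 1 = 0) :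
    ∫ ξ, u.toL2 ξ * deriv φ ξ ∂leb = - ∫ ξ, u.weakDeriv ξ * φ ξ ∂leb := by
  obtain ⟨w, hw, -, hp⟩ := exists_isWeakDeriv u.weakDeriv
  rw [MeanZeroH1.weakDeriv_injective hw] at hp
  exact hp φ hφ h0 h1

/-- The norm `‖u‖ = ‖u'‖_{L²(0,1)}`. -/
instance : NormedAddCommGroup MeanZeroH1 :=
  NormedAddCommGroup.induced MeanZeroH1 L2 MeanZeroH1.weakDeriv MeanZeroH1.weakDeriv_injective

/-- The scalar product `⟪u, v⟫ = ∫ u' v'`. -/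
instance : InnerProductSpace ℝ MeanZeroH1 where
  toNormedSpace := NormedSpace.induced ℝ MeanZeroH1 L2 MeanZeroH1.weakDeriv
  inner u v := ⟪u.weakDeriv, v.weakDeriv⟫
  norm_sq_eq_re_inner u := norm_sq_eq_re_inner (𝕜 := ℝ) u.weakDeriv
  conj_inner_symm u v := inner_conj_symm u.weakDeriv v.weakDeriv
  add_left u v w := by rw [map_add, inner_add_left]
  smul_left u v c := by rw [map_smul, inner_smul_left]

theorem MeanZeroH1.norm_eq (u : MeanZeroH1) : ‖u‖ = ‖u.weakDeriv‖ := rfl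

theorem MeanZeroH1.inner_eq (u v : MeanZeroH1) :
    ⟪u, v⟫ = ∫ ξ, u.weakDeriv ξ * v.weakDeriv ξ ∂leb := (L2.integral_mul _ _).symm

instance : CompleteSpace MeanZeroH1 := by
  let e : MeanZeroH1 ≃ₗᵢ[ℝ] L2 :=
    { LinearEquiv.ofBijective MeanZeroH1.weakDeriv
        ⟨MeanZeroH1.weakDeriv_injective, fun v => (exists_isWeakDeriv v).imp fun _ h => h.1⟩ with
      norm_map' := fun _ => rfl }
  exact (completeSpace_congr (e := e.toEquiv) e.isometry.isUniformEmbedding).2 inferInstance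

/-- The dual space of `MeanZeroH1`, with the dual norm. -/
abbrev X : Type := StrongDual ℝ MeanZeroH1

/-- The canonical isometry `B` of `MeanZeroH1` onto its dual, `Bu(y) = ∫ u' y'`. -/
def B : MeanZeroH1 ≃ₗᵢ[ℝ] X where
  toFun := InnerProductSpace.toDual ℝ MeanZeroH1
  invFun := (InnerProductSpace.toDual ℝ MeanZeroH1).symm
  map_add' := map_add _
  map_smul' c u := by simp
  left_inv u := by simp
  right_inv x := by simp
  norm_map' u := (InnerProductSpace.toDual ℝ MeanZeroH1).norm_map u

theorem B_apply (u y : MeanZeroH1) : B u y = ∫ ξ, u.weakDeriv ξ * y.weakDeriv ξ ∂leb :=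
  u.inner_eq y

/-- The scalar product of `X` that induces the dual norm. -/
instance : InnerProductSpace ℝ X where
  toNormedSpace := inferInstance
  inner x y := ⟪B.symm x, B.symm y⟫
  norm_sq_eq_re_inner x := by
    rw [← norm_sq_eq_re_inner (𝕜 := ℝ) (B.symm x), LinearIsometryEquiv.norm_map]
  conj_inner_symm x y := inner_conj_symm (B.symm x) (B.symm y)
  add_left x y z := by rw [map_add, inner_add_left]
  smul_left x y c := by rw [map_smul, inner_smul_left]

/-- The function `g` on `(0,1)` represents the functional `y ↦ ∫ g y`. -/
def Represents (g : ℝ → ℝ) (x : X) : Prop := ∀ y : MeanZeroH1, x y = ∫ ξ, g ξ * y.toL2 ξ ∂leb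

/-- `MeanZeroH1` as a subspace of `X`: `u` is identified with the functional `y ↦ ∫ u y`. -/
def embed : MeanZeroH1 →L[ℝ] X :=
  LinearMap.mkContinuous₂
    (LinearMap.mk₂ ℝ (fun u y : MeanZeroH1 => ⟪u.toL2, y.toL2⟫)
      (fun _ _ _ => by rw [map_add, inner_add_left]) (fun _ _ _ => by rw [map_smul, real_inner_smul_left]; rfl)
      (fun _ _ _ => by rw [map_add, inner_add_right]) (fun _ _ _ => by rw [map_smul, real_inner_smul_right]; rfl))
    4 (fun u y => by
      refine (norm_inner_le_norm (𝕜 := ℝ) u.toL2 y.toL2).trans ?_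
      have h1 := u.norm_toL2_le
      have h2 := y.norm_toL2_le
      rw [← MeanZeroH1.norm_eq] at h1 h2
      calc ‖u.toL2‖ * ‖y.toL2‖ ≤ (2 * ‖u‖) * (2 * ‖y‖) := by gcongr
        _ = 4 * ‖u‖ * ‖y‖ := by ring)

theorem represents_embed (u : MeanZeroH1) : Represents (u.toL2) (embed u) := fun _ =>
  (L2.integral_mul _ _).symm

/-- The operator `I + αB`, where `B` is regarded as an unbounded operator in `X` whose domain is
`MeanZeroH1`, identified with a subspace of `X`. -/
def onePlus (α : ℝ) : MeanZeroH1 →L[ℝ] X := embed + α • (B : MeanZeroH1 →L[ℝ] X)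

theorem onePlus_bijective {α : ℝ} (hα : 0 < α) : Function.Bijective (onePlus α) := by
  have hco : IsCoercive (onePlus α : MeanZeroH1 →L[ℝ] MeanZeroH1 →L[ℝ] ℝ) := by
    refine ⟨α, hα, fun u => ?_⟩
    have : onePlus α u u = ⟪u.toL2, u.toL2⟫ + α * ⟪u, u⟫ := rfl
    rw [this, real_inner_self_eq_norm_sq, real_inner_self_eq_norm_sq]
    nlinarith [sq_nonneg ‖u.toL2‖]
  have heq : (onePlus α : MeanZeroH1 → X) = B ∘ hco.continuousLinearEquivOfBilin := by
    ext u y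
    exact (hco.continuousLinearEquivOfBilin_apply u y).symm
  rw [heq]
  exact B.bijective.comp hco.continuousLinearEquivOfBilin.bijective

/-- The operator `(I + αB)⁻¹` for `α > 0`; its values lie in the domain `MeanZeroH1` of `B`. -/
def resolvent (α : ℝ) : X →L[ℝ] MeanZeroH1 := (onePlus α).inverse

theorem onePlus_resolvent {α : ℝ} (hα : 0 < α) (x : X) :
    embed (resolvent α x) + α • B (resolvent α x) = x := by
  let e : MeanZeroH1 ≃L[ℝ] X := 
    ContinuousLinearEquiv.ofBijective (𝕜 := ℝ) (E := MeanZeroH1) (F := X) (onePlus α)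
      (LinearMap.ker_eq_bot.2 (onePlus_bijective hα).1)
      (LinearMap.range_eq_top.2 (onePlus_bijective hα).2)
  have h : resolvent α = e.symm := by
    have : onePlus α = (e : MeanZeroH1 →L[ℝ] X) := rfl
    rw [resolvent, this, ContinuousLinearMap.inverse_equiv]
  rw [h]
  exact e.apply_symm_apply x

theorem memLp_of_continuous {g : ℝ → ℝ} (hg : Continuous g) : MemLp g 2 leb := by
  obtain ⟨C, hC⟩ := isCompact_Icc.exists_bound_of_continuousOn (s := Icc (0 : ℝ) 1) hg.continuousOn
  exact MemLp.of_bound hg.aestronglyMeasurable C ((ae_restrict_iff' measurableSet_Ioo).2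
    (Eventually.of_forall fun ξ hξ => hC ξ (Ioo_subset_Icc_self hξ)))

/-- The element of `L²(0,1)` given by a continuous function. -/
def contL2 {g : ℝ → ℝ} (hg : Continuous g) : L2 := (memLp_of_continuous hg).toLp

theorem contL2_ae {g : ℝ → ℝ} (hg : Continuous g) : contL2 hg =ᵐ[leb] g :=
  (memLp_of_continuous hg).coeFn_toLp

theorem isWeakDeriv_of_hasDerivAt {g g' : ℝ → ℝ} (hg : ∀ ξ, HasDerivAt g (g' ξ) ξ)
    (hc : Continuous g) (hc' : Continuous g') :
    IsWeakDeriv (contL2 hc) (contL2 hc') := by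
  intro φ hφ
  have h0 : ∀ ξ, ξ ∉ Ioo (0:ℝ) 1 → φ ξ = 0 := fun ξ hx =>
    image_eq_zero_of_notMem_tsupport (fun hh => hx (hφ.2.2 hh))
  have hp := intervalIntegral.integral_mul_deriv_eq_deriv_mul (a := 0) (b := 1)
    (fun x _ => hg x) (fun x _ => ((hφ.1.differentiable (by simp)) x).hasDerivAt)
    (hc'.intervalIntegrable _ _) (hφ.deriv.1.continuous.intervalIntegrable _ _)
  rw [h0 0 (by simp), h0 1 (by simp)] at hp
  have e : ∀ {f : ℝ → ℝ} (hf : Continuous f) (ψ : ℝ → ℝ),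
      ∫ ξ, (contL2 hf : L2) ξ * ψ ξ ∂leb = ∫ ξ in (0:ℝ)..1, f ξ * ψ ξ := by
    intro f hf ψ
    rw [intervalIntegral.integral_of_le zero_le_one, integral_Ioc_eq_integral_Ioo]
    refine integral_congr_ae ?_
    filter_upwards [contL2_ae hf] with ξ hξ
    rw [hξ]
  rw [e, e, hp]; ring

/-- The frequency `(k+1)π`, `k = 0, 1, 2, …`. -/
def freq (k : ℕ) : ℝ := (k + 1) * Real.pi

theorem freq_pos (k : ℕ) : 0 < freq k := by unfold freq; positivity

/-- The function `√2 cos((k+1)πξ) / ((k+1)π)`. -/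
def cosFun (k : ℕ) (ξ : ℝ) : ℝ := √2 * Real.cos (freq k * ξ) / freq k

theorem continuous_cosFun (k : ℕ) : Continuous (cosFun k) := by unfold cosFun; fun_prop

/-- The derivative `-√2 sin((k+1)πξ)` of `cosFun k`. -/
def sinFun (k : ℕ) (ξ : ℝ) : ℝ := -(√2 * Real.sin (freq k * ξ))

theorem continuous_sinFun (k : ℕ) : Continuous (sinFun k) := by unfold sinFun; fun_prop

theorem hasDerivAt_cosFun (k : ℕ) (ξ : ℝ) : HasDerivAt (cosFun k) (sinFun k ξ) ξ := by
  have h := (((Real.hasDerivAt_cos (freq k * ξ)).comp ξ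
    ((hasDerivAt_id ξ).const_mul (freq k))).const_mul √2).div_const (freq k)
  refine h.congr_deriv ?_
  have := (freq_pos k).ne'
  unfold sinFun
  field_simp

theorem integral_cosFun (k : ℕ) : ∫ ξ, cosFun k ξ ∂leb = 0 := by
  have hs : ∀ ξ, HasDerivAt (fun ξ => √2 * Real.sin (freq k * ξ) / freq k ^ 2) (cosFun k ξ) ξ := by
    intro ξ
    have h := (((Real.hasDerivAt_sin (freq k * ξ)).comp ξ
      ((hasDerivAt_id ξ).const_mul (freq k))).const_mul √2).div_const (freq k ^ 2)
    refine h.congr_deriv ?_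
    have := (freq_pos k).ne'
    unfold cosFun
    field_simp
  rw [← integral_Ioc_eq_integral_Ioo, ← intervalIntegral.integral_of_le zero_le_one,
    intervalIntegral.integral_eq_sub_of_hasDerivAt (fun x _ => hs x)
      ((continuous_cosFun k).intervalIntegrable _ _)]
  have : Real.sin (freq k) = 0 := by
    have := Real.sin_nat_mul_pi (k + 1)
    push_cast at this
    exact this
  simp [this]

/-- The orthonormal basis `√2 cos((k+1)πξ) / ((k+1)π)`, `k = 0, 1, 2, …`, of `MeanZeroH1`. -/
def cosBasis (k : ℕ) : MeanZeroH1 :=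
  ⟨contL2 (continuous_cosFun k),
    by rw [integral_congr_ae (contL2_ae _), integral_cosFun],
    _, isWeakDeriv_of_hasDerivAt (hasDerivAt_cosFun k) (continuous_cosFun k) (continuous_sinFun k)⟩

/-- The orthonormal basis of `X` that is the image under `B` of `cosBasis`. -/
def dualBasis (k : ℕ) : X := B (cosBasis k)

/-- The bounded operator `B⁻¹` in `X`. -/
def Binv : X →L[ℝ] X := embed ∘L (B.symm : X →L[ℝ] MeanZeroH1)

/-- The covariance operator `Q = -A⁻¹/2`, where `A = -B²`. -/
def Q : X →L[ℝ] X := (1 / 2 : ℝ) • (Binv ∘L Binv)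

/-- The eigenvalues `1 / (2 ((k+1)π)⁴)` of `Q`. -/
def eigenvalue (k : ℕ) : ℝ := 1 / (2 * freq k ^ 4)

theorem weakDeriv_cosBasis (k : ℕ) :
    (cosBasis k).weakDeriv = contL2 (continuous_sinFun k) :=
  (cosBasis k).isWeakDeriv.unique
    (isWeakDeriv_of_hasDerivAt (hasDerivAt_cosFun k) (continuous_cosFun k) (continuous_sinFun k))

theorem embed_cosBasis (k : ℕ) : embed (cosBasis k) = (1 / freq k ^ 2) • dualBasis k := by
  ext y
  have hk := (freq_pos k).ne'
  have h1 : embed (cosBasis k) y = ∫ ξ, y.toL2 ξ * cosFun k ξ ∂leb := by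
    rw [represents_embed (cosBasis k) y]
    refine integral_congr_ae ?_
    filter_upwards [contL2_ae (continuous_cosFun k)] with ξ hξ
    have : (cosBasis k).toL2 ξ = (contL2 (continuous_cosFun k) : L2) ξ := rfl
    rw [this, hξ, mul_comm]
  have h2 : dualBasis k y = ∫ ξ, y.weakDeriv ξ * sinFun k ξ ∂leb := by
    rw [dualBasis, B_apply, weakDeriv_cosBasis]
    refine integral_congr_ae ?_
    filter_upwards [contL2_ae (continuous_sinFun k)] with ξ hξ
    rw [hξ, mul_comm]
  have hd : ∀ ξ, deriv (sinFun k) ξ = -(freq k ^ 2) * cosFun k ξ := by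
    intro ξ
    have h := (((Real.hasDerivAt_sin (freq k * ξ)).comp ξ
      ((hasDerivAt_id ξ).const_mul (freq k))).const_mul √2).neg
    refine (h.congr_deriv (?_ : _ = -(freq k ^ 2) * cosFun k ξ)).deriv
    unfold cosFun
    field_simp
  have hp := y.integral_mul_deriv (φ := sinFun k) (by unfold sinFun; fun_prop)
    (by simp [sinFun]) (by
      have := Real.sin_nat_mul_pi (k + 1)
      push_cast at this
      simp [sinFun, freq, this])
  simp_rw [hd] at hp
  have h3 : ∫ ξ, y.toL2 ξ * (-(freq k ^ 2) * cosFun k ξ) ∂leb =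
      -(freq k ^ 2) * ∫ ξ, y.toL2 ξ * cosFun k ξ ∂leb := by
    rw [← integral_const_mul]
    congr 1; ext ξ; ring
  rw [h3, ← h1, ← h2] at hp
  change _ = (1 / freq k ^ 2) * dualBasis k y
  field_simp
  linarith

theorem Q_dualBasis (k : ℕ) : Q (dualBasis k) = eigenvalue k • dualBasis k := by
  have hb : Binv (dualBasis k) = (1 / freq k ^ 2) • dualBasis k := by
    rw [← embed_cosBasis]
    change embed (B.symm (B (cosBasis k))) = _
    rw [LinearIsometryEquiv.symm_apply_apply]
  change (1 / 2 : ℝ) • Binv (Binv (dualBasis k)) = _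
  rw [hb, map_smul, hb, smul_smul, smul_smul, eigenvalue]
  congr 1
  have := (freq_pos k).ne'
  field_simp

theorem integral_cos_int_mul_pi {m : ℤ} (hm : m ≠ 0) :
    ∫ ξ in (0:ℝ)..1, Real.cos (m * Real.pi * ξ) = 0 := by
  have hc : (m * Real.pi : ℝ) ≠ 0 := mul_ne_zero (by exact_mod_cast hm) Real.pi_ne_zero
  rw [intervalIntegral.integral_comp_mul_left (fun x => Real.cos x) hc]
  simp [Real.sin_int_mul_pi]

theorem orthonormal_dualBasis : Orthonormal ℝ dualBasis := by
  rw [orthonormal_iff_ite]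
  intro j k
  have h1 : ⟪dualBasis j, dualBasis k⟫ = ∫ ξ in (0:ℝ)..1, sinFun j ξ * sinFun k ξ := by
    change ⟪B.symm (B (cosBasis j)), B.symm (B (cosBasis k))⟫ = _
    rw [LinearIsometryEquiv.symm_apply_apply, LinearIsometryEquiv.symm_apply_apply,
      MeanZeroH1.inner_eq, weakDeriv_cosBasis, weakDeriv_cosBasis,
      intervalIntegral.integral_of_le zero_le_one, integral_Ioc_eq_integral_Ioo]
    refine integral_congr_ae ?_
    filter_upwards [contL2_ae (continuous_sinFun j), contL2_ae (continuous_sinFun k)] with ξ h h'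
    rw [h, h']
  have h2 : ∀ ξ : ℝ, sinFun j ξ * sinFun k ξ =
      Real.cos (((j - k : ℤ) : ℝ) * Real.pi * ξ) -
        Real.cos (((j + k + 2 : ℤ) : ℝ) * Real.pi * ξ) := by
    intro ξ
    have e1 : ((j - k : ℤ) : ℝ) * Real.pi * ξ = freq j * ξ - freq k * ξ := by
      push_cast; unfold freq; ring
    have e2 : ((j + k + 2 : ℤ) : ℝ) * Real.pi * ξ = freq j * ξ + freq k * ξ := by
      push_cast; unfold freq; ring
    have hs : √2 * √2 = (2 : ℝ) := Real.mul_self_sqrt (by norm_num)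
    rw [e1, e2, Real.cos_sub, Real.cos_add]
    unfold sinFun
    linear_combination (Real.sin (freq j * ξ) * Real.sin (freq k * ξ)) * hs
  rw [h1]
  simp_rw [h2]
  rw [intervalIntegral.integral_sub (Continuous.intervalIntegrable (by fun_prop) _ _)
    (Continuous.intervalIntegrable (by fun_prop) _ _),
    integral_cos_int_mul_pi (m := j + k + 2) (by omega), sub_zero]
  by_cases hjk : j = k
  · simp [hjk]
  · rw [if_neg hjk, integral_cos_int_mul_pi (by omega)]

/-- `x ∈ X` is the element that corresponds to the function `g ∈ L^p(0,1)` with zero average. -/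
def IsAdmissible (p : ℝ) (g : ℝ → ℝ) (x : X) : Prop :=
  MemLp g (ENNReal.ofReal p) leb ∧ ∫ ξ, g ξ ∂leb = 0 ∧ Represents g x

/-- An element of `X` corresponds to at most one function, up to null sets. -/
theorem IsAdmissible.ae_eq {p : ℝ} (hp : 1 ≤ p) {g h : ℝ → ℝ} {x : X} (hg : IsAdmissible p g x)
    (hh : IsAdmissible p h x) : g =ᵐ[leb] h := by
  have hp' : 1 ≤ ENNReal.ofReal p := by simpa using hp
  have hgi := hg.1.integrable hp'
  have hhi := hh.1.integrable hp'
  have key : ∀ φ, IsTest φ → ∫ ξ, (g ξ - h ξ) * deriv φ ξ ∂leb = 0 := by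
    intro φ hφ
    have hc := hφ.deriv.1.continuous
    have h0 : ∫ ξ, (contL2 hc : L2) ξ ∂leb = 0 := by
      rw [integral_congr_ae (contL2_ae hc), ← integral_Ioc_eq_integral_Ioo,
        ← intervalIntegral.integral_of_le zero_le_one, intervalIntegral.integral_deriv_eq_sub
          (fun x _ => (hφ.1.differentiable (by simp)) x) (hc.intervalIntegrable _ _)]
      have h00 : φ 0 = 0 :=
        image_eq_zero_of_notMem_tsupport (fun hh => by simpa using hφ.2.2 hh)
      have h11 : φ 1 = 0 :=
        image_eq_zero_of_notMem_tsupport (fun hh => by simpa using hφ.2.2 hh)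
      rw [h00, h11, sub_zero]
    let y : MeanZeroH1 := ⟨contL2 hc, h0, _,
      isWeakDeriv_of_hasDerivAt
        (fun ξ => ((hφ.deriv.1.differentiable (by simp)) ξ).hasDerivAt) hc
        hφ.deriv.deriv.1.continuous⟩
    have e1 : ∀ {w : ℝ → ℝ}, Represents w x → x y = ∫ ξ, w ξ * deriv φ ξ ∂leb := by
      intro w hw
      rw [hw y]
      refine integral_congr_ae ?_
      filter_upwards [contL2_ae hc] with ξ hξ
      have : y.toL2 ξ = (contL2 hc : L2) ξ := rfl
      rw [this, hξ]
    simp_rw [sub_mul]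
    rw [integral_sub (integrable_mul_test hgi hφ.deriv) (integrable_mul_test hhi hφ.deriv),
      ← e1 hg.2.2, ← e1 hh.2.2, sub_self]
  obtain ⟨c, hc⟩ := ae_const_of_test (hgi.sub hhi) key
  have hc0 : c = 0 := by
    have := integral_congr_ae hc
    simp only [Pi.sub_apply] at this
    rw [integral_sub hgi hhi, hg.2.1, hh.2.1] at this
    simpa using this.symm
  filter_upwards [hc] with ξ hξ
  rw [hc0] at hξ
  simpa [sub_eq_zero] using hξ

open Classical in
/-- `U(x) = ∫ Φ(x(ξ)) dξ` if `x ∈ L^p(0,1)`, and `U(x) = +∞` otherwise. -/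
def U (Φ : ℝ → ℝ) (p : ℝ) (x : X) : EReal :=
  if h : ∃ g, IsAdmissible p g x then ((∫ ξ, Φ (h.choose ξ) ∂leb : ℝ) : EReal) else ⊤

theorem U_eq {Φ : ℝ → ℝ} {p : ℝ} (hp : 1 ≤ p) {g : ℝ → ℝ} {x : X} (hg : IsAdmissible p g x) :
    U Φ p x = ((∫ ξ, Φ (g ξ) ∂leb : ℝ) : EReal) := by
  have h : ∃ g, IsAdmissible p g x := ⟨g, hg⟩
  rw [U, dif_pos h]
  congr 1
  refine integral_congr_ae ?_
  filter_upwards [h.choose_spec.ae_eq hp hg] with ξ hξ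
  rw [hξ]

/-- The Moreau–Yosida approximations of `Φ`. -/
def moreauYosida (Φ : ℝ → ℝ) (α r : ℝ) : ℝ := ⨅ s : ℝ, Φ s + (r - s) ^ 2 / (2 * α)

/-- The function `x ↦ ∫ Φ_α((I + αB)⁻¹x(ξ)) dξ`, where `Φ_α` is the Moreau–Yosida approximation of `Φ`. -/
def UApprox (Φ : ℝ → ℝ) (α : ℝ) (x : X) : ℝ :=
  ∫ ξ, moreauYosida Φ α ((resolvent α x).toL2 ξ) ∂leb

end

end CahnHilliard

namespace CahnHilliard
noncomputable section

/-! Write ω_k for `freq k`, f_k for `dualBasis k` and λ_k for its eigenvalue. Under μ the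
coefficient of x along f_k is a centred Gaussian of variance λ_k, and f_k is the function η_k = √2
ω_k cos(ω_k ξ). Thus λ_k η_k(ξ)² ≤ ω_k⁻², which is summable uniformly in ξ
(`eigenvalue_mul_etaFun_sq_le`). So almost every x is a function, realised by a Gaussian field v(x,
ξ) on X × (0,1) with finite moments of every order (`IsField.ae_isAdmissible`,
`IsField.eLpNorm_le`). The resolvent R = (I + αB)⁻¹ multiplies the k-th coefficient by (1 +
αω_k²)⁻¹. It gives a second field v', and the variance of v' - v is bounded uniformly in ξ by
`errorVariance α`, which tends to 0.

Regularity of U_α. The derivative of Φ_α is the Yosida approximation ψ_α = Φ' ∘ (I + αΦ')⁻¹, which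
is α⁻¹-Lipschitz. Hence w ↦ ∫ Φ_α(w) is convex on L² with Lipschitz gradient, and U_α is its
composition with the bounded map R : X → L². In particular DU_α(x) = R* ψ_α(Rx).

The bound U_α ≤ U. With u = Rx one has x - u = αBu, so the subgradient inequality reduces ∫ Φ_α(u) ≤
∫ Φ_α(x) to ∫ ψ_α(u) Bu = ∫ ψ_α'(u) u'² ≥ 0, an integration by parts with Neumann conditions. It is
carried out for cosine sums and passed to the limit (`ae_UApprox_le`); finally Φ_α ≤ Φ.

Convergence. The growth of Φ'' bounds Φ_α(v') - Φ(v) and ψ_α(v') - Φ'(v) by (|v' - v| + α) times a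
polynomial in |v|, |v'| (`exists_growth_bounds`), and Hölder's inequality with the Gaussian moments
makes this small in every L^q. Since Q^{1/2} = 2^{-1/2} B⁻¹, the functional Q^{1/2}DU_α(x) sends y
to 2^{-1/2} ∫ ψ_α(v') Ry. Because ‖Ry - y‖ ≤ √α ‖y‖_H in L², it converges in the dual norm to y ↦
2^{-1/2} ∫ Φ'(v) y (`enorm_sqrtQ_gradUApprox_sub_le`).

Membership in the Sobolev space. A function with Lipschitz gradient is approximated by cylindrical
functions obtained from finitely many coordinates bounded by a sine cutoff
(`hasSobolevGradient_of_lipschitz_gradient`). This covers U_α, and U follows because the graph of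
the weighted gradient is closed (`HasSobolevGradient.of_tendsto`). -/

theorem tendsto_eLpNorm_of_dominated {Ω E : Type*} [MeasurableSpace Ω] [NormedAddCommGroup E]
    {μ : Measure Ω} {q : ℝ≥0∞} (hq0 : q ≠ 0) (hq : q ≠ ⊤) {f : ℕ → Ω → E} {g : Ω → E}
    {bound : Ω → ℝ} (hf : ∀ n, AEStronglyMeasurable (f n) μ) (hg : AEStronglyMeasurable g μ)
    (hb : MemLp bound q μ) (hfb : ∀ n, ∀ᵐ x ∂μ, ‖f n x‖ ≤ bound x)
    (h : ∀ᵐ x ∂μ, Tendsto (fun n => f n x) atTop (𝓝 (g x))) :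
    Tendsto (fun n => eLpNorm (fun x => f n x - g x) q μ) atTop (𝓝 0) := by
  have hq' : 0 < q.toReal := ENNReal.toReal_pos hq0 hq
  simp_rw [eLpNorm_eq_lintegral_rpow_enorm_toReal hq0 hq]
  have key : Tendsto (fun n => ∫⁻ x, ‖f n x - g x‖ₑ ^ q.toReal ∂μ) atTop (𝓝 (∫⁻ _, 0 ∂μ)) := by
    refine tendsto_lintegral_of_dominated_convergence' (fun x => ‖(2 : ℝ) * bound x‖ₑ ^ q.toReal)
      (fun n => ((hf n).sub hg).enorm.pow_const _) (fun n => ?_) ?_ ?_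
    · filter_upwards [ae_all_iff.2 hfb, h] with x hx hx'
      refine ENNReal.rpow_le_rpow ?_ hq'.le
      have h1 : ‖g x‖ ≤ bound x := le_of_tendsto hx'.norm (Eventually.of_forall fun n => hx n)
      rw [← ofReal_norm, ← ofReal_norm]
      refine ENNReal.ofReal_le_ofReal ((norm_sub_le _ _).trans ?_)
      rw [Real.norm_eq_abs]
      exact le_trans (by linarith [hx n]) (le_abs_self _)
    · exact (lintegral_rpow_enorm_lt_top_of_eLpNorm_lt_top hq0 hq (hb.const_mul 2).2).ne
    · filter_upwards [h] with x hx
      have h1 : Tendsto (fun n => ‖f n x - g x‖ₑ) atTop (𝓝 0) := by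
        simpa using (hx.sub_const (g x)).enorm
      have := (ENNReal.continuous_rpow_const (y := q.toReal)).continuousAt.tendsto.comp h1
      simpa [Function.comp_def, ENNReal.zero_rpow_of_pos hq'] using this
  have := (ENNReal.continuous_rpow_const (y := 1 / q.toReal)).continuousAt.tendsto.comp key
  simpa [Function.comp_def, hq'] using this

/-! ### Cylindrical functions, closedness of the weighted gradient, diagonal truncations. -/

section
variable {H : Type*} [NormedAddCommGroup H] [InnerProductSpace ℝ H]

/-- The function ignores the coordinates with index ≥ n, so its derivative along those basis vectors
vanishes and the series is a finite sum. -/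
theorem weightedGradient_comp {b : ℕ → H} (hb : Orthonormal ℝ b) (lam : ℕ → ℝ) (θ : ℝ) {n : ℕ}
    {ϕ : (Fin n → ℝ) → ℝ} (hϕ : ContDiff ℝ 1 ϕ) {φ : H → ℝ} (h : ∀ x, φ x = ϕ fun i => ⟪x, b i⟫)
    (x : H) : weightedGradient b lam θ φ x =
      ∑ k ∈ Finset.range n, (lam k ^ θ * fderiv ℝ φ x (b k)) • b k := by
  refine tsum_eq_sum fun k hk => ?_
  let L : H →L[ℝ] (Fin n → ℝ) := ContinuousLinearMap.pi fun i => innerSL ℝ (b i)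
  have hφ : φ = ϕ ∘ L := by
    ext x; rw [h]; simp only [Function.comp]; congr 1; ext i; exact real_inner_comm _ _
  have hLk : L (b k) = 0 := by
    ext i
    have : (i : ℕ) ≠ k := fun hh => hk (by rw [← hh]; exact Finset.mem_range.2 i.2)
    exact hb.2 this
  rw [hφ, ((hϕ.differentiable (by simp) _).hasFDerivAt.comp x L.hasFDerivAt).fderiv]
  simp [hLk]

theorem IsCylindrical.contDiff {b : ℕ → H} {φ : H → ℝ} (h : IsCylindrical b φ) :
    ContDiff ℝ 1 φ := by
  obtain ⟨n, ϕ, hϕ, -, h⟩ := h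
  have : φ = fun x => ϕ fun i => ⟪x, b i⟫ := funext h
  rw [this]
  exact hϕ.comp (contDiff_pi.2 fun i => contDiff_id.inner ℝ contDiff_const)

theorem IsCylindrical.continuous_weightedGradient {b : ℕ → H} (hb : Orthonormal ℝ b)
    (lam : ℕ → ℝ) (θ : ℝ) {φ : H → ℝ} (h : IsCylindrical b φ) :
    Continuous (weightedGradient b lam θ φ) := by
  have hc := h.contDiff.continuous_fderiv (by simp)
  obtain ⟨n, ϕ, hϕ, -, h⟩ := h
  rw [funext (weightedGradient_comp hb lam θ hϕ h)]
  fun_prop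

theorem tendsto_eLpNorm_sub_trans {Ω E : Type*} [MeasurableSpace Ω] [NormedAddCommGroup E]
    {μ : Measure Ω} {q : ℝ≥0∞} (hq : 1 ≤ q) {f g : ℕ → Ω → E} {h : Ω → E}
    (hf : ∀ n, AEStronglyMeasurable (f n) μ) (hg : ∀ n, AEStronglyMeasurable (g n) μ)
    (hh : AEStronglyMeasurable h μ)
    (h1 : Tendsto (fun n => eLpNorm (fun x => f n x - g n x) q μ) atTop (𝓝 0))
    (h2 : Tendsto (fun n => eLpNorm (fun x => g n x - h x) q μ) atTop (𝓝 0)) :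
    Tendsto (fun n => eLpNorm (fun x => f n x - h x) q μ) atTop (𝓝 0) := by
  refine tendsto_of_tendsto_of_tendsto_of_le_of_le tendsto_const_nhds
    (by simpa using h1.add h2) (fun _ => zero_le) fun n => ?_
  have := eLpNorm_add_le ((hf n).sub (hg n)) ((hg n).sub hh) hq
  refine le_trans (le_of_eq ?_) this
  congr 1; ext x; simp

/-- The pairs `(u, Q^θ Du)` form a closed set in `L^q × L^q`. -/
theorem HasSobolevGradient.of_tendsto [MeasurableSpace H] [OpensMeasurableSpace H]
    [SecondCountableTopology H] {μ : Measure H} {b : ℕ → H} (hb : Orthonormal ℝ b) {lam : ℕ → ℝ}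
    {θ q : ℝ} (hq : 1 ≤ q) {u : H → ℝ} {F : H → H} {un : ℕ → H → ℝ} {Fn : ℕ → H → H}
    (h : ∀ n, HasSobolevGradient μ b lam θ q (un n) (Fn n))
    (hu : MemLp u (ENNReal.ofReal q) μ) (hF : MemLp F (ENNReal.ofReal q) μ)
    (hun : Tendsto (fun n => eLpNorm (fun x => un n x - u x) (ENNReal.ofReal q) μ) atTop (𝓝 0))
    (hFn : Tendsto (fun n => eLpNorm (fun x => Fn n x - F x) (ENNReal.ofReal q) μ) atTop (𝓝 0)) :
    HasSobolevGradient μ b lam θ q u F := by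
  have hq' : 1 ≤ ENNReal.ofReal q := by simpa using hq
  -- Diagonal choice: one cylindrical function that is close to `un n` and whose weighted gradient
  -- is simultaneously close to `Fn n`.
  have key : ∀ n : ℕ, ∃ φ, IsCylindrical b φ ∧
      eLpNorm (fun x => φ x - un n x) (ENNReal.ofReal q) μ ≤ ((n : ℝ≥0∞) + 1)⁻¹ ∧
      eLpNorm (fun x => weightedGradient b lam θ φ x - Fn n x) (ENNReal.ofReal q) μ ≤
        ((n : ℝ≥0∞) + 1)⁻¹ := by
    intro n
    obtain ⟨-, -, φ, h1, h2, h3⟩ := h n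
    have hpos : 0 < ((n : ℝ≥0∞) + 1)⁻¹ := by simp
    obtain ⟨m, hm⟩ := ((h2.eventually (ge_mem_nhds hpos)).and
      (h3.eventually (ge_mem_nhds hpos))).exists
    exact ⟨φ m, h1 m, hm.1, hm.2⟩
  choose φ hφ h1 h2 using key
  have hlim : Tendsto (fun n : ℕ => ((n : ℝ≥0∞) + 1)⁻¹) atTop (𝓝 0) := by
    have := (tendsto_add_atTop_iff_nat 1).2 ENNReal.tendsto_inv_nat_nhds_zero
    simpa using this
  refine ⟨hu, hF, φ, hφ, ?_, ?_⟩
  · exact tendsto_eLpNorm_sub_trans hq' (fun n => (hφ n).contDiff.continuous.aestronglyMeasurable)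
      (fun n => (h n).1.1) hu.1 (tendsto_of_tendsto_of_tendsto_of_le_of_le tendsto_const_nhds hlim
        (fun _ => zero_le) h1) hun
  · exact tendsto_eLpNorm_sub_trans hq'
      (fun n => ((hφ n).continuous_weightedGradient hb lam θ).aestronglyMeasurable)
      (fun n => (h n).2.1.1) hF.1 (tendsto_of_tendsto_of_tendsto_of_le_of_le tendsto_const_nhds hlim
        (fun _ => zero_le) h2) hFn

/-- The diagonal operator with entries `c 0, …, c (n - 1), 0, 0, …` in the basis `b`. -/
def diagTrunc (b : ℕ → H) (c : ℕ → ℝ) (n : ℕ) : H →L[ℝ] H :=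
  ∑ k ∈ Finset.range n, (c k • innerSL ℝ (b k)).smulRight (b k)

theorem diagTrunc_apply (b : ℕ → H) (c : ℕ → ℝ) (n : ℕ) (x : H) :
    diagTrunc b c n x = ∑ k ∈ Finset.range n, (c k * ⟪b k, x⟫) • b k := by
  simp [diagTrunc]

theorem inner_diagTrunc {b : ℕ → H} (hb : Orthonormal ℝ b) (c : ℕ → ℝ) (n : ℕ) (x : H) (k : ℕ) :
    ⟪b k, diagTrunc b c n x⟫ = if k < n then c k * ⟪b k, x⟫ else 0 := by
  rw [diagTrunc_apply, inner_sum]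
  simp_rw [inner_smul_right, orthonormal_iff_ite.1 hb]
  simp [Finset.sum_ite_eq]

theorem HilbertBasis.hasSum_sq (b : HilbertBasis ℕ ℝ H) (x : H) :
    HasSum (fun k => ⟪b k, x⟫ ^ 2) (‖x‖ ^ 2) := by
  have := b.hasSum_inner_mul_inner x x
  rw [real_inner_self_eq_norm_sq] at this
  refine this.congr_fun fun k => ?_
  rw [real_inner_comm x (b k), sq]

theorem norm_diagTrunc_le (b : HilbertBasis ℕ ℝ H) {c : ℕ → ℝ} (hc : ∀ k, |c k| ≤ 1) (n : ℕ)
    (x : H) : ‖diagTrunc b c n x‖ ≤ ‖x‖ := by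
  refine le_of_sq_le_sq ?_ (norm_nonneg _)
  refine hasSum_le (fun k => ?_) (HilbertBasis.hasSum_sq b _) (HilbertBasis.hasSum_sq b x)
  rw [inner_diagTrunc b.orthonormal]
  split_ifs
  · rw [mul_pow]
    have := (sq_le_one_iff_abs_le_one _).2 (hc k)
    nlinarith [sq_nonneg ⟪b k, x⟫]
  · simpa using sq_nonneg ⟪b k, x⟫

/-- By Parseval the squared distance is a series with terms at most 4⟪b k, x⟫², so dominated
convergence for series applies. The limit is strong, not in operator norm, which is why only
convergence of each multiplier is required. -/
theorem tendsto_diagTrunc (b : HilbertBasis ℕ ℝ H) {c : ℕ → ℕ → ℝ} (hc : ∀ n k, |c n k| ≤ 1)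
    (hlim : ∀ k, Tendsto (fun n => c n k) atTop (𝓝 1)) (x : H) :
    Tendsto (fun n => diagTrunc b (c n) n x) atTop (𝓝 x) := by
  rw [tendsto_iff_norm_sub_tendsto_zero]
  have hco : ∀ n k, ⟪b k, diagTrunc b (c n) n x - x⟫ ^ 2 =
      ((if k < n then c n k else 0) - 1) ^ 2 * ⟪b k, x⟫ ^ 2 := by
    intro n k
    rw [inner_sub_right, inner_diagTrunc b.orthonormal, ← mul_pow]
    split_ifs <;> ring
  have h2 : ∀ n, ‖diagTrunc b (c n) n x - x‖ ^ 2 =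
      ∑' k, ((if k < n then c n k else 0) - 1) ^ 2 * ⟪b k, x⟫ ^ 2 := by
    intro n
    rw [← (HilbertBasis.hasSum_sq b _).tsum_eq]
    exact tsum_congr (hco n)
  have h3 : Tendsto (fun n => ‖diagTrunc b (c n) n x - x‖ ^ 2) atTop (𝓝 0) := by
    simp_rw [h2]
    have h0 : (0 : ℝ) = ∑' _ : ℕ, (0 : ℝ) := tsum_zero.symm
    conv_rhs => rw [h0]
    refine tendsto_tsum_of_dominated_convergence (bound := fun k => 4 * ⟪b k, x⟫ ^ 2)
      ((HilbertBasis.hasSum_sq b x).summable.mul_left 4) (fun k => ?_)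
      (Eventually.of_forall fun n k => ?_)
    · have e : ∀ᶠ n in atTop, ((if k < n then c n k else 0) - 1) ^ 2 * ⟪b k, x⟫ ^ 2 =
          (c n k - 1) ^ 2 * ⟪b k, x⟫ ^ 2 := by
        filter_upwards [eventually_gt_atTop k] with n hn
        rw [if_pos hn]
      refine (tendsto_congr' e).2 ?_
      have := (((hlim k).sub_const 1).pow 2).mul_const (⟪b k, x⟫ ^ 2)
      simpa using this
    · rw [Real.norm_eq_abs, abs_of_nonneg (by positivity)]
      have h4 : |(if k < n then c n k else 0) - 1| ≤ 2 := by
        split_ifs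
        · refine (abs_sub _ _).trans ?_
          rw [abs_one]; linarith [hc n k]
        · norm_num
      have h5 := sq_le_sq' (by linarith [neg_abs_le ((if k < n then c n k else 0) - 1)])
        ((le_abs_self _).trans h4)
      nlinarith [sq_nonneg ⟪b k, x⟫]
  have := h3.sqrt
  simpa [Real.sqrt_sq] using this

end


/-! ### Functions with Lipschitz gradient belong to the Sobolev space. -/

section
variable {H : Type*} [NormedAddCommGroup H] [InnerProductSpace ℝ H]

/-- The map with coordinates `R sin (zᵢ / R)` in the family `b`. -/
def sinMap (b : ℕ → H) (R : ℝ) {n : ℕ} (z : Fin n → ℝ) : H :=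
  ∑ i : Fin n, (R * Real.sin (z i / R)) • b i

/-- The derivative of `sinMap b R`. -/
def sinMapDeriv (b : ℕ → H) (R : ℝ) {n : ℕ} (z : Fin n → ℝ) : (Fin n → ℝ) →L[ℝ] H :=
  ∑ i : Fin n, (Real.cos (z i / R) • ContinuousLinearMap.proj (R := ℝ) i).smulRight (b i)

theorem hasFDerivAt_sinMap (b : ℕ → H) {R : ℝ} (hR : R ≠ 0) {n : ℕ} (z : Fin n → ℝ) :
    HasFDerivAt (sinMap b R) (sinMapDeriv b R z) z := by
  refine HasFDerivAt.fun_sum fun i _ => ?_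
  have h1 : HasFDerivAt (fun z : Fin n → ℝ => z i) (ContinuousLinearMap.proj (R := ℝ) i) z :=
    hasFDerivAt_apply i z
  have h2 : HasDerivAt (fun t : ℝ => R * Real.sin (t / R)) (Real.cos (z i / R)) (z i) := by
    have := ((Real.hasDerivAt_sin (z i / R)).comp (z i) ((hasDerivAt_id (z i)).div_const R)).const_mul R
    refine this.congr_deriv ?_
    field_simp
  exact (h2.comp_hasFDerivAt z h1).smul_const (b i)

theorem contDiff_sinMap (b : ℕ → H) (R : ℝ) {n : ℕ} :
    ContDiff ℝ 1 (sinMap b R : (Fin n → ℝ) → H) := by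
  unfold sinMap
  fun_prop

theorem norm_sinMap_le {b : ℕ → H} (hb : Orthonormal ℝ b) {R : ℝ} (hR : 0 ≤ R) {n : ℕ}
    (z : Fin n → ℝ) : ‖sinMap b R z‖ ≤ n * R := by
  refine (norm_sum_le _ _).trans ((Finset.sum_le_card_nsmul _ _ R fun i _ => ?_).trans ?_)
  · rw [norm_smul, hb.1, mul_one, Real.norm_eq_abs, abs_mul, abs_of_nonneg hR]
    nlinarith [Real.abs_sin_le_one (z i / R)]
  · simp

theorem norm_sinMapDeriv_le {b : ℕ → H} (hb : Orthonormal ℝ b) (R : ℝ) {n : ℕ} (z : Fin n → ℝ) :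
    ‖sinMapDeriv b R z‖ ≤ n := by
  refine (norm_sum_le _ _).trans ((Finset.sum_le_card_nsmul _ _ 1 fun i _ => ?_).trans ?_)
  · refine ContinuousLinearMap.opNorm_le_bound _ zero_le_one fun w => ?_
    simp only [ContinuousLinearMap.smulRight_apply, smul_apply,
      ContinuousLinearMap.proj_apply, norm_smul, hb.1, Real.norm_eq_abs, smul_eq_mul, abs_mul]
    have h1 := Real.abs_cos_le_one (z i / R)
    have h2 := norm_le_pi_norm w i
    rw [Real.norm_eq_abs] at h2
    nlinarith [abs_nonneg (w i), abs_nonneg (Real.cos (z i / R))]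
  · simp

/-- Since R sin(t/R) = sinc(t/R) t, the cutoff is a diagonal operator, with x-dependent multipliers
that are bounded by 1 and tend to 1 as R → ∞. -/
theorem sinMap_inner (b : ℕ → H) {R : ℝ} (hR : R ≠ 0) (n : ℕ) (x : H) :
    sinMap b R (fun i : Fin n => ⟪x, b i⟫) =
      diagTrunc b (fun k => Real.sinc (⟪b k, x⟫ / R)) n x := by
  rw [diagTrunc_apply, sinMap, Finset.sum_range]
  refine Finset.sum_congr rfl fun i _ => ?_
  rw [real_inner_comm]
  congr 1
  by_cases h : ⟪b i, x⟫ = 0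
  · simp [h]
  · rw [Real.sinc_of_ne_zero (div_ne_zero h hR)]
    field_simp

theorem sinMapDeriv_inner (b : ℕ → H) (R : ℝ) (n : ℕ) (x y : H) :
    sinMapDeriv b R (fun i : Fin n => ⟪x, b i⟫) (fun i : Fin n => ⟪y, b i⟫) =
      diagTrunc b (fun k => Real.cos (⟪b k, x⟫ / R)) n y := by
  rw [diagTrunc_apply, sinMapDeriv, Finset.sum_range, sum_apply]
  refine Finset.sum_congr rfl fun i _ => ?_
  simp [real_inner_comm]

theorem inner_diagTrunc_comm (b : ℕ → H) (c : ℕ → ℝ) (n : ℕ) (x y : H) :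
    ⟪x, diagTrunc b c n y⟫ = ⟪diagTrunc b c n x, y⟫ := by
  simp_rw [diagTrunc_apply, inner_sum, sum_inner, inner_smul_left, inner_smul_right]
  refine Finset.sum_congr rfl fun i _ => ?_
  rw [real_inner_comm x]
  simp; ring

theorem norm_le_of_lipschitz {E F : Type*} [NormedAddCommGroup E] [NormedAddCommGroup F]
    {G : E → F} {L : ℝ≥0} (hG : LipschitzWith L G) (x : E) : ‖G x‖ ≤ ‖G 0‖ + L * ‖x‖ := by
  have := hG.norm_sub_le x 0
  rw [sub_zero] at this
  calc ‖G x‖ = ‖G 0 + (G x - G 0)‖ := by congr 1; abel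
    _ ≤ _ := (norm_add_le _ _).trans (by linarith)

/-- Mean value inequality on the ball of radius ‖x‖, where the gradient grows at most linearly. The
quadratic bound is the majorant for dominated convergence. -/
theorem abs_le_of_lipschitz_gradient {V : H → ℝ} {G : H → H} {L : ℝ≥0}
    (hV : ∀ x, HasFDerivAt V (innerSL ℝ (G x)) x) (hG : LipschitzWith L G) (x : H) :
    |V x| ≤ |V 0| + (‖G 0‖ + L * ‖x‖) * ‖x‖ := by
  have := (convex_closedBall (0 : H) ‖x‖).norm_image_sub_le_of_norm_hasFDerivWithin_le
    (f := V) (C := ‖G 0‖ + L * ‖x‖) (fun y _ => (hV y).hasFDerivWithinAt) (fun y hy => by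
      rw [innerSL_apply_norm]
      refine (norm_le_of_lipschitz hG y).trans ?_
      rw [mem_closedBall_zero_iff] at hy
      gcongr) (x := 0) (y := x) (by simp) (by simp)
  rw [sub_zero, Real.norm_eq_abs] at this
  calc |V x| = |V 0 + (V x - V 0)| := by congr 1; ring
    _ ≤ _ := (abs_add_le _ _).trans (by linarith)

/-- The sine keeps the argument of V in a ball of radius nR, where V and its gradient are bounded.
This gives the boundedness in C¹_b that truncation of coordinates alone would not. -/
theorem isCylindrical_sinMap {b : ℕ → H} (hb : Orthonormal ℝ b) {V : H → ℝ} {G : H → H} {L : ℝ≥0}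
    (hV : ∀ x, HasFDerivAt V (innerSL ℝ (G x)) x) (hG : LipschitzWith L G) {R : ℝ} (hR : 0 < R)
    (n : ℕ) : IsCylindrical b fun x => V (sinMap b R fun i : Fin n => ⟪x, b i⟫) := by
  refine ⟨n, fun z => V (sinMap b R z), ?_, ?_, fun x => rfl⟩
  · refine ContDiff.comp ?_ (contDiff_sinMap b R)
    rw [contDiff_one_iff_fderiv]
    refine ⟨fun x => (hV x).differentiableAt, ?_⟩
    have : fderiv ℝ V = fun x => innerSL ℝ (G x) := funext fun x => (hV x).fderiv
    rw [this]
    exact (innerSL ℝ).continuous.comp hG.continuous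
  · have hn := norm_sinMap_le hb hR.le (n := n)
    refine ⟨max (|V 0| + (‖G 0‖ + L * (n * R)) * (n * R)) ((‖G 0‖ + L * (n * R)) * n),
      fun z => ⟨le_max_of_le_left ?_, le_max_of_le_right ?_⟩⟩
    · refine (abs_le_of_lipschitz_gradient hV hG _).trans ?_
      gcongr <;> exact hn z
    · change ‖fderiv ℝ (V ∘ sinMap b R) z‖ ≤ _
      rw [((hV _).comp z (hasFDerivAt_sinMap b hR.ne' z)).fderiv]
      refine (ContinuousLinearMap.opNorm_comp_le _ _).trans ?_
      rw [innerSL_apply_norm]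
      refine mul_le_mul ((norm_le_of_lipschitz hG _).trans ?_) (norm_sinMapDeriv_le hb R z)
        (norm_nonneg _) (by positivity)
      gcongr; exact hn z

/-- The chain rule produces the cosine multipliers, and diagonal operators are symmetric, so they
can be moved onto the gradient of V. The bounded operator S carries the weights λ_k^θ. -/
theorem weightedGradient_sinMap {b : ℕ → H} (hb : Orthonormal ℝ b) {lam : ℕ → ℝ} {θ : ℝ}
    {S : H →L[ℝ] H} (hS : ∀ k, S (b k) = lam k ^ θ • b k) {V : H → ℝ} {G : H → H}
    (hV : ∀ x, HasFDerivAt V (innerSL ℝ (G x)) x) {R : ℝ} (hR : 0 < R)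
    (n : ℕ) (x : H) :
    weightedGradient b lam θ (fun x => V (sinMap b R fun i : Fin n => ⟪x, b i⟫)) x =
      S (diagTrunc b (fun k => Real.cos (⟪b k, x⟫ / R)) n
        (G (diagTrunc b (fun k => Real.sinc (⟪b k, x⟫ / R)) n x))) := by
  set g := G (diagTrunc b (fun k => Real.sinc (⟪b k, x⟫ / R)) n x) with hg
  set c := fun k => Real.cos (⟪b k, x⟫ / R)
  have hd : ∀ y, fderiv ℝ (fun x => V (sinMap b R fun i : Fin n => ⟪x, b i⟫)) x y =
      ⟪g, diagTrunc b c n y⟫ := by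
    intro y
    let Λ : H →L[ℝ] (Fin n → ℝ) := ContinuousLinearMap.pi fun i => innerSL ℝ (b i)
    have hΛ : ∀ x, Λ x = fun i : Fin n => ⟪x, b i⟫ := fun x => by
      ext i; exact real_inner_comm _ _
    have h2 := (hV _).comp x ((hasFDerivAt_sinMap b hR.ne' _).comp x Λ.hasFDerivAt)
    have h3 : (fun x => V (sinMap b R fun i : Fin n => ⟪x, b i⟫)) = V ∘ (sinMap b R ∘ Λ) := by
      ext x; simp [hΛ]
    rw [h3, h2.fderiv]
    simp only [ContinuousLinearMap.comp_apply, innerSL_apply_apply, Function.comp, hΛ]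
    rw [sinMapDeriv_inner, sinMap_inner b hR.ne']
  have h5 : weightedGradient b lam θ (fun x => V (sinMap b R fun i : Fin n => ⟪x, b i⟫)) x =
      ∑ k ∈ Finset.range n, (lam k ^ θ * ⟪g, diagTrunc b c n (b k)⟫) • b k := by
    simp_rw [← hd]
    refine tsum_eq_sum fun k hk => ?_
    rw [hd, diagTrunc_apply, Finset.sum_eq_zero, inner_zero_right, mul_zero, zero_smul]
    intro i hi
    rw [orthonormal_iff_ite.1 hb, if_neg, mul_zero, zero_smul]
    rintro rfl; exact hk hi
  rw [h5, diagTrunc_apply, map_sum]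
  refine Finset.sum_congr rfl fun k hk => ?_
  rw [map_smul, hS, smul_smul, inner_diagTrunc_comm, real_inner_comm, inner_diagTrunc hb,
    if_pos (Finset.mem_range.1 hk)]
  congr 1; ring

variable [MeasurableSpace H] [BorelSpace H] [SecondCountableTopology H]

/-- The dimension n and the cutoff level R are sent to infinity together. The values converge
pointwise under a quadratic majorant, the weighted gradients under a linear one, and both majorants
lie in L^q because μ has moments of all finite orders. -/
theorem hasSobolevGradient_of_lipschitz_gradient {μ : Measure H} [IsFiniteMeasure μ]
    (hμ : ∀ r : ℝ≥0∞, r ≠ ⊤ → MemLp (fun x : H => x) r μ) (b : HilbertBasis ℕ ℝ H)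
    {lam : ℕ → ℝ} {θ : ℝ} {S : H →L[ℝ] H} (hS : ∀ k, S (b k) = lam k ^ θ • b k) {V : H → ℝ}
    {G : H → H} {L : ℝ≥0} (hV : ∀ x, HasFDerivAt V (innerSL ℝ (G x)) x) (hG : LipschitzWith L G)
    {q : ℝ} (hq : 0 < q) : HasSobolevGradient μ b lam θ q V fun x => S (G x) := by
  have hq0 : ENNReal.ofReal q ≠ 0 := by simpa using hq
  have hqt : ENNReal.ofReal q ≠ ⊤ := ENNReal.ofReal_ne_top
  have hVc : Continuous V := continuous_iff_continuousAt.2 fun x => (hV x).continuousAt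
  have hSG : Continuous fun x => S (G x) := S.continuous.comp hG.continuous
  have hm1 : MemLp (fun x : H => ‖x‖) (ENNReal.ofReal q) μ := (hμ _ hqt).norm
  have hm2 : MemLp (fun x : H => ‖x‖ ^ 2) (ENNReal.ofReal q) μ := by
    have := (hμ (ENNReal.ofReal q * 2) (ENNReal.mul_ne_top hqt (by simp))).norm_rpow_div 2
    rw [ENNReal.mul_div_cancel_right (by simp) (by simp)] at this
    simpa using this
  have hb1 : MemLp (fun x : H => |V 0| + (‖G 0‖ + L * ‖x‖) * ‖x‖) (ENNReal.ofReal q) μ := by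
    have := ((memLp_const (|V 0|)).add (hm1.const_mul ‖G 0‖)).add (hm2.const_mul (L : ℝ))
    refine this.congr_norm (by fun_prop) (Eventually.of_forall fun x => ?_)
    congr 1; simp only [Pi.add_apply]; ring
  have hb2 : MemLp (fun x : H => ‖S‖ * (‖G 0‖ + L * ‖x‖)) (ENNReal.ofReal q) μ :=
    ((memLp_const (‖G 0‖)).add (hm1.const_mul (L : ℝ))).const_mul ‖S‖
  -- The shift by one keeps the cutoff level positive at n = 0.
  let R : ℕ → ℝ := fun n => n + 1
  have hR : ∀ n, 0 < R n := fun n => by positivity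
  have hRlim : ∀ t : ℝ, Tendsto (fun n => t / R n) atTop (𝓝 0) := fun t => by
    refine tendsto_const_nhds.div_atTop ?_
    exact tendsto_atTop_add_const_right _ _ tendsto_natCast_atTop_atTop
  have hT : ∀ x, Tendsto (fun n => diagTrunc b (fun k => Real.sinc (⟪b k, x⟫ / R n)) n x) atTop
      (𝓝 x) := fun x => by
    refine tendsto_diagTrunc b (fun n k => Real.abs_sinc_le_one _) (fun k => ?_) x
    have := (Real.continuous_sinc.tendsto 0).comp (hRlim ⟪b k, x⟫)
    simpa [Function.comp_def] using this
  have hC : ∀ x y, Tendsto (fun n => diagTrunc b (fun k => Real.cos (⟪b k, x⟫ / R n)) n y) atTop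
      (𝓝 y) := fun x y => by
    refine tendsto_diagTrunc b (fun n k => Real.abs_cos_le_one _) (fun k => ?_) y
    have := (Real.continuous_cos.tendsto 0).comp (hRlim ⟪b k, x⟫)
    simpa [Function.comp_def] using this
  have hTn : ∀ n x, ‖diagTrunc b (fun k => Real.sinc (⟪b k, x⟫ / R n)) n x‖ ≤ ‖x‖ := fun n x =>
    norm_diagTrunc_le b (fun k => Real.abs_sinc_le_one _) n x
  have hCn : ∀ n x y, ‖diagTrunc b (fun k => Real.cos (⟪b k, x⟫ / R n)) n y‖ ≤ ‖y‖ := fun n x y =>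
    norm_diagTrunc_le b (fun k => Real.abs_cos_le_one _) n y
  have hcyl := fun n => isCylindrical_sinMap b.orthonormal hV hG (hR n) n
  refine ⟨hb1.mono' hVc.aestronglyMeasurable
      (Eventually.of_forall (abs_le_of_lipschitz_gradient hV hG)),
    hb2.mono' hSG.aestronglyMeasurable (Eventually.of_forall fun x =>
      (S.le_opNorm _).trans (by gcongr; exact norm_le_of_lipschitz hG x)),
    fun n x => V (sinMap b (R n) fun i : Fin n => ⟪x, b i⟫), hcyl, ?_, ?_⟩
  · refine tendsto_eLpNorm_of_dominated hq0 hqt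
      (fun n => (hcyl n).contDiff.continuous.aestronglyMeasurable) hVc.aestronglyMeasurable hb1
      (fun n => Eventually.of_forall fun x => ?_) (Eventually.of_forall fun x => ?_)
    · rw [sinMap_inner b (hR n).ne']
      refine (abs_le_of_lipschitz_gradient hV hG _).trans ?_
      gcongr <;> exact hTn n x
    · simp_rw [fun n => sinMap_inner b (hR n).ne' n x]
      exact (hVc.tendsto x).comp (hT x)
  · refine tendsto_eLpNorm_of_dominated hq0 hqt
      (fun n => ((hcyl n).continuous_weightedGradient b.orthonormal lam θ).aestronglyMeasurable)
      hSG.aestronglyMeasurable hb2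
      (fun n => Eventually.of_forall fun x => ?_) (Eventually.of_forall fun x => ?_)
    · rw [weightedGradient_sinMap b.orthonormal hS hV (hR n)]
      refine (S.le_opNorm _).trans ?_
      gcongr
      refine (hCn _ _ _).trans ((norm_le_of_lipschitz hG _).trans ?_)
      gcongr; exact hTn n x
    · simp_rw [fun n => weightedGradient_sinMap b.orthonormal hS hV (hR n) n x]
      refine (S.continuous.tendsto _).comp ?_
      rw [tendsto_iff_norm_sub_tendsto_zero]
      have h1 : Tendsto (fun n => ‖G (diagTrunc b (fun k => Real.sinc (⟪b k, x⟫ / R n)) n x) - G x‖)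
          atTop (𝓝 0) :=
        tendsto_iff_norm_sub_tendsto_zero.1 ((hG.continuous.tendsto x).comp (hT x))
      have h2 := tendsto_iff_norm_sub_tendsto_zero.1 (hC x (G x))
      -- Operator and argument both vary with n: the contraction bound handles the varying argument,
      -- strong convergence at the fixed vector `G x` the varying operator.
      refine squeeze_zero (fun _ => norm_nonneg _) (fun n => ?_) (by simpa using h1.add h2)
      have h3 := hCn n x (G (diagTrunc b (fun k => Real.sinc (⟪b k, x⟫ / R n)) n x) - G x)
      rw [map_sub] at h3
      refine (norm_sub_le_norm_sub_add_norm_sub _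
        (diagTrunc b (fun k => Real.cos (⟪b k, x⟫ / R n)) n (G x)) _).trans ?_
      gcongr

end


/-! ### Moreau–Yosida and Yosida approximations on the real line. -/

section MoreauYosida
variable {Φ : ℝ → ℝ}

theorem hasDerivAt_of_contDiff_two (hΦ : ContDiff ℝ 2 Φ) (t : ℝ) :
    HasDerivAt Φ (deriv Φ t) t :=
  (hΦ.differentiable (by simp) t).hasDerivAt

theorem contDiff_deriv_of_contDiff_two (hΦ : ContDiff ℝ 2 Φ) : ContDiff ℝ 1 (deriv Φ) := by
  have : ContDiff ℝ (1 + 1) Φ := by simpa [one_add_one_eq_two] using hΦ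
  exact (contDiff_succ_iff_deriv.1 this).2.2

theorem add_deriv_mul_le (hΦ : ContDiff ℝ 2 Φ) (hconv : ConvexOn ℝ univ Φ) (s t : ℝ) :
    Φ t + deriv Φ t * (s - t) ≤ Φ s := by
  have hd := hasDerivAt_of_contDiff_two hΦ t
  rcases lt_trichotomy s t with h | h | h
  · have := hconv.slope_le_of_hasDerivAt (mem_univ s) (mem_univ t) h hd
    rw [slope_def_field, div_le_iff₀ (sub_pos.2 h)] at this
    linarith
  · simp [h]
  · have := hconv.le_slope_of_hasDerivAt (mem_univ t) (mem_univ s) h hd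
    rw [slope_def_field, le_div_iff₀ (sub_pos.2 h)] at this
    linarith

theorem monotone_deriv_of_convex (hΦ : ContDiff ℝ 2 Φ) (hconv : ConvexOn ℝ univ Φ) :
    Monotone (deriv Φ) := by
  intro s t hst
  rcases hst.eq_or_lt with rfl | h
  · rfl
  · nlinarith [add_deriv_mul_le hΦ hconv s t, add_deriv_mul_le hΦ hconv t s]

/-- The resolvent `(I + αΦ')⁻¹`. -/
def prox (Φ : ℝ → ℝ) (α : ℝ) : ℝ → ℝ := Function.invFun fun s => s + α * deriv Φ s

/-- The Yosida approximation `Φ' ∘ (I + αΦ')⁻¹` of `Φ'`. -/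
def yosida (Φ : ℝ → ℝ) (α r : ℝ) : ℝ := deriv Φ (prox Φ α r)

/-- Comparison with s + αΦ'(0) on both half-lines gives limits ±∞, hence surjectivity by the
intermediate value theorem. Surjectivity alone makes `invFun` a right inverse. This identity and the
monotonicity of Φ' are the source of all later properties of `prox` and `yosida`. -/
theorem prox_add (hΦ : ContDiff ℝ 2 Φ) (hconv : ConvexOn ℝ univ Φ) {α : ℝ} (hα : 0 < α) (r : ℝ) :
    prox Φ α r + α * yosida Φ α r = r := by
  have hm := monotone_deriv_of_convex hΦ hconv
  have hc : Continuous fun s => s + α * deriv Φ s :=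
    continuous_id.add ((contDiff_deriv_of_contDiff_two hΦ).continuous.const_mul α)
  have hs : Function.Surjective fun s => s + α * deriv Φ s := by
    refine hc.surjective ?_ ?_
    · refine tendsto_atTop_mono' atTop (f₁ := fun s => s + α * deriv Φ 0) ?_
        (tendsto_atTop_add_const_right _ _ tendsto_id)
      filter_upwards [eventually_ge_atTop 0] with s hs
      have := mul_le_mul_of_nonneg_left (hm hs) hα.le
      linarith
    · refine tendsto_atBot_mono' atBot (f₂ := fun s => s + α * deriv Φ s)
        (f₁ := fun s => s + α * deriv Φ 0) ?_
        (tendsto_atBot_add_const_right _ _ tendsto_id)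
      filter_upwards [eventually_le_atBot 0] with s hs
      have := mul_le_mul_of_nonneg_left (hm hs) hα.le
      linarith
  exact Function.invFun_eq (hs r)

theorem le_moreauYosida {c : ℝ} (hc : ∀ t, c ≤ Φ t) {α : ℝ} (hα : 0 < α)
    (r : ℝ) : c ≤ moreauYosida Φ α r :=
  le_ciInf fun s => (hc s).trans (le_add_of_nonneg_right (by positivity))

variable (hΦ : ContDiff ℝ 2 Φ) (hconv : ConvexOn ℝ univ Φ) {α : ℝ} (hα : 0 < α)
include hΦ hconv hα

theorem monotone_prox : Monotone (prox Φ α) := by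
  intro r s hrs
  by_contra! h
  have h1 := prox_add hΦ hconv hα r
  have h2 := prox_add hΦ hconv hα s
  have h3 : yosida Φ α s ≤ yosida Φ α r := monotone_deriv_of_convex hΦ hconv h.le
  nlinarith

theorem monotone_yosida : Monotone (yosida Φ α) :=
  (monotone_deriv_of_convex hΦ hconv).comp (monotone_prox hΦ hconv hα)

/-- `prox` and α·`yosida` are nondecreasing and add up to the identity, so the increment of each is
at most that of the identity. -/
theorem abs_prox_sub_le (r s : ℝ) : |prox Φ α r - prox Φ α s| ≤ |r - s| := by
  have h1 := prox_add hΦ hconv hα r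
  have h2 := prox_add hΦ hconv hα s
  rcases le_total r s with h | h
  · have h3 := monotone_prox hΦ hconv hα h
    have h4 := mul_le_mul_of_nonneg_left (monotone_yosida hΦ hconv hα h) hα.le
    rw [abs_of_nonpos (by linarith), abs_of_nonpos (by linarith)]
    linarith
  · have h3 := monotone_prox hΦ hconv hα h
    have h4 := mul_le_mul_of_nonneg_left (monotone_yosida hΦ hconv hα h) hα.le
    rw [abs_of_nonneg (by linarith), abs_of_nonneg (by linarith)]
    linarith

theorem abs_yosida_sub_le (r s : ℝ) : |yosida Φ α r - yosida Φ α s| ≤ α⁻¹ * |r - s| := by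
  have h1 := prox_add hΦ hconv hα r
  have h2 := prox_add hΦ hconv hα s
  rw [le_inv_mul_iff₀ hα]
  rcases le_total r s with h | h
  · have h3 := monotone_prox hΦ hconv hα h
    have h4 := monotone_yosida hΦ hconv hα h
    rw [abs_of_nonpos (by linarith), abs_of_nonpos (by linarith)]
    linarith
  · have h3 := monotone_prox hΦ hconv hα h
    have h4 := monotone_yosida hΦ hconv hα h
    rw [abs_of_nonneg (by linarith), abs_of_nonneg (by linarith)]
    linarith

/-- The tangent line of Φ at `prox Φ α r`, followed by completion of the square. For r' = r it says
that `prox` attains the infimum; for general r' it says that `yosida` is a subgradient of the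
infimum at r. -/
theorem moreauYosida_aux (r r' s : ℝ) :
    Φ (prox Φ α r) + α / 2 * yosida Φ α r ^ 2 + yosida Φ α r * (r' - r) ≤
      Φ s + (r' - s) ^ 2 / (2 * α) := by
  have h1 := prox_add hΦ hconv hα r
  have h2 : Φ (prox Φ α r) + yosida Φ α r * (s - prox Φ α r) ≤ Φ s :=
    add_deriv_mul_le hΦ hconv s _
  have h3 : prox Φ α r = r - α * yosida Φ α r := by linarith
  have h4 : (r' - s) ^ 2 / (2 * α) - yosida Φ α r * (r' - s) + α / 2 * yosida Φ α r ^ 2 =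
      (r' - s - α * yosida Φ α r) ^ 2 / (2 * α) := by
    field_simp; ring
  have h5 : 0 ≤ (r' - s - α * yosida Φ α r) ^ 2 / (2 * α) := by positivity
  rw [h3] at h2 ⊢
  nlinarith

theorem bddBelow_moreauYosida (r : ℝ) : BddBelow (range fun s => Φ s + (r - s) ^ 2 / (2 * α)) := by
  refine ⟨Φ (prox Φ α r) + α / 2 * yosida Φ α r ^ 2, ?_⟩
  rintro _ ⟨s, rfl⟩
  simpa using moreauYosida_aux hΦ hconv hα r r s

theorem moreauYosida_eq (r : ℝ) :
    moreauYosida Φ α r = Φ (prox Φ α r) + α / 2 * yosida Φ α r ^ 2 := by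
  refine le_antisymm ?_ (le_ciInf fun s => by simpa using moreauYosida_aux hΦ hconv hα r r s)
  refine (ciInf_le (bddBelow_moreauYosida hΦ hconv hα r) (prox Φ α r)).trans (le_of_eq ?_)
  have h1 : r - prox Φ α r = α * yosida Φ α r := by linarith [prox_add hΦ hconv hα r]
  rw [h1]
  field_simp

theorem moreauYosida_add_le (r r' : ℝ) :
    moreauYosida Φ α r + yosida Φ α r * (r' - r) ≤ moreauYosida Φ α r' := by
  rw [moreauYosida_eq hΦ hconv hα r]
  exact le_ciInf fun s => moreauYosida_aux hΦ hconv hα r r' s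

theorem moreauYosida_le (r : ℝ) : moreauYosida Φ α r ≤ Φ r := by
  refine (ciInf_le (bddBelow_moreauYosida hΦ hconv hα r) r).trans (le_of_eq ?_)
  simp

/-- If the Yosida approximation is nonnegative then `prox` lies to the left of r, and monotonicity
of Φ' gives the bound; the other sign is symmetric. -/
theorem abs_yosida_le (r : ℝ) : |yosida Φ α r| ≤ |deriv Φ r| := by
  have h1 := prox_add hΦ hconv hα r
  have hm := monotone_deriv_of_convex hΦ hconv
  rcases le_total 0 (yosida Φ α r) with h | h
  · have h2 : prox Φ α r ≤ r := by nlinarith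
    exact abs_le_abs_of_nonneg h (hm h2)
  · have h2 : r ≤ prox Φ α r := by nlinarith
    exact abs_le_abs_of_nonpos h (hm h2)

theorem abs_prox_sub_self_le (r : ℝ) : |prox Φ α r - r| ≤ α * |deriv Φ r| := by
  have h1 := prox_add hΦ hconv hα r
  have h2 : prox Φ α r - r = -(α * yosida Φ α r) := by linarith
  rw [h2, abs_neg, abs_mul, abs_of_pos hα]
  exact mul_le_mul_of_nonneg_left (abs_yosida_le hΦ hconv hα r) hα.le

/-- Φ is replaced by its tangent line at r, for which the infimum over s is an explicit quadratic
minimum. -/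
theorem sub_moreauYosida_le (r : ℝ) : Φ r - moreauYosida Φ α r ≤ α / 2 * deriv Φ r ^ 2 := by
  have h : Φ r - α / 2 * deriv Φ r ^ 2 ≤ moreauYosida Φ α r := by
    refine le_ciInf fun s => ?_
    have h1 := add_deriv_mul_le hΦ hconv s r
    have h2 : (r - s) ^ 2 / (2 * α) - deriv Φ r * (r - s) + α / 2 * deriv Φ r ^ 2 =
        (r - s - α * deriv Φ r) ^ 2 / (2 * α) := by
      field_simp; ring
    have h3 : 0 ≤ (r - s - α * deriv Φ r) ^ 2 / (2 * α) := by positivity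
    nlinarith
  linarith

/-- Average of the supporting line at the convex combination, evaluated at the two end points. -/
theorem convexOn_moreauYosida : ConvexOn ℝ univ (moreauYosida Φ α) := by
  refine ⟨convex_univ, fun x _ y _ a b ha hb hab => ?_⟩
  have h1 := moreauYosida_add_le hΦ hconv hα (a • x + b • y) x
  have h2 := moreauYosida_add_le hΦ hconv hα (a • x + b • y) y
  simp only [smul_eq_mul] at *
  have hb' : b = 1 - a := by linarith
  subst hb'
  nlinarith [mul_le_mul_of_nonneg_left h1 ha, mul_le_mul_of_nonneg_left h2 hb]

/-- The inverse function rule gives prox' = (1 + αΦ''(prox))⁻¹, with Φ'' ≥ 0 by convexity. The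
continuous nonnegative derivative is needed for the integration by parts behind U_α ≤ U. -/
theorem exists_hasDerivAt_yosida : ∃ ψ' : ℝ → ℝ, Continuous ψ' ∧ (∀ r, 0 ≤ ψ' r) ∧
    ∀ r, HasDerivAt (yosida Φ α) (ψ' r) r := by
  have h1 := contDiff_deriv_of_contDiff_two hΦ
  have hd : ∀ t, HasDerivAt (deriv Φ) (deriv (deriv Φ) t) t := fun t =>
    (h1.differentiable (by simp) t).hasDerivAt
  have hc : Continuous (deriv (deriv Φ)) := h1.continuous_deriv le_rfl
  have h0 : ∀ t, 0 ≤ deriv (deriv Φ) t := fun t => (monotone_deriv_of_convex hΦ hconv).deriv_nonneg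
  have hpc : Continuous (prox Φ α) :=
    (LipschitzWith.of_dist_le_mul (K := 1) fun r s => by
      simpa [Real.dist_eq] using abs_prox_sub_le hΦ hconv hα r s).continuous
  have hne : ∀ t, 1 + α * deriv (deriv Φ) t ≠ 0 := fun t => by
    have := mul_nonneg hα.le (h0 t)
    positivity
  have hp : ∀ r, HasDerivAt (prox Φ α) (1 + α * deriv (deriv Φ) (prox Φ α r))⁻¹ r := fun r =>
    HasDerivAt.of_local_left_inverse (f := fun s => s + α * deriv Φ s) hpc.continuousAt
      ((hasDerivAt_id _).add ((hd _).const_mul α)) (hne _)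
      (Eventually.of_forall fun s => prox_add hΦ hconv hα s)
  refine ⟨fun r => deriv (deriv Φ) (prox Φ α r) * (1 + α * deriv (deriv Φ) (prox Φ α r))⁻¹, ?_, ?_,
    fun r => (hd _).comp r (hp r)⟩
  · have := hc.comp hpc
    exact this.mul ((continuous_const.add (this.const_mul α)).inv₀ fun r => hne _)
  · intro r
    have := h0 (prox Φ α r)
    positivity

end MoreauYosida

/-! ### Consequences of the growth condition on the second derivative. -/

section growth
variable {Φ : ℝ → ℝ} {K p : ℝ}

theorem abs_deriv_sub_le (hΦ : ContDiff ℝ 2 Φ)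
    (hgrowth : ∀ t : ℝ, |iteratedDeriv 2 Φ t| ≤ K * (1 + |t| ^ (p - 2))) (hK : 0 < K) (hp : 2 ≤ p)
    {R : ℝ} {s t : ℝ} (hs : |s| ≤ R) (ht : |t| ≤ R) :
    |deriv Φ s - deriv Φ t| ≤ K * (1 + R ^ (p - 2)) * |s - t| := by
  have h1 := contDiff_deriv_of_contDiff_two hΦ
  have := (convex_closedBall (0 : ℝ) R).norm_image_sub_le_of_norm_hasDerivWithin_le
    (f := deriv Φ) (f' := deriv (deriv Φ)) (C := K * (1 + R ^ (p - 2)))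
    (fun u _ => (h1.differentiable (by simp) u).hasDerivAt.hasDerivWithinAt) (fun u hu => ?_)
    (x := t) (y := s) (by simpa using ht) (by simpa using hs)
  · exact this
  · rw [mem_closedBall_zero_iff, Real.norm_eq_abs] at hu
    have h2 := hgrowth u
    rw [iteratedDeriv_succ, iteratedDeriv_one] at h2
    refine h2.trans ?_
    gcongr

theorem abs_deriv_le_rpow (hΦ : ContDiff ℝ 2 Φ)
    (hgrowth : ∀ t : ℝ, |iteratedDeriv 2 Φ t| ≤ K * (1 + |t| ^ (p - 2))) (hK : 0 < K) (hp : 2 ≤ p)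
    (t : ℝ) : |deriv Φ t| ≤ |deriv Φ 0| + K * (1 + |t| ^ (p - 2)) * |t| := by
  have := abs_deriv_sub_le hΦ hgrowth hK hp (s := t) (t := 0) le_rfl (by simp)
  rw [sub_zero] at this
  calc |deriv Φ t| = |deriv Φ 0 + (deriv Φ t - deriv Φ 0)| := by congr 1; ring
    _ ≤ _ := (abs_add_le _ _).trans (by linarith)

theorem exists_abs_le_rpow (hΦ : ContDiff ℝ 2 Φ)
    (hgrowth : ∀ t : ℝ, |iteratedDeriv 2 Φ t| ≤ K * (1 + |t| ^ (p - 2))) (hK : 0 < K) (hp : 2 ≤ p) :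
    ∃ C, ∀ t, |Φ t| ≤ C * (1 + |t| ^ p) := by
  refine ⟨|Φ 0| + |deriv Φ 0| + 2 * K, fun t => ?_⟩
  have := (convex_closedBall (0 : ℝ) |t|).norm_image_sub_le_of_norm_hasDerivWithin_le
    (f := Φ) (f' := deriv Φ) (C := |deriv Φ 0| + K * (1 + |t| ^ (p - 2)) * |t|)
    (fun u _ => (hasDerivAt_of_contDiff_two hΦ u).hasDerivWithinAt) (fun u hu => ?_)
    (x := 0) (y := t) (by simp) (by simp)
  · rw [sub_zero, Real.norm_eq_abs, Real.norm_eq_abs] at this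
    have h1 : |Φ t| ≤ |Φ 0| + |Φ t - Φ 0| := by
      calc |Φ t| = |Φ 0 + (Φ t - Φ 0)| := by congr 1; ring
        _ ≤ _ := abs_add_le _ _
    have hle : ∀ m : ℝ, 0 ≤ m → m ≤ p → |t| ^ m ≤ 1 + |t| ^ p := fun m h0 hm => by
      rcases le_total |t| 1 with h | h
      · exact (Real.rpow_le_one (abs_nonneg _) h h0).trans
          (le_add_of_nonneg_right (by positivity))
      · exact (Real.rpow_le_rpow_of_exponent_le h hm).trans (by linarith)
    have e1 := hle 1 (by norm_num) (by linarith)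
    have e2 := hle 2 (by norm_num) (by linarith)
    rw [Real.rpow_one] at e1
    rw [Real.rpow_two] at e2
    -- The point t = 0 is separated because adding real exponents requires a positive base.
    have e3 : |t| ^ (p - 2) * |t| * |t| = |t| ^ p ∨ t = 0 := by
      by_cases h : t = 0
      · exact Or.inr h
      · left
        rw [mul_assoc, ← sq, ← Real.rpow_two, ← Real.rpow_add (abs_pos.2 h)]
        congr 1; ring
    have e4 : |t| ^ (p - 2) * |t| * |t| ≤ |t| ^ p := by
      rcases e3 with h | h
      · exact h.le
      · subst h; simp; positivity
    have h5 := abs_nonneg (Φ 0)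
    have h6 := mul_le_mul_of_nonneg_left e1 (abs_nonneg (deriv Φ 0))
    have h7 := mul_le_mul_of_nonneg_left e2 hK.le
    have h8 := mul_le_mul_of_nonneg_left e4 hK.le
    have h9 : 0 ≤ |t| ^ p := by positivity
    nlinarith
  · rw [mem_closedBall_zero_iff, Real.norm_eq_abs] at hu
    refine (abs_deriv_le_rpow hΦ hgrowth hK hp u).trans ?_
    gcongr

/-- Trades the real exponent for a natural one, so that products of powers can be handled
algebraically and Hölder's inequality can be applied to natural powers. -/
theorem rpow_le_one_add_pow (hp : 2 ≤ p) {t R : ℝ} (h0 : 0 ≤ t) (h : 1 + t ≤ R) :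
    1 + t ^ (p - 2) ≤ 2 * R ^ ⌈p⌉₊ := by
  have hR : 1 ≤ R := by linarith
  have h1 : t ^ (p - 2) ≤ R ^ ⌈p⌉₊ := by
    rw [← Real.rpow_natCast]
    refine (Real.rpow_le_rpow h0 (by linarith) (by linarith)).trans
      (Real.rpow_le_rpow_of_exponent_le hR ?_)
    linarith [Nat.le_ceil p]
  have h2 := one_le_pow₀ (n := ⌈p⌉₊) hR
  linarith

/-- Polynomial growth, and polynomial control of the errors of the Moreau–Yosida approximation. -/
theorem exists_growth_bounds (hΦ : ContDiff ℝ 2 Φ) (hconv : ConvexOn ℝ univ Φ)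
    (hgrowth : ∀ t : ℝ, |iteratedDeriv 2 Φ t| ≤ K * (1 + |t| ^ (p - 2))) (hK : 0 < K) (hp : 2 ≤ p) :
    ∃ (C : ℝ) (N : ℕ), 0 ≤ C ∧ 0 < N ∧ ∀ a b α : ℝ, 0 < α → α ≤ 1 →
      |deriv Φ b| ≤ C * (1 + |a| + |b|) ^ N ∧
      |yosida Φ α a - deriv Φ b| ≤ C * ((|a - b| + α) * (1 + |a| + |b|) ^ N) ∧
      |moreauYosida Φ α a - Φ b| ≤ C * ((|a - b| + α) * (1 + |a| + |b|) ^ N) := by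
  set N := ⌈p⌉₊
  set D := |deriv Φ 0| with hD
  set C₁ := D + 2 * K with hC₁
  have hD0 : 0 ≤ D := abs_nonneg _
  have hC₁0 : 0 ≤ C₁ := by positivity
  have hder : ∀ t M : ℝ, 1 + |t| ≤ M → |deriv Φ t| ≤ C₁ * M ^ (N + 1) := by
    intro t M hM
    have hM1 : 1 ≤ M := by linarith [abs_nonneg t]
    have h1 := abs_deriv_le_rpow hΦ hgrowth hK hp t
    have h2 := rpow_le_one_add_pow hp (abs_nonneg t) hM
    have h3 : K * (1 + |t| ^ (p - 2)) * |t| ≤ K * (2 * M ^ N) * M := by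
      gcongr; linarith
    have h4 : D * 1 ≤ D * M ^ (N + 1) := by
      gcongr; exact one_le_pow₀ hM1
    rw [pow_succ] at *
    rw [hC₁]
    nlinarith
  -- The three summands serve the three estimates in turn. The exponent 2⌈p⌉ + 2 comes from the
  -- third one, where the bound for Φ' of degree ⌈p⌉ + 1 is squared.
  refine ⟨C₁ + (1 + C₁) * (K * 2 * (1 + D) ^ N) + (C₁ + C₁ ^ 2), 2 * N + 2, by positivity, by omega,
    fun a b α hα hα1 => ?_⟩
  set M := 1 + |a| + |b| with hM
  have hM1 : 1 ≤ M := by linarith [abs_nonneg a, abs_nonneg b]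
  have hM0 : 0 ≤ M := by linarith
  have hpow : ∀ {k : ℕ}, k ≤ 2 * N + 2 → M ^ k ≤ M ^ (2 * N + 2) := fun h =>
    pow_le_pow_right₀ hM1 h
  have ha := hder a M (by linarith [abs_nonneg b])
  have hb := hder b M (by linarith [abs_nonneg a])
  have hab : 0 ≤ |a - b| + α := by positivity
  have hB0 : 0 ≤ (1 + C₁) * (K * 2 * (1 + D) ^ N) := by positivity
  have hC0 : 0 ≤ C₁ + C₁ ^ 2 := by positivity
  refine ⟨?_, ?_, ?_⟩
  · refine hb.trans ?_
    exact mul_le_mul (by linarith) (hpow (by omega)) (by positivity) (by positivity)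
  · have h1 : |prox Φ α a - b| ≤ (|a - b| + α) * ((1 + C₁) * M ^ (N + 1)) := by
      have e1 := abs_sub_le (prox Φ α a) (prox Φ α b) b
      have e2 := abs_prox_sub_le hΦ hconv hα a b
      have e3 := abs_prox_sub_self_le hΦ hconv hα b
      have e4 := mul_le_mul_of_nonneg_left hb hα.le
      have e5 : 1 ≤ M ^ (N + 1) := one_le_pow₀ hM1
      have e6 : 0 ≤ C₁ * M ^ (N + 1) := by positivity
      nlinarith [abs_nonneg (a - b), mul_nonneg (abs_nonneg (a - b)) e6,
        mul_le_mul_of_nonneg_left e5 (abs_nonneg (a - b)), mul_le_mul_of_nonneg_left e5 hα.le]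
    -- The distance from `prox Φ α 0` to 0 is at most α|Φ'(0)|, and α ≤ 1 makes the bound
    -- independent of α.
    have h2 : |prox Φ α a| ≤ |a| + D := by
      have e1 := abs_prox_sub_le hΦ hconv hα a 0
      have e2 := abs_prox_sub_self_le hΦ hconv hα 0
      rw [sub_zero] at e1 e2
      have e3 : |prox Φ α a| ≤ |prox Φ α a - prox Φ α 0| + |prox Φ α 0| := by
        calc |prox Φ α a| = |(prox Φ α a - prox Φ α 0) + prox Φ α 0| := by congr 1; ring
          _ ≤ _ := abs_add_le _ _
      nlinarith
    have h3 := abs_deriv_sub_le hΦ hgrowth hK hp (s := prox Φ α a) (t := b)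
      (R := |prox Φ α a| + |b|) (by linarith [abs_nonneg b])
      (by linarith [abs_nonneg (prox Φ α a)])
    have h4 := rpow_le_one_add_pow hp (t := |prox Φ α a| + |b|) (R := (1 + D) * M)
      (by positivity) (by nlinarith)
    calc |yosida Φ α a - deriv Φ b| ≤ K * (1 + (|prox Φ α a| + |b|) ^ (p - 2)) *
          |prox Φ α a - b| := h3
      _ ≤ K * (2 * ((1 + D) * M) ^ N) * ((|a - b| + α) * ((1 + C₁) * M ^ (N + 1))) := by gcongr
      _ = (1 + C₁) * (K * 2 * (1 + D) ^ N) * ((|a - b| + α) * M ^ (2 * N + 1)) := by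
          rw [mul_pow]; ring
      _ ≤ _ := by
          gcongr
          · linarith
          · omega
  -- Passing through Φ_α(b): the two subgradient inequalities bound Φ_α(a) - Φ_α(b), and Φ(b) -
  -- Φ_α(b) is at most αΦ'(b)²/2.
  · have h1 := moreauYosida_add_le hΦ hconv hα a b
    have h2 := moreauYosida_add_le hΦ hconv hα b a
    have h3 : |moreauYosida Φ α a - moreauYosida Φ α b| ≤ C₁ * M ^ (N + 1) * |a - b| := by
      have e1 : |yosida Φ α a * (a - b)| ≤ C₁ * M ^ (N + 1) * |a - b| := by
        rw [abs_mul]; gcongr; exact (abs_yosida_le hΦ hconv hα a).trans ha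
      have e2 : |yosida Φ α b * (a - b)| ≤ C₁ * M ^ (N + 1) * |a - b| := by
        rw [abs_mul]; gcongr; exact (abs_yosida_le hΦ hconv hα b).trans hb
      rw [abs_le] at *
      constructor <;> nlinarith
    have h4 : |moreauYosida Φ α b - Φ b| ≤ α * (C₁ * M ^ (N + 1)) ^ 2 := by
      rw [abs_sub_comm, abs_of_nonneg (by linarith [moreauYosida_le hΦ hconv hα b])]
      refine (sub_moreauYosida_le hΦ hconv hα b).trans ?_
      have e1 : deriv Φ b ^ 2 ≤ (C₁ * M ^ (N + 1)) ^ 2 := by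
        rw [← sq_abs]; gcongr
      nlinarith [sq_nonneg (C₁ * M ^ (N + 1))]
    calc |moreauYosida Φ α a - Φ b| ≤ _ := abs_sub_le _ (moreauYosida Φ α b) _
      _ ≤ C₁ * M ^ (N + 1) * |a - b| + α * (C₁ * M ^ (N + 1)) ^ 2 := add_le_add h3 h4
      _ = C₁ * (|a - b| * M ^ (N + 1)) + C₁ ^ 2 * (α * M ^ (2 * N + 2)) := by ring
      _ ≤ C₁ * ((|a - b| + α) * M ^ (2 * N + 2)) + C₁ ^ 2 * ((|a - b| + α) * M ^ (2 * N + 2)) := by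
          have e1 : |a - b| ≤ |a - b| + α := by linarith
          have e2 : α ≤ |a - b| + α := by linarith [abs_nonneg (a - b)]
          have e3 := hpow (k := N + 1) (by omega)
          gcongr
      _ = (C₁ + C₁ ^ 2) * ((|a - b| + α) * M ^ (2 * N + 2)) := by ring
      _ ≤ _ := mul_le_mul_of_nonneg_right (by linarith) (by positivity)

end growth


instance : IsProbabilityMeasure leb := ⟨by simp⟩

/-! ### Completeness of the cosine basis -/

theorem L2.integrable_mul_continuous (v : L2) {g : ℝ → ℝ} (hg : Continuous g) :
    Integrable (fun ξ => v ξ * g ξ) leb :=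
  (Lp.memLp v).integrable_mul (memLp_of_continuous hg)

/-- Induction on the power of the cosine through 2 sin(kt) cos t = sin((k+1)t) + sin((k-1)t). At k =
0 the integrand vanishes, so the index never becomes negative. -/
theorem integral_mul_sin_mul_cos_pow (v : L2) (h : ∀ k, ∫ ξ, v ξ * sinFun k ξ ∂leb = 0)
    (m k : ℕ) : ∫ ξ, v ξ * (Real.sin (k * (Real.pi * ξ)) * Real.cos (Real.pi * ξ) ^ m) ∂leb = 0 := by
  induction m generalizing k with
  | zero =>
    rcases k with _ | j
    · simp
    · have h1 := h j
      have e : ∀ ξ, v ξ * sinFun j ξ =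
          -√2 * (v ξ * (Real.sin ((j + 1 : ℕ) * (Real.pi * ξ)) * Real.cos (Real.pi * ξ) ^ 0)) := by
        intro ξ
        simp only [sinFun, freq]
        push_cast
        rw [mul_assoc ((j : ℝ) + 1)]
        ring
      simp_rw [e] at h1
      rw [integral_const_mul] at h1
      exact (mul_eq_zero.1 h1).resolve_left (by simp)
  | succ m ih =>
    rcases k with _ | j
    · simp
    · have e : ∀ ξ, v ξ * (Real.sin ((j + 1 : ℕ) * (Real.pi * ξ)) * Real.cos (Real.pi * ξ) ^ (m + 1)) =
          (1 / 2) * (v ξ * (Real.sin ((j + 2 : ℕ) * (Real.pi * ξ)) * Real.cos (Real.pi * ξ) ^ m)) +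
          (1 / 2) * (v ξ * (Real.sin ((j : ℕ) * (Real.pi * ξ)) * Real.cos (Real.pi * ξ) ^ m)) := by
        intro ξ
        have e1 : ((j + 2 : ℕ) : ℝ) * (Real.pi * ξ) = (j + 1 : ℕ) * (Real.pi * ξ) + Real.pi * ξ := by
          push_cast; ring
        have e2 : (j : ℝ) * (Real.pi * ξ) = (j + 1 : ℕ) * (Real.pi * ξ) - Real.pi * ξ := by
          push_cast; ring
        rw [e1, e2, Real.sin_add, Real.sin_sub]
        ring
      have hi : ∀ j : ℕ, Integrable (fun ξ =>
          v ξ * (Real.sin (j * (Real.pi * ξ)) * Real.cos (Real.pi * ξ) ^ m)) leb := fun j =>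
        L2.integrable_mul_continuous v (by fun_prop)
      simp_rw [e]
      rw [integral_add ((hi _).const_mul _) ((hi _).const_mul _), integral_const_mul,
        integral_const_mul, ih, ih]
      simp

/-- Taking k = 1 above, v·sin(πξ) annihilates every polynomial in cos(πξ). As cos(πξ) is injective
on [0,1], Weierstrass' theorem extends this to all test functions, and sin(πξ) > 0 on (0,1) gives v
= 0. -/
theorem L2.eq_zero_of_integral_mul_sinFun (v : L2) (h : ∀ k, ∫ ξ, v ξ * sinFun k ξ ∂leb = 0) :
    v = 0 := by
  have hw : Integrable (fun ξ => v ξ * Real.sin (Real.pi * ξ)) leb :=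
    L2.integrable_mul_continuous v (by fun_prop)
  have hpoly : ∀ P : Polynomial ℝ,
      ∫ ξ, v ξ * Real.sin (Real.pi * ξ) * P.eval (Real.cos (Real.pi * ξ)) ∂leb = 0 := by
    intro P
    simp_rw [Polynomial.eval_eq_sum_range, Finset.mul_sum]
    rw [integral_finsetSum]
    · refine Finset.sum_eq_zero fun m _ => ?_
      have := integral_mul_sin_mul_cos_pow v h m 1
      simp only [Nat.cast_one, one_mul] at this
      have e : ∀ ξ, v ξ * Real.sin (Real.pi * ξ) * (P.coeff m * Real.cos (Real.pi * ξ) ^ m) =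
          P.coeff m * (v ξ * (Real.sin (Real.pi * ξ) * Real.cos (Real.pi * ξ) ^ m)) := fun ξ => by
        ring
      simp_rw [e]
      rw [integral_const_mul, this, mul_zero]
    · intro m _
      refine (L2.integrable_mul_continuous v (g := fun ξ => Real.sin (Real.pi * ξ) *
        (P.coeff m * Real.cos (Real.pi * ξ) ^ m)) (by fun_prop)).congr
        (Eventually.of_forall fun ξ => ?_)
      simp only; ring
  have key : (fun ξ => v ξ * Real.sin (Real.pi * ξ)) =ᵐ[leb] 0 := by
    refine ae_zero_of_test hw fun φ hφ => ?_
    have hφc := hφ.1.continuous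
    set A := ∫ ξ, ‖v ξ * Real.sin (Real.pi * ξ)‖ ∂leb
    have hA : 0 ≤ A := integral_nonneg fun _ => norm_nonneg _
    have hle : ∀ ε > 0, |∫ ξ, v ξ * Real.sin (Real.pi * ξ) * φ ξ ∂leb| ≤ A * ε := by
      intro ε hε
      -- The test function is written as a continuous function of t = cos(πξ) on [-1,1] and
      -- approximated there.
      obtain ⟨P, hP⟩ := exists_polynomial_near_of_continuousOn (-1) 1
        (fun t => φ (Real.arccos t / Real.pi))
        (hφc.comp (Real.continuous_arccos.div_const _)).continuousOn ε hε
      have h1 : ∀ᵐ ξ ∂leb, |φ ξ - P.eval (Real.cos (Real.pi * ξ))| ≤ ε := by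
        refine (ae_restrict_iff' measurableSet_Ioo).2 (Eventually.of_forall fun ξ hξ => ?_)
        have h2 := hP (Real.cos (Real.pi * ξ)) ⟨Real.neg_one_le_cos _, Real.cos_le_one _⟩
        rw [Real.arccos_cos (by have := hξ.1; positivity)
          (by have := hξ.2; have := Real.pi_pos; nlinarith), mul_div_cancel_left₀ _ Real.pi_ne_zero]
          at h2
        rw [abs_sub_comm]; exact h2.le
      have hi1 : Integrable (fun ξ => v ξ * Real.sin (Real.pi * ξ) * φ ξ) leb := by
        refine (L2.integrable_mul_continuous v (g := fun ξ => Real.sin (Real.pi * ξ) * φ ξ)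
          (by fun_prop)).congr (Eventually.of_forall fun ξ => ?_)
        simp only; ring
      have hi2 : Integrable (fun ξ => v ξ * Real.sin (Real.pi * ξ) *
          P.eval (Real.cos (Real.pi * ξ))) leb := by
        refine (L2.integrable_mul_continuous v (g := fun ξ => Real.sin (Real.pi * ξ) *
          P.eval (Real.cos (Real.pi * ξ))) (by fun_prop)).congr (Eventually.of_forall fun ξ => ?_)
        simp only; ring
      have e : ∫ ξ, v ξ * Real.sin (Real.pi * ξ) * φ ξ ∂leb =
          ∫ ξ, v ξ * Real.sin (Real.pi * ξ) * (φ ξ - P.eval (Real.cos (Real.pi * ξ))) ∂leb := by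
        simp_rw [mul_sub]
        rw [integral_sub hi1 hi2, hpoly, sub_zero]
      rw [e, ← Real.norm_eq_abs, ← integral_mul_const]
      refine norm_integral_le_of_norm_le (hw.norm.mul_const ε) ?_
      filter_upwards [h1] with ξ hξ
      rw [norm_mul]
      exact mul_le_mul_of_nonneg_left hξ (norm_nonneg _)
    by_contra hne
    have hpos := abs_pos.2 hne
    -- The denominator 2(A + 1) makes A·ε strictly smaller than the integral, also when A = 0.
    have := hle (|∫ ξ, v ξ * Real.sin (Real.pi * ξ) * φ ξ ∂leb| / (2 * (A + 1))) (by positivity)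
    rw [← mul_div_assoc, le_div_iff₀ (by positivity)] at this
    nlinarith
  refine Lp.ext ?_
  have hae : ∀ᵐ ξ ∂leb, ξ ∈ Ioo (0 : ℝ) 1 := ae_restrict_mem measurableSet_Ioo
  filter_upwards [key, hae, Lp.coeFn_zero ℝ 2 leb] with ξ h1 h2 h3
  rw [h3]
  have : 0 < Real.sin (Real.pi * ξ) := Real.sin_pos_of_pos_of_lt_pi
    (by have := h2.1; positivity) (by have := h2.2; have := Real.pi_pos; nlinarith)
  exact (mul_eq_zero.1 h1).resolve_right this.ne'

theorem inner_B (x : X) (u : MeanZeroH1) : ⟪x, B u⟫ = x u := by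
  change ⟪B.symm x, B.symm (B u)⟫ = x u
  rw [LinearIsometryEquiv.symm_apply_apply, MeanZeroH1.inner_eq, ← B_apply,
    LinearIsometryEquiv.apply_symm_apply]

theorem inner_dualBasis (x : X) (k : ℕ) : ⟪x, dualBasis k⟫ = x (cosBasis k) := inner_B x _

/-- The values on the cosines are the sine coefficients of the weak derivative of B⁻¹x, and the
sines are complete in L². -/
theorem X.eq_zero_of_cosBasis (x : X) (h : ∀ k, x (cosBasis k) = 0) : x = 0 := by
  have h1 : (B.symm x).weakDeriv = 0 := by
    refine L2.eq_zero_of_integral_mul_sinFun _ fun k => ?_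
    have h2 := h k
    rw [← B.apply_symm_apply x, B_apply, weakDeriv_cosBasis] at h2
    rw [← h2]
    refine integral_congr_ae ?_
    filter_upwards [contL2_ae (continuous_sinFun k)] with ξ hξ
    rw [hξ]
  have h3 : B.symm x = 0 := MeanZeroH1.weakDeriv_injective (by rw [h1, map_zero])
  rw [← B.apply_symm_apply x, h3, LinearIsometryEquiv.map_zero]

/-- `dualBasis` as a Hilbert basis of `X`. -/
def dualHilbertBasis : HilbertBasis ℕ ℝ X :=
  HilbertBasis.mkOfOrthogonalEqBot orthonormal_dualBasis (by
    rw [Submodule.eq_bot_iff]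
    intro x hx
    refine X.eq_zero_of_cosBasis x fun k => ?_
    rw [← inner_dualBasis, real_inner_comm]
    exact (Submodule.mem_orthogonal _ _).1 hx _ (Submodule.subset_span ⟨k, rfl⟩))

theorem coe_dualHilbertBasis : (dualHilbertBasis : ℕ → X) = dualBasis :=
  HilbertBasis.coe_mkOfOrthogonalEqBot _ _

instance : SecondCountableTopology L2 := by
  have : Fact ((2 : ℝ≥0∞) ≠ ⊤) := ⟨by simp⟩
  infer_instance

instance : SecondCountableTopology X := by
  have hw : Isometry (fun x : X => (B.symm x).weakDeriv) :=
    AddMonoidHomClass.isometry_of_norm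
      (MeanZeroH1.weakDeriv ∘ₗ (B.symm.toLinearEquiv : X →ₗ[ℝ] MeanZeroH1)) fun x =>
        B.symm.norm_map x
  exact hw.isEmbedding.secondCountableTopology

/-! ### The resolvent -/

/-- The inclusion of `MeanZeroH1` into `L²(0,1)` as a bounded operator. -/
def toL2CLM : MeanZeroH1 →L[ℝ] L2 :=
  MeanZeroH1.toL2.mkContinuous 2 fun u => u.norm_toL2_le

theorem norm_toL2_le_two_mul (u : MeanZeroH1) : ‖u.toL2‖ ≤ 2 * ‖u‖ := u.norm_toL2_le

theorem embed_apply (u y : MeanZeroH1) : embed u y = ⟪u.toL2, y.toL2⟫ := rfl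

theorem resolvent_onePlus {α : ℝ} (hα : 0 < α) (u : MeanZeroH1) :
    resolvent α (embed u + α • B u) = u :=
  (onePlus_bijective hα).1 (onePlus_resolvent hα _)

/-- Weak form of u + αBu = x; the estimates of the resolvent come from choosing the test element. -/
theorem resolvent_apply_test {α : ℝ} (hα : 0 < α) (x : X) (w : MeanZeroH1) :
    ⟪(resolvent α x).toL2, w.toL2⟫ + α * ⟪resolvent α x, w⟫ = x w := by
  have := congrArg (fun z : X => z w) (onePlus_resolvent hα x)
  exact this

/-- Energy estimate with the solution itself as test element: the resolvent contracts the L² norm,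
and the factor 2 is the Poincaré constant. -/
theorem norm_toL2_resolvent_embed_le {α : ℝ} (hα : 0 < α) (y : MeanZeroH1) :
    ‖(resolvent α (embed y)).toL2‖ ≤ 2 * ‖y‖ := by
  refine le_trans ?_ (norm_toL2_le_two_mul y)
  set u := resolvent α (embed y)
  have h := resolvent_apply_test hα (embed y) u
  rw [embed_apply, real_inner_self_eq_norm_sq, real_inner_self_eq_norm_sq] at h
  have h1 := real_inner_le_norm y.toL2 u.toL2
  have h2 : ‖u.toL2‖ * ‖u.toL2‖ ≤ ‖y.toL2‖ * ‖u.toL2‖ := by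
    nlinarith [mul_nonneg hα.le (sq_nonneg ‖u‖)]
  rcases (norm_nonneg u.toL2).eq_or_lt with h0 | h0
  · rw [← h0]; exact norm_nonneg _
  · exact le_of_mul_le_mul_right h2 h0

/-- Testing with u - y gives ‖u - y‖² = α(⟪u, y⟫ - ‖u‖²). The rate is uniform on bounded sets of
`MeanZeroH1`, as is needed for convergence in the dual norm. -/
theorem norm_toL2_resolvent_embed_sub_le {α : ℝ} (hα : 0 < α) (y : MeanZeroH1) :
    ‖(resolvent α (embed y)).toL2 - y.toL2‖ ≤ √α * ‖y‖ := by
  set u := resolvent α (embed y) with hu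
  have h := resolvent_apply_test hα (embed y) (u - y)
  rw [embed_apply, ← hu, map_sub] at h
  have h1 : ‖u.toL2 - y.toL2‖ ^ 2 = α * (⟪u, y⟫ - ‖u‖ ^ 2) := by
    rw [← real_inner_self_eq_norm_sq, inner_sub_left]
    rw [inner_sub_right u, real_inner_self_eq_norm_sq u] at h
    linarith
  have h2 : ⟪u, y⟫ - ‖u‖ ^ 2 ≤ ‖y‖ ^ 2 := by
    have := real_inner_le_norm u y
    nlinarith [sq_nonneg (‖u‖ - ‖y‖), sq_nonneg (‖y‖), sq_nonneg ‖u‖]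
  refine le_of_sq_le_sq ?_ (by positivity)
  rw [h1, mul_pow, Real.sq_sqrt hα.le]
  exact mul_le_mul_of_nonneg_left h2 hα.le

/-- The eigenvalues `(1 + α((k+1)π)²)⁻¹` of the resolvent. -/
def resolventEigenvalue (α : ℝ) (k : ℕ) : ℝ := (1 + α * freq k ^ 2)⁻¹

theorem resolvent_dualBasis {α : ℝ} (hα : 0 < α) (k : ℕ) :
    resolvent α (dualBasis k) = (resolventEigenvalue α k * freq k ^ 2) • cosBasis k := by
  have hk := (freq_pos k).ne'
  have h1 : dualBasis k = embed ((resolventEigenvalue α k * freq k ^ 2) • cosBasis k) +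
      α • B ((resolventEigenvalue α k * freq k ^ 2) • cosBasis k) := by
    have h2 : B (cosBasis k) = dualBasis k := rfl
    rw [map_smul, map_smul, embed_cosBasis, h2, smul_smul, smul_smul, ← add_smul]
    have h3 : 1 + α * freq k ^ 2 ≠ 0 := by positivity
    have h4 : resolventEigenvalue α k * freq k ^ 2 * (1 / freq k ^ 2) +
        α * (resolventEigenvalue α k * freq k ^ 2) = 1 := by
      rw [resolventEigenvalue]; field_simp
    rw [h4, one_smul]
  conv_lhs => rw [h1]
  exact resolvent_onePlus hα _

theorem resolventEigenvalue_nonneg {α : ℝ} (hα : 0 ≤ α) (k : ℕ) : 0 ≤ resolventEigenvalue α k := by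
  unfold resolventEigenvalue; positivity

theorem abs_resolventEigenvalue_le {α : ℝ} (hα : 0 ≤ α) (k : ℕ) : |resolventEigenvalue α k| ≤ 1 := by
  rw [abs_of_nonneg (resolventEigenvalue_nonneg hα k)]
  refine inv_le_one_of_one_le₀ ?_
  have : 0 ≤ α * freq k ^ 2 := by positivity
  linarith

theorem Binv_apply (z : X) (y : MeanZeroH1) : Binv z y = ⟪z, embed y⟫ := by
  have h1 : Binv z y = embed (B.symm z) y := rfl
  have h2 : ⟪z, embed y⟫ = ⟪embed y, B (B.symm z)⟫ := by
    rw [LinearIsometryEquiv.apply_symm_apply, real_inner_comm]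
  rw [h1, h2, inner_B, embed_apply, embed_apply, real_inner_comm]

theorem Binv_dualBasis (k : ℕ) : Binv (dualBasis k) = (1 / freq k ^ 2) • dualBasis k := by
  rw [← embed_cosBasis]
  change embed (B.symm (B (cosBasis k))) = _
  rw [LinearIsometryEquiv.symm_apply_apply]

/-- The operator `Q^{1/2} = 2^{-1/2} B⁻¹`. -/
def sqrtQ : X →L[ℝ] X := (√2)⁻¹ • Binv

theorem sqrtQ_dualBasis (k : ℕ) :
    sqrtQ (dualBasis k) = eigenvalue k ^ (1 / 2 : ℝ) • dualBasis k := by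
  have h1 : eigenvalue k ^ (1 / 2 : ℝ) = (√2)⁻¹ * (1 / freq k ^ 2) := by
    have h2 : eigenvalue k = ((√2)⁻¹ * (1 / freq k ^ 2)) ^ 2 := by
      rw [eigenvalue, mul_pow, inv_pow, Real.sq_sqrt (by norm_num)]
      ring
    rw [h2, ← Real.sqrt_eq_rpow, Real.sqrt_sq (by positivity)]
  change (√2)⁻¹ • Binv (dualBasis k) = _
  rw [Binv_dualBasis, smul_smul, h1]

theorem sqrtQ_apply (z : X) (y : MeanZeroH1) : sqrtQ z y = (√2)⁻¹ * ⟪z, embed y⟫ := by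
  rw [← Binv_apply]; rfl


/-! ### Integral functionals on `L²(0,1)` -/

/-- `ψ` is a Lipschitz selection of the subdifferential of `ρ`. -/
structure IsLipschitzSubgradient (ρ ψ : ℝ → ℝ) (L : ℝ) : Prop where
  continuous : Continuous ρ
  nonneg : 0 ≤ L
  add_le : ∀ a b, ρ a + ψ a * (b - a) ≤ ρ b
  abs_sub_le : ∀ a b, |ψ a - ψ b| ≤ L * |a - b|

namespace IsLipschitzSubgradient
variable {ρ ψ : ℝ → ℝ} {L : ℝ} (h : IsLipschitzSubgradient ρ ψ L)
include h

/-- The subgradient inequality at b combined with the Lipschitz bound; the constant L in place of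
L/2 is sufficient and needs no integration. -/
theorem le_add (a b : ℝ) : ρ b ≤ ρ a + ψ a * (b - a) + L * (b - a) ^ 2 := by
  have h1 := h.add_le b a
  have h2 := h.abs_sub_le b a
  have h3 : (ψ b - ψ a) * (b - a) ≤ L * |b - a| * |b - a| :=
    (le_abs_self _).trans (by rw [abs_mul]; gcongr)
  rw [mul_assoc, ← sq, sq_abs] at h3
  linarith

theorem continuous_subgradient : Continuous ψ :=
  (LipschitzWith.of_dist_le_mul (K := ⟨L, h.nonneg⟩) fun r s => h.abs_sub_le r s).continuous

theorem abs_subgradient_le (t : ℝ) : |ψ t| ≤ |ψ 0| + L * |t| := by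
  have := h.abs_sub_le t 0
  rw [sub_zero] at this
  calc |ψ t| = |ψ 0 + (ψ t - ψ 0)| := by congr 1; ring
    _ ≤ _ := (abs_add_le _ _).trans (by linarith)

theorem memLp_comp {w : ℝ → ℝ} (hw : MemLp w 2 leb) : MemLp (fun ξ => ψ (w ξ)) 2 leb := by
  refine MemLp.mono' ((memLp_const |ψ 0|).add (hw.norm.const_mul L))
    (h.continuous_subgradient.comp_aestronglyMeasurable hw.1) (Eventually.of_forall fun ξ => ?_)
  exact h.abs_subgradient_le _

theorem integrable_comp {w : ℝ → ℝ} (hw : MemLp w 2 leb) : Integrable (fun ξ => ρ (w ξ)) leb := by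
  have hi := (hw.integrable one_le_two).norm
  refine (((integrable_const |ρ 0|).add (hi.const_mul |ψ 0|)).add
    (hw.integrable_sq.const_mul L)).mono' (h.continuous.comp_aestronglyMeasurable hw.1)
    (Eventually.of_forall fun ξ => ?_)
  have h1 := h.add_le 0 (w ξ)
  have h2 := h.le_add 0 (w ξ)
  have h3 : |ψ 0 * (w ξ - 0)| ≤ |ψ 0| * |w ξ| := by rw [sub_zero, abs_mul]
  have h4 : 0 ≤ L * w ξ ^ 2 := mul_nonneg h.nonneg (sq_nonneg _)
  rw [sub_zero] at *
  simp only [Pi.add_apply, Real.norm_eq_abs]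
  rw [abs_le] at *
  constructor <;> linarith [neg_abs_le (ρ 0), le_abs_self (ρ 0)]

/-- The superposition operator `w ↦ ψ ∘ w` on `L²(0,1)`. -/
def superposition (w : L2) : L2 := (h.memLp_comp (Lp.memLp w)).toLp

theorem coeFn_superposition (w : L2) : h.superposition w =ᵐ[leb] fun ξ => ψ (w ξ) :=
  (h.memLp_comp (Lp.memLp w)).coeFn_toLp

theorem lipschitzWith_superposition : LipschitzWith ⟨L, h.nonneg⟩ h.superposition := by
  refine LipschitzWith.of_dist_le_mul fun v w => ?_
  rw [dist_eq_norm, dist_eq_norm]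
  refine Lp.norm_le_mul_norm_of_ae_le_mul ?_
  filter_upwards [h.coeFn_superposition v, h.coeFn_superposition w,
    Lp.coeFn_sub (h.superposition v) (h.superposition w), Lp.coeFn_sub v w] with ξ h1 h2 h3 h4
  rw [h3, h4, Pi.sub_apply, Pi.sub_apply, h1, h2]
  exact h.abs_sub_le _ _

theorem inner_superposition (w v : L2) : ⟪h.superposition w, v⟫ = ∫ ξ, ψ (w ξ) * v ξ ∂leb := by
  rw [← L2.integral_mul]
  refine integral_congr_ae ?_
  filter_upwards [h.coeFn_superposition w] with ξ hξ
  rw [hξ]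

/-- Integrated forms of the two pointwise inequalities. The lower one yields convexity, and both
together yield differentiability. -/
theorem integral_bounds (v w : L2) :
    ∫ ξ, ρ (v ξ) ∂leb + ⟪h.superposition v, w - v⟫ ≤ ∫ ξ, ρ (w ξ) ∂leb ∧
    ∫ ξ, ρ (w ξ) ∂leb ≤
      ∫ ξ, ρ (v ξ) ∂leb + ⟪h.superposition v, w - v⟫ + L * ‖w - v‖ ^ 2 := by
  have hv := h.integrable_comp (Lp.memLp v)
  have hw := h.integrable_comp (Lp.memLp w)
  have hm : Integrable (fun ξ => ψ (v ξ) * (w - v : L2) ξ) leb :=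
    (h.memLp_comp (Lp.memLp v)).integrable_mul (Lp.memLp (w - v))
  have hs : Integrable (fun ξ => L * (w - v : L2) ξ ^ 2) leb :=
    (Lp.memLp (w - v)).integrable_sq.const_mul L
  have hn : ‖w - v‖ ^ 2 = ∫ ξ, (w - v : L2) ξ ^ 2 ∂leb := by
    rw [← real_inner_self_eq_norm_sq, ← L2.integral_mul]
    congr 1; ext ξ; ring
  have hsub := Lp.coeFn_sub w v
  rw [h.inner_superposition, hn, ← integral_const_mul, ← integral_add hv hm,
    ← integral_add (f := fun ξ => ρ (v ξ) + ψ (v ξ) * (w - v : L2) ξ) (hv.add hm) hs]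
  constructor
  · refine integral_mono_ae (hv.add hm) hw ?_
    filter_upwards [hsub] with ξ hξ
    simp only [hξ, Pi.sub_apply]
    exact h.add_le _ _
  · refine integral_mono_ae hw ((hv.add hm).add hs) ?_
    filter_upwards [hsub] with ξ hξ
    simp only [hξ, Pi.sub_apply]
    exact h.le_add _ _

/-- The remainder lies between 0 and L‖v - w‖². No differentiability of ψ or of the superposition
operator is involved. -/
theorem hasFDerivAt_integral (w : L2) :
    HasFDerivAt (fun v : L2 => ∫ ξ, ρ (v ξ) ∂leb) (innerSL ℝ (h.superposition w)) w := by
  refine HasFDerivAt.of_isLittleO ?_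
  refine Asymptotics.IsBigO.trans_isLittleO (g := fun v : L2 => ‖v - w‖ ^ 2) ?_
    (Asymptotics.isLittleO_pow_sub_sub w one_lt_two)
  refine Asymptotics.IsBigO.of_bound L (Eventually.of_forall fun v => ?_)
  obtain ⟨h1, h2⟩ := h.integral_bounds w v
  rw [innerSL_apply_apply, Real.norm_eq_abs, Real.norm_eq_abs, abs_of_nonneg (by linarith),
    abs_of_nonneg (by positivity)]
  linarith

theorem convexOn_integral : ConvexOn ℝ univ (fun v : L2 => ∫ ξ, ρ (v ξ) ∂leb) := by
  refine ⟨convex_univ, fun x _ y _ a b ha hb hab => ?_⟩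
  have h1 := (h.integral_bounds (a • x + b • y) x).1
  have h2 := (h.integral_bounds (a • x + b • y) y).1
  have h3 : a * ⟪h.superposition (a • x + b • y), x - (a • x + b • y)⟫ +
      b * ⟪h.superposition (a • x + b • y), y - (a • x + b • y)⟫ = 0 := by
    rw [← real_inner_smul_right, ← real_inner_smul_right, ← inner_add_right]
    have : a • (x - (a • x + b • y)) + b • (y - (a • x + b • y)) =
        (1 - (a + b)) • (a • x + b • y) := by module
    rw [this, hab, sub_self, zero_smul, inner_zero_right]
  simp only [smul_eq_mul]
  have hb' : b = 1 - a := by linarith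
  have e1 := mul_le_mul_of_nonneg_left h1 ha
  have e2 := mul_le_mul_of_nonneg_left h2 hb
  have e3 : a * ∫ ξ, ρ ((a • x + b • y : L2) ξ) ∂leb + b * ∫ ξ, ρ ((a • x + b • y : L2) ξ) ∂leb =
      ∫ ξ, ρ ((a • x + b • y : L2) ξ) ∂leb := by rw [← add_mul, hab, one_mul]
  linarith

theorem continuous_integral : Continuous (fun v : L2 => ∫ ξ, ρ (v ξ) ∂leb) :=
  continuous_iff_continuousAt.2 fun w => (h.hasFDerivAt_integral w).continuousAt

end IsLipschitzSubgradient

/-- Applies to G = T* ∘ Ψ ∘ T: pair the difference with itself, move to the other side of T, and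
divide by its norm. -/
theorem norm_sub_le_of_inner_eq {H K : Type*} [NormedAddCommGroup H] [InnerProductSpace ℝ H]
    [NormedAddCommGroup K] [InnerProductSpace ℝ K] {T : H → K} {Ψ : K → K} {G : H → H} {L C : ℝ}
    (hL : 0 ≤ L) (hsub : ∀ x y, T (x - y) = T x - T y) (hT : ∀ x, ‖T x‖ ≤ C * ‖x‖)
    (hΨ : ∀ v w, ‖Ψ v - Ψ w‖ ≤ L * ‖v - w‖) (hG : ∀ x z, ⟪G x, z⟫ = ⟪Ψ (T x), T z⟫) (x y : H) :
    ‖G x - G y‖ ≤ L * C * C * ‖x - y‖ := by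
  have h1 : ‖G x - G y‖ * ‖G x - G y‖ ≤ (L * C * C * ‖x - y‖) * ‖G x - G y‖ := by
    rw [← real_inner_self_eq_norm_mul_norm, inner_sub_left, hG, hG, ← inner_sub_left]
    have h2 : ‖Ψ (T x) - Ψ (T y)‖ ≤ L * (C * ‖x - y‖) :=
      (hΨ _ _).trans (by rw [← hsub]; exact mul_le_mul_of_nonneg_left (hT _) hL)
    calc _ ≤ ‖Ψ (T x) - Ψ (T y)‖ * ‖T (G x - G y)‖ := real_inner_le_norm _ _
      _ ≤ L * (C * ‖x - y‖) * (C * ‖G x - G y‖) :=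
          mul_le_mul h2 (hT _) (norm_nonneg _) ((norm_nonneg _).trans h2)
      _ = _ := by ring
  -- Division is impossible when the difference vanishes; then the sign of C, which is not assumed,
  -- is recovered from `hT` if x ≠ y.
  rcases (norm_nonneg (G x - G y)).eq_or_lt with h0 | h0
  · rw [← h0]
    rcases (norm_nonneg (x - y)).eq_or_lt with h3 | h3
    · rw [← h3, mul_zero]
    · have := (norm_nonneg _).trans (hT (x - y))
      have hC : 0 ≤ C := nonneg_of_mul_nonneg_left this h3
      positivity
  · exact le_of_mul_le_mul_right h1 h0

/-! ### The approximating functionals -/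

section UApprox
variable {Φ : ℝ → ℝ}

theorem isLipschitzSubgradient_moreauYosida (hΦ : ContDiff ℝ 2 Φ) (hconv : ConvexOn ℝ univ Φ)
    {α : ℝ} (hα : 0 < α) : IsLipschitzSubgradient (moreauYosida Φ α) (yosida Φ α) α⁻¹ where
  continuous := by
    have := (convexOn_moreauYosida hΦ hconv hα).continuousOn isOpen_univ
    rwa [continuousOn_univ] at this
  nonneg := (inv_pos.2 hα).le
  add_le := moreauYosida_add_le hΦ hconv hα
  abs_sub_le := abs_yosida_sub_le hΦ hconv hα

/-- The resolvent as an operator with values in `L²(0,1)`. -/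
def resolventL2 (α : ℝ) : X →L[ℝ] L2 := toL2CLM ∘L resolvent α

theorem resolventL2_apply (α : ℝ) (x : X) : resolventL2 α x = (resolvent α x).toL2 := rfl

/-- Testing the equation with its solution bounds the H norm by α⁻¹‖x‖, and Poincaré's inequality
contributes the factor 2. -/
theorem norm_resolventL2_le {α : ℝ} (hα : 0 < α) (x : X) :
    ‖resolventL2 α x‖ ≤ 2 * α⁻¹ * ‖x‖ := by
  set u := resolvent α x with hu
  have h1 := resolvent_apply_test hα x u
  rw [← hu, real_inner_self_eq_norm_sq, real_inner_self_eq_norm_sq] at h1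
  have h2 : x u ≤ ‖x‖ * ‖u‖ := (le_abs_self _).trans (x.le_opNorm u)
  have h3 : α * ‖u‖ ≤ ‖x‖ := by
    rcases (norm_nonneg u).eq_or_lt with h0 | h0
    · rw [← h0, mul_zero]; exact norm_nonneg x
    · exact le_of_mul_le_mul_right (by nlinarith [sq_nonneg ‖u.toL2‖]) h0
  have h4 : ‖u‖ ≤ α⁻¹ * ‖x‖ := by rwa [le_inv_mul_iff₀ hα]
  calc ‖resolventL2 α x‖ ≤ 2 * ‖u‖ := norm_toL2_le_two_mul u
    _ ≤ 2 * α⁻¹ * ‖x‖ := by linarith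

variable (hΦ : ContDiff ℝ 2 Φ) (hconv : ConvexOn ℝ univ Φ) {α : ℝ} (hα : 0 < α)

/-- The superposition operator on `L²(0,1)` of the Yosida approximation of `Φ'`. -/
def yosidaL2 : L2 → L2 := (isLipschitzSubgradient_moreauYosida hΦ hconv hα).superposition

/-- The gradient of `UApprox Φ α`. -/
def gradUApprox (x : X) : X :=
  (resolventL2 α).adjoint (yosidaL2 hΦ hconv hα (resolventL2 α x))

theorem inner_gradUApprox (x z : X) : ⟪gradUApprox hΦ hconv hα x, z⟫ =
    ⟪yosidaL2 hΦ hconv hα (resolventL2 α x), resolventL2 α z⟫ :=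
  ContinuousLinearMap.adjoint_inner_left _ _ _

theorem hasFDerivAt_UApprox (x : X) :
    HasFDerivAt (UApprox Φ α) (innerSL ℝ (gradUApprox hΦ hconv hα x)) x := by
  have h := ((isLipschitzSubgradient_moreauYosida hΦ hconv hα).hasFDerivAt_integral
    (resolventL2 α x)).comp x (resolventL2 α).hasFDerivAt
  refine h.congr_fderiv ?_
  ext z
  simp only [ContinuousLinearMap.comp_apply, innerSL_apply_apply, inner_gradUApprox]
  rfl

theorem exists_lipschitzWith_gradUApprox :
    ∃ L : ℝ≥0, LipschitzWith L (gradUApprox hΦ hconv hα) := by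
  have hL : 0 ≤ α⁻¹ := (inv_pos.2 hα).le
  refine ⟨⟨α⁻¹ * (2 * α⁻¹) * (2 * α⁻¹), by positivity⟩,
    LipschitzWith.of_dist_le_mul fun x y => ?_⟩
  rw [dist_eq_norm, dist_eq_norm]
  refine norm_sub_le_of_inner_eq (T := fun x => resolventL2 α x) (Ψ := yosidaL2 hΦ hconv hα) hL
    (fun x y => map_sub _ x y) (norm_resolventL2_le hα) (fun v w => ?_)
    (fun x z => inner_gradUApprox hΦ hconv hα x z) x y
  exact (isLipschitzSubgradient_moreauYosida hΦ hconv hα).lipschitzWith_superposition.norm_sub_le v w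

include hΦ hconv hα in
theorem convexOn_UApprox : ConvexOn ℝ univ (UApprox Φ α) :=
  (isLipschitzSubgradient_moreauYosida hΦ hconv hα).convexOn_integral.comp_linearMap
    (resolventL2 α).toLinearMap

theorem gradient_UApprox : gradient (UApprox Φ α) = gradUApprox hΦ hconv hα := by
  ext1 x
  refine HasGradientAt.gradient ?_
  rw [hasGradientAt_iff_hasFDerivAt]
  exact hasFDerivAt_UApprox hΦ hconv hα x

/-- As B⁻¹ is symmetric in X, the weight passes to the test element: applying Q^{1/2}DU_α to y is,
up to 2^{-1/2}, pairing DU_α with the embedded y. -/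
theorem sqrtQ_gradUApprox_apply (x : X) (y : MeanZeroH1) :
    sqrtQ (gradUApprox hΦ hconv hα x) y =
      (√2)⁻¹ * ⟪yosidaL2 hΦ hconv hα (resolventL2 α x), (resolvent α (embed y)).toL2⟫ := by
  rw [sqrtQ_apply, inner_gradUApprox]
  rfl

theorem coeFn_yosidaL2 (w : L2) :
    yosidaL2 hΦ hconv hα w =ᵐ[leb] fun ξ => yosida Φ α (w ξ) :=
  (isLipschitzSubgradient_moreauYosida hΦ hconv hα).coeFn_superposition w

end UApprox

/-! ### Convexity of `U` -/

theorem U_ne_bot (Φ : ℝ → ℝ) (p : ℝ) (x : X) : U Φ p x ≠ ⊥ := by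
  unfold U
  split_ifs <;> simp

theorem exists_isAdmissible_of_U_le {Φ : ℝ → ℝ} {p : ℝ} {x : X} {t : ℝ} (h : U Φ p x ≤ t) :
    ∃ g, IsAdmissible p g x := by
  by_contra hne
  rw [U, dif_neg hne] at h
  simp at h

theorem IsAdmissible.integrable_mul {p : ℝ} (hp : 2 ≤ p) {g : ℝ → ℝ} {x : X}
    (hg : IsAdmissible p g x) (v : L2) : Integrable (fun ξ => g ξ * v ξ) leb := by
  have h2 : MemLp g 2 leb := hg.1.mono_exponent (by
    rw [← ENNReal.ofReal_ofNat]; exact ENNReal.ofReal_le_ofReal hp)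
  exact h2.integrable_mul (Lp.memLp v)

theorem IsAdmissible.combo {p : ℝ} (hp : 2 ≤ p) {g h : ℝ → ℝ} {x y : X} (hg : IsAdmissible p g x)
    (hh : IsAdmissible p h y) (a b : ℝ) :
    IsAdmissible p (fun ξ => a * g ξ + b * h ξ) (a • x + b • y) := by
  have hp1 : 1 ≤ ENNReal.ofReal p := by simpa using one_le_two.trans hp
  refine ⟨(hg.1.const_mul a).add (hh.1.const_mul b), ?_, fun z => ?_⟩
  · rw [integral_add ((hg.1.integrable hp1).const_mul a) ((hh.1.integrable hp1).const_mul b),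
      integral_const_mul, integral_const_mul, hg.2.1, hh.2.1]
    simp
  · have e : ∀ ξ, (a * g ξ + b * h ξ) * z.toL2 ξ = a * (g ξ * z.toL2 ξ) + b * (h ξ * z.toL2 ξ) :=
      fun ξ => by ring
    simp_rw [e]
    rw [integral_add ((hg.integrable_mul hp _).const_mul a) ((hh.integrable_mul hp _).const_mul b),
      integral_const_mul, integral_const_mul, ← hg.2.2 z, ← hh.2.2 z]
    rfl

theorem integrable_comp_of_growth {Φ : ℝ → ℝ} (hc : Continuous Φ) {C p : ℝ} (hp : 0 < p)
    (hC : ∀ t, |Φ t| ≤ C * (1 + |t| ^ p)) {g : ℝ → ℝ} (hg : MemLp g (ENNReal.ofReal p) leb) :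
    Integrable (fun ξ => Φ (g ξ)) leb := by
  have h1 : Integrable (fun ξ => ‖g ξ‖ ^ p) leb := by
    have := hg.integrable_norm_rpow (by simpa using hp) ENNReal.ofReal_ne_top
    rwa [ENNReal.toReal_ofReal hp.le] at this
  refine (((integrable_const (1 : ℝ)).add h1).const_mul C).mono' (hc.comp_aestronglyMeasurable hg.1)
    (Eventually.of_forall fun ξ => hC _)

/-- Points of the epigraph come from L^p functions, whose combinations represent the combined
functional. The growth bound makes all the integrals genuine, and pointwise convexity is integrated.
-/
theorem convex_epigraph_U {Φ : ℝ → ℝ} (hc : Continuous Φ) (hconv : ConvexOn ℝ univ Φ) {C p : ℝ}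
    (hp : 2 ≤ p) (hC : ∀ t, |Φ t| ≤ C * (1 + |t| ^ p)) :
    Convex ℝ {z : X × ℝ | U Φ p z.1 ≤ (z.2 : EReal)} := by
  rintro ⟨x, s⟩ hx ⟨y, t⟩ hy a b ha hb hab
  simp only [mem_ofPred_eq] at hx hy ⊢
  have hp1 : 1 ≤ p := by linarith
  obtain ⟨g, hg⟩ := exists_isAdmissible_of_U_le hx
  obtain ⟨h, hh⟩ := exists_isAdmissible_of_U_le hy
  rw [U_eq hp1 hg, EReal.coe_le_coe_iff] at hx
  rw [U_eq hp1 hh, EReal.coe_le_coe_iff] at hy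
  change U Φ p (a • x + b • y) ≤ ((a • s + b • t : ℝ) : EReal)
  have hco := hg.combo hp hh a b
  rw [U_eq hp1 hco, EReal.coe_le_coe_iff]
  have hp0 : 0 < p := by linarith
  have hi1 := integrable_comp_of_growth hc hp0 hC hg.1
  have hi2 := integrable_comp_of_growth hc hp0 hC hh.1
  have hi3 := integrable_comp_of_growth hc hp0 hC hco.1
  calc ∫ ξ, Φ (a * g ξ + b * h ξ) ∂leb ≤ ∫ ξ, (a * Φ (g ξ) + b * Φ (h ξ)) ∂leb := by
        refine integral_mono hi3 ((hi1.const_mul a).add (hi2.const_mul b)) fun ξ => ?_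
        exact hconv.2 (mem_univ _) (mem_univ _) ha hb hab
    _ = a * ∫ ξ, Φ (g ξ) ∂leb + b * ∫ ξ, Φ (h ξ) ∂leb := by
        rw [integral_add (hi1.const_mul a) (hi2.const_mul b), integral_const_mul,
          integral_const_mul]
    _ ≤ a • s + b • t := by
        simp only [smul_eq_mul]
        gcongr


/-! ### Moments of Gaussian measures -/

/-- The `L^r` norm of a standard normal random variable. -/
def gaussMoment (r : ℝ≥0∞) : ℝ≥0∞ := eLpNorm id r (ProbabilityTheory.gaussianReal 0 1)

theorem gaussMoment_lt_top {r : ℝ≥0∞} (hr : r ≠ ⊤) : gaussMoment r < ⊤ :=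
  (ProbabilityTheory.memLp_id_gaussianReal' r hr).2

section
variable {H : Type*} [NormedAddCommGroup H] [InnerProductSpace ℝ H]

theorem inner_sum_eigenvectors {b : ℕ → H} (hb : Orthonormal ℝ b) {S : H →L[ℝ] H} {lam : ℕ → ℝ}
    (hS : ∀ k, S (b k) = lam k • b k) (s : Finset ℕ) (c : ℕ → ℝ) :
    ⟪S (∑ k ∈ s, c k • b k), ∑ k ∈ s, c k • b k⟫ = ∑ k ∈ s, lam k * c k ^ 2 := by
  have e : S (∑ k ∈ s, c k • b k) = ∑ k ∈ s, (lam k * c k) • b k := by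
    rw [map_sum]
    refine Finset.sum_congr rfl fun k _ => ?_
    rw [map_smul, hS, smul_smul, mul_comm]
  rw [e, hb.inner_sum]
  refine Finset.sum_congr rfl fun k _ => ?_
  simp; ring

theorem IsGaussianMeasure.isProbabilityMeasure [MeasurableSpace H] [BorelSpace H]
    {μ : Measure H} {S : H →L[ℝ] H}
    (hμ : IsGaussianMeasure μ S) : IsProbabilityMeasure μ := by
  have := hμ.isGaussian
  infer_instance

variable [CompleteSpace H] [MeasurableSpace H] [BorelSpace H] [SecondCountableTopology H]

theorem IsGaussianMeasure.memLp {μ : Measure H} {S : H →L[ℝ] H} (hμ : IsGaussianMeasure μ S)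
    (r : ℝ≥0∞) (hr : r ≠ ⊤) : MemLp (fun x : H => x) r μ := by
  have := hμ.isGaussian
  exact ProbabilityTheory.IsGaussian.memLp_id μ r hr

/-- The law of ⟪·, h⟫ is centred Gaussian with variance ⟪Sh, h⟫, that is, a standard normal scaled
by the standard deviation. -/
theorem IsGaussianMeasure.eLpNorm_inner {μ : Measure H} {S : H →L[ℝ] H}
    (hμ : IsGaussianMeasure μ S) (h : H) (r : ℝ≥0∞) :
    eLpNorm (fun x => ⟪x, h⟫) r μ = ENNReal.ofReal √⟪S h, h⟫ * gaussMoment r := by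
  have := hμ.isGaussian
  have h1 := ProbabilityTheory.IsGaussian.map_eq_gaussianReal (μ := μ) (innerSL ℝ h)
  have hi : Integrable (fun x : H => x) μ := (hμ.memLp 1 (by simp)).integrable le_rfl
  have hmean : ∫ x, innerSL ℝ h x ∂μ = 0 := by
    rw [ContinuousLinearMap.integral_comp_comm _ hi, hμ.mean_zero, map_zero]
  have hvar : ProbabilityTheory.variance (innerSL ℝ h) μ = ⟪S h, h⟫ := by
    rw [← hμ.covariance h h, ProbabilityTheory.covarianceBilin_self (hμ.memLp 2 (by simp))]
    rfl
  have hpos : 0 ≤ ⟪S h, h⟫ := by rw [← hvar]; exact ProbabilityTheory.variance_nonneg _ _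
  have h2 : ProbabilityTheory.gaussianReal 0 (⟪S h, h⟫).toNNReal =
      (ProbabilityTheory.gaussianReal 0 1).map (√⟪S h, h⟫ * ·) := by
    rw [ProbabilityTheory.gaussianReal_map_const_mul]
    congr 1
    · simp
    · ext
      simp [Real.sq_sqrt hpos, hpos]
  rw [hmean, hvar, h2] at h1
  have e1 : eLpNorm (fun x => ⟪x, h⟫) r μ = eLpNorm id r (μ.map (innerSL ℝ h)) := by
    rw [eLpNorm_map_measure aestronglyMeasurable_id (innerSL ℝ h).continuous.aemeasurable]
    congr 1; ext x; exact real_inner_comm _ _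
  rw [e1, h1, eLpNorm_map_measure aestronglyMeasurable_id (by fun_prop)]
  have e2 : (id ∘ fun t : ℝ => √⟪S h, h⟫ * t) = √⟪S h, h⟫ • (id : ℝ → ℝ) := by
    ext t; simp
  rw [e2, eLpNorm_const_smul, gaussMoment, Real.enorm_eq_ofReal (Real.sqrt_nonneg _)]

end

section
variable {Ω₁ Ω₂ : Type*} [MeasurableSpace Ω₁] [MeasurableSpace Ω₂] {μ : Measure Ω₁} {ν : Measure Ω₂}

theorem eLpNorm_prod_le [SFinite μ] [IsProbabilityMeasure ν] {f : Ω₁ × Ω₂ → ℝ}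
    (hf : AEStronglyMeasurable f (μ.prod ν)) {r : ℝ≥0∞} (hr0 : r ≠ 0) (hr : r ≠ ⊤) {C : ℝ≥0∞}
    (h : ∀ y, eLpNorm (fun x => f (x, y)) r μ ≤ C) : eLpNorm f r (μ.prod ν) ≤ C := by
  have hr' : 0 < r.toReal := ENNReal.toReal_pos hr0 hr
  rw [eLpNorm_eq_lintegral_rpow_enorm_toReal hr0 hr, lintegral_prod_symm _ (hf.enorm.pow_const _),
    one_div, ENNReal.rpow_inv_le_iff hr']
  calc _ ≤ ∫⁻ _ : Ω₂, C ^ r.toReal ∂ν := by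
        refine lintegral_mono fun y => ?_
        have := h y
        rwa [eLpNorm_eq_lintegral_rpow_enorm_toReal hr0 hr, one_div, ENNReal.rpow_inv_le_iff hr']
          at this
    _ = C ^ r.toReal := by simp

theorem ae_memLp_slice [SFinite μ] [SFinite ν] {f : Ω₁ × Ω₂ → ℝ} (hf : StronglyMeasurable f)
    {r : ℝ≥0∞} (hr0 : r ≠ 0) (hr : r ≠ ⊤) (h : eLpNorm f r (μ.prod ν) < ⊤) :
    ∀ᵐ x ∂μ, MemLp (fun y => f (x, y)) r ν := by
  have h1 := lintegral_rpow_enorm_lt_top_of_eLpNorm_lt_top hr0 hr h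
  have hm : Measurable fun z => ‖f z‖ₑ ^ r.toReal := hf.enorm.pow_const _
  rw [lintegral_prod _ hm.aemeasurable] at h1
  filter_upwards [ae_lt_top hm.lintegral_prod_right' h1.ne] with x hx
  refine ⟨(hf.comp_measurable measurable_prodMk_left).aestronglyMeasurable, ?_⟩
  rw [eLpNorm_eq_lintegral_rpow_enorm_toReal hr0 hr]
  exact ENNReal.rpow_lt_top_of_nonneg (by positivity) hx.ne

/-- Along a subsequence, convergence in `L²` of a product implies convergence of the slices. -/
theorem exists_seq_tendsto_slice [SFinite μ] [SFinite ν] {f : ℕ → Ω₁ × Ω₂ → ℝ}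
    (hf : ∀ n, StronglyMeasurable (f n))
    (h : Tendsto (fun n => eLpNorm (f n) 2 (μ.prod ν)) atTop (𝓝 0)) :
    ∃ ns : ℕ → ℕ, StrictMono ns ∧
      ∀ᵐ x ∂μ, Tendsto (fun j => eLpNorm (fun y => f (ns j) (x, y)) 2 ν) atTop (𝓝 0) := by
  have hm : ∀ n, Measurable fun z => ‖f n z‖ₑ ^ (2 : ℝ) := fun n => (hf n).enorm.pow_const _
  have h1 : Tendsto (fun n => ∫⁻ x, ∫⁻ y, ‖f n (x, y)‖ₑ ^ (2 : ℝ) ∂ν ∂μ) atTop (𝓝 0) := by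
    have h2 : ∀ n, ∫⁻ x, ∫⁻ y, ‖f n (x, y)‖ₑ ^ (2 : ℝ) ∂ν ∂μ =
        eLpNorm (f n) 2 (μ.prod ν) ^ (2 : ℝ) := by
      intro n
      rw [eLpNorm_eq_lintegral_rpow_enorm_toReal (by simp) (by simp),
        lintegral_prod _ (by simpa using (hm n).aemeasurable), ← ENNReal.rpow_mul]
      simp
    simp_rw [h2]
    have := (ENNReal.continuous_rpow_const (y := (2 : ℝ))).continuousAt.tendsto.comp h
    simpa [Function.comp_def] using this
  have hpos : ∀ j : ℕ, (0 : ℝ≥0∞) < (1 / 2) ^ j := fun j => by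
    refine ENNReal.pow_pos (by simp) j
  -- Geometric decay makes the sum of the slice integrals integrable, hence finite almost
  -- everywhere, so its terms tend to 0.
  obtain ⟨ns, hns, hle⟩ := extraction_forall_of_eventually fun j =>
    eventually_atTop.1 (h1.eventually (ge_mem_nhds (hpos j))) |>.elim fun N hN =>
      eventually_atTop.2 ⟨N, fun n hn => hN n hn⟩
  refine ⟨ns, hns, ?_⟩
  have h3 : ∫⁻ x, ∑' j, ∫⁻ y, ‖f (ns j) (x, y)‖ₑ ^ (2 : ℝ) ∂ν ∂μ ≠ ⊤ := by
    rw [lintegral_tsum fun j => (hm _).lintegral_prod_right'.aemeasurable]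
    refine ((ENNReal.tsum_le_tsum hle).trans_lt ?_).ne
    rw [ENNReal.tsum_geometric]
    simp
  filter_upwards [ae_lt_top (Measurable.tsum fun j => (hm _).lintegral_prod_right') h3]
    with x hx
  have h4 := ENNReal.tendsto_atTop_zero_of_tsum_ne_top hx.ne
  have := (ENNReal.continuous_rpow_const (y := (1 / 2 : ℝ))).continuousAt.tendsto.comp h4
  simp_rw [eLpNorm_eq_lintegral_rpow_enorm_toReal (p := 2) (by simp) (by simp)]
  simpa [Function.comp_def] using this

end


/-! ### The Gaussian random field `x(ξ)` -/

/-- The function `√2 (k+1)π cos((k+1)πξ)` that represents `dualBasis k`. -/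
def etaFun (k : ℕ) (ξ : ℝ) : ℝ := freq k ^ 2 * cosFun k ξ

theorem continuous_etaFun (k : ℕ) : Continuous (etaFun k) := (continuous_cosFun k).const_mul _

/-- `etaFun` as an element of `L²(0,1)`. -/
def etaL2 (k : ℕ) : L2 := contL2 (continuous_etaFun k)

theorem etaL2_eq (k : ℕ) : etaL2 k = freq k ^ 2 • (cosBasis k).toL2 := by
  refine Lp.ext ?_
  have h : (cosBasis k).toL2 = contL2 (continuous_cosFun k) := rfl
  rw [h]
  filter_upwards [contL2_ae (continuous_etaFun k), contL2_ae (continuous_cosFun k),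
    Lp.coeFn_smul (freq k ^ 2) (contL2 (continuous_cosFun k))] with ξ h1 h2 h3
  rw [h3, Pi.smul_apply, h2, etaL2, h1]
  rfl

theorem inner_etaL2 (k : ℕ) (y : MeanZeroH1) : ⟪etaL2 k, y.toL2⟫ = dualBasis k y := by
  have h1 : embed (cosBasis k) y = (1 / freq k ^ 2) * dualBasis k y := by
    rw [embed_cosBasis]; rfl
  have hk := (freq_pos k).ne'
  rw [etaL2_eq, real_inner_smul_left, ← embed_apply, h1]
  field_simp

theorem inner_etaL2_one (k : ℕ) : ⟪etaL2 k, contL2 continuous_const (g := fun _ => (1 : ℝ))⟫ = 0 := by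
  rw [← L2.integral_mul]
  have : ∫ ξ, etaFun k ξ ∂leb = 0 := by
    unfold etaFun
    rw [integral_const_mul, integral_cosFun, mul_zero]
  rw [← this]
  refine integral_congr_ae ?_
  filter_upwards [contL2_ae (continuous_etaFun k),
    contL2_ae (continuous_const (y := (1 : ℝ)))] with ξ h1 h2
  rw [etaL2, h1, h2, mul_one]

theorem resolventL2_dualBasis {α : ℝ} (hα : 0 < α) (k : ℕ) :
    resolventL2 α (dualBasis k) = resolventEigenvalue α k • etaL2 k := by
  rw [resolventL2_apply, resolvent_dualBasis hα, map_smul, etaL2_eq, smul_smul]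

/-- The left side is the variance of the k-th term of the random series at the point ξ. Its bound is
summable and independent of ξ, which is what makes x a function with all moments. -/
theorem eigenvalue_mul_etaFun_sq_le (k : ℕ) (ξ : ℝ) :
    eigenvalue k * etaFun k ξ ^ 2 ≤ (freq k ^ 2)⁻¹ := by
  have hk := freq_pos k
  have h2 : √2 ^ 2 = (2 : ℝ) := Real.sq_sqrt (by norm_num)
  have : eigenvalue k * etaFun k ξ ^ 2 = Real.cos (freq k * ξ) ^ 2 * (freq k ^ 2)⁻¹ := by
    unfold eigenvalue etaFun cosFun
    field_simp
    rw [h2]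
  rw [this]
  exact mul_le_of_le_one_left (by positivity) (Real.cos_sq_le_one _)

/-- The partial sum `∑ₖ wₖ ⟪x, fₖ⟫ fₖ(ξ)` over `k ∈ s`. -/
def partialField (w : ℕ → ℝ) (s : Finset ℕ) (z : X × ℝ) : ℝ :=
  ∑ k ∈ s, w k * ⟪z.1, dualBasis k⟫ * etaFun k z.2

theorem stronglyMeasurable_partialField (w : ℕ → ℝ) (s : Finset ℕ) :
    StronglyMeasurable (partialField w s) := by
  refine Continuous.stronglyMeasurable ?_
  unfold partialField
  refine continuous_finsetSum _ fun k _ => ?_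
  have h1 : Continuous fun z : X × ℝ => ⟪z.1, dualBasis k⟫ := continuous_fst.inner continuous_const
  exact (h1.const_mul _).mul ((continuous_etaFun k).comp continuous_snd)

theorem partialField_sub (w w' : ℕ → ℝ) (s : Finset ℕ) (z : X × ℝ) :
    partialField (fun k => w k - w' k) s z = partialField w s z - partialField w' s z := by
  unfold partialField
  rw [← Finset.sum_sub_distrib]
  exact Finset.sum_congr rfl fun k _ => by ring

variable {μ : Measure X}

/-- For fixed ξ the partial sum is a linear functional of x, hence Gaussian with variance at most ∑
w_k² ω_k⁻². The bound is uniform in ξ and survives integration over (0,1). -/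
theorem eLpNorm_partialField_le (hμ : IsGaussianMeasure μ Q) (w : ℕ → ℝ) (s : Finset ℕ) {r : ℝ≥0∞}
    (hr0 : r ≠ 0) (hr : r ≠ ⊤) : eLpNorm (partialField w s) r (μ.prod leb) ≤
      ENNReal.ofReal √(∑ k ∈ s, w k ^ 2 * (freq k ^ 2)⁻¹) * gaussMoment r := by
  have := hμ.isProbabilityMeasure
  refine eLpNorm_prod_le (stronglyMeasurable_partialField w s).aestronglyMeasurable hr0 hr
    fun ξ => ?_
  have e : (fun x => partialField w s (x, ξ)) =
      fun x => ⟪x, ∑ k ∈ s, (w k * etaFun k ξ) • dualBasis k⟫ := by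
    ext x
    refine Eq.trans ?_ (inner_sum (𝕜 := ℝ) (E := X) s
      (fun k => (w k * etaFun k ξ) • dualBasis k) x).symm
    refine Finset.sum_congr rfl fun k _ => ?_
    refine Eq.trans ?_ (real_inner_smul_right (F := X) x (dualBasis k) (w k * etaFun k ξ)).symm
    ring
  rw [e, hμ.eLpNorm_inner]
  refine mul_le_mul_left ?_ _
  refine ENNReal.ofReal_le_ofReal (Real.sqrt_le_sqrt ?_)
  refine (inner_sum_eigenvectors (H := X) orthonormal_dualBasis Q_dualBasis s
    fun k => w k * etaFun k ξ).trans_le ?_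
  refine Finset.sum_le_sum fun k _ => ?_
  have := mul_le_mul_of_nonneg_left (eigenvalue_mul_etaFun_sq_le k ξ) (sq_nonneg (w k))
  nlinarith

theorem summable_inv_freq_sq : Summable fun k => (freq k ^ 2)⁻¹ := by
  have h1 : Summable fun k : ℕ => (((k + 1 : ℕ) : ℝ) ^ 2)⁻¹ :=
    (summable_nat_add_iff 1).2 (Real.summable_nat_pow_inv.2 one_lt_two)
  refine (h1.mul_right (Real.pi ^ 2)⁻¹).congr fun k => ?_
  unfold freq
  push_cast
  rw [mul_pow, mul_inv]

theorem summable_weight {w : ℕ → ℝ} {c : ℝ} (hw : ∀ k, |w k| ≤ c) :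
    Summable fun k => w k ^ 2 * (freq k ^ 2)⁻¹ := by
  refine Summable.of_nonneg_of_le (fun k => by positivity) (fun k => ?_)
    (summable_inv_freq_sq.mul_left (c ^ 2))
  have : w k ^ 2 ≤ c ^ 2 := by rw [← sq_abs]; exact pow_le_pow_left₀ (abs_nonneg _) (hw k) 2
  exact mul_le_mul_of_nonneg_right this (by positivity)

/-- `v(x, ξ)` is the sum of the series `∑ₖ wₖ ⟪x, fₖ⟫ fₖ(ξ)`. -/
structure IsField (μ : Measure X) (w : ℕ → ℝ) (v : X × ℝ → ℝ) : Prop where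
  stronglyMeasurable : StronglyMeasurable v
  tendsto : Tendsto (fun n => eLpNorm (fun z => partialField w (Finset.range n) z - v z) 2
    (μ.prod leb)) atTop (𝓝 0)

/-- The partial sums are Cauchy in L²(μ ⊗ dξ), because differences are partial sums over blocks and
are bounded by tails of the variance series. -/
theorem exists_isField (hμ : IsGaussianMeasure μ Q) {w : ℕ → ℝ} {c : ℝ} (hw : ∀ k, |w k| ≤ c) :
    ∃ v, IsField μ w v := by
  have := hμ.isProbabilityMeasure
  have hs := summable_weight hw
  set a := fun k => w k ^ 2 * (freq k ^ 2)⁻¹ with ha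
  have hmem : ∀ s, MemLp (partialField w s) 2 (μ.prod leb) := fun s =>
    ⟨(stronglyMeasurable_partialField w s).aestronglyMeasurable,
      (eLpNorm_partialField_le hμ w s (by simp) (by simp)).trans_lt
        (ENNReal.mul_lt_top ENNReal.ofReal_lt_top (gaussMoment_lt_top (by simp)))⟩
  have hcauchy : CauchySeq fun n => (hmem (Finset.range n)).toLp := by
    refine cauchySeq_of_le_tendsto_0' (fun m => √(∑' k, a (k + m)) * (gaussMoment 2).toReal)
      (fun m n hmn => ?_) ?_
    · rw [dist_comm, dist_eq_norm, ← MemLp.toLp_sub, Lp.norm_toLp]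
      have e : partialField w (Finset.range n) - partialField w (Finset.range m) =
          partialField w (Finset.Ico m n) := by
        ext z
        exact (Finset.sum_Ico_eq_sub _ hmn).symm
      rw [e]
      have h1 := eLpNorm_partialField_le hμ w (Finset.Ico m n) (r := 2) (by simp) (by simp)
      have h2 := ENNReal.toReal_mono
        (ENNReal.mul_lt_top ENNReal.ofReal_lt_top (gaussMoment_lt_top (by simp))).ne h1
      rw [ENNReal.toReal_mul, ENNReal.toReal_ofReal (Real.sqrt_nonneg _)] at h2
      refine h2.trans (mul_le_mul_of_nonneg_right (Real.sqrt_le_sqrt ?_) ENNReal.toReal_nonneg)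
      rw [Finset.sum_Ico_eq_sum_range]
      simp_rw [add_comm m]
      exact ((summable_nat_add_iff m).2 hs).sum_le_tsum _ fun k _ => by positivity
    · have := ((tendsto_sum_nat_add a).sqrt).mul_const (gaussMoment 2).toReal
      simpa using this
  obtain ⟨v, hv⟩ := cauchySeq_tendsto_of_complete hcauchy
  refine ⟨v, Lp.stronglyMeasurable v, ?_⟩
  rw [Lp.tendsto_Lp_iff_tendsto_eLpNorm'] at hv
  refine hv.congr fun n => eLpNorm_congr_ae ?_
  filter_upwards [(hmem (Finset.range n)).coeFn_toLp] with z hz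
  rw [Pi.sub_apply, hz]

theorem IsField.sub [SFinite μ] {w w' : ℕ → ℝ} {v v' : X × ℝ → ℝ} (h : IsField μ w v)
    (h' : IsField μ w' v') : IsField μ (fun k => w k - w' k) (fun z => v z - v' z) := by
  refine ⟨h.1.sub h'.1, ?_⟩
  have hm := fun w n => (stronglyMeasurable_partialField w (Finset.range n)).aestronglyMeasurable
    (μ := μ.prod leb)
  refine tendsto_of_tendsto_of_tendsto_of_le_of_le tendsto_const_nhds
    (by simpa using h.2.add h'.2) (fun _ => zero_le) fun n => ?_
  refine le_trans (le_of_eq ?_) (eLpNorm_sub_le ((hm w n).sub h.1.aestronglyMeasurable)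
    ((hm w' n).sub h'.1.aestronglyMeasurable) one_le_two)
  congr 1
  ext z
  simp only [Pi.sub_apply, partialField_sub]
  ring

/-- L² convergence implies convergence in measure, under which uniform L^r bounds pass to the limit
for every finite r, including r > 2. -/
theorem IsField.eLpNorm_le (hμ : IsGaussianMeasure μ Q) {w : ℕ → ℝ} {c : ℝ} (hw : ∀ k, |w k| ≤ c)
    {v : X × ℝ → ℝ} (h : IsField μ w v) {r : ℝ≥0∞} (hr0 : r ≠ 0) (hr : r ≠ ⊤) :
    eLpNorm v r (μ.prod leb) ≤
      ENNReal.ofReal √(∑' k, w k ^ 2 * (freq k ^ 2)⁻¹) * gaussMoment r := by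
  have hm := fun n => (stronglyMeasurable_partialField w (Finset.range n)).aestronglyMeasurable
    (μ := μ.prod leb)
  refine eLpNorm_le_of_tendstoInMeasure (Eventually.of_forall fun n => ?_)
    (tendstoInMeasure_of_tendsto_eLpNorm (p := 2) (by simp) hm h.1.aestronglyMeasurable h.2) hm
  refine (eLpNorm_partialField_le hμ w _ hr0 hr).trans (mul_le_mul_left ?_ _)
  refine ENNReal.ofReal_le_ofReal (Real.sqrt_le_sqrt ?_)
  exact (summable_weight hw).sum_le_tsum _ fun k _ => by positivity

/-- The partial sums as elements of `L²(0,1)`. -/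
def partialL2 (w : ℕ → ℝ) (n : ℕ) (x : X) : L2 :=
  ∑ k ∈ Finset.range n, (w k * ⟪x, dualBasis k⟫) • etaL2 k

theorem coeFn_partialL2 (w : ℕ → ℝ) (n : ℕ) (x : X) :
    partialL2 w n x =ᵐ[leb] fun ξ => partialField w (Finset.range n) (x, ξ) := by
  unfold partialL2 partialField
  have h1 := Lp.coeFn_finsetSum (Finset.range n) fun k => (w k * ⟪x, dualBasis k⟫) • etaL2 k
  have h2 : ∀ᵐ ξ ∂leb, ∀ k, ((w k * ⟪x, dualBasis k⟫) • etaL2 k : L2) ξ =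
      w k * ⟪x, dualBasis k⟫ * etaFun k ξ := by
    rw [ae_all_iff]
    intro k
    filter_upwards [Lp.coeFn_smul (w k * ⟪x, dualBasis k⟫) (etaL2 k),
      contL2_ae (continuous_etaFun k)] with ξ h3 h4
    rw [h3, Pi.smul_apply, etaL2, h4, smul_eq_mul]
  filter_upwards [h1, h2] with ξ h3 h4
  rw [h3, Finset.sum_apply]
  exact Finset.sum_congr rfl fun k _ => h4 k

/-- Bridge from the field on the product space to individual x: along one subsequence, almost every
slice of the partial sums converges in L²(0,1). -/
theorem IsField.exists_seq [SFinite μ] {w : ℕ → ℝ} {v : X × ℝ → ℝ} (h : IsField μ w v) :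
    ∃ ns : ℕ → ℕ, StrictMono ns ∧ ∀ᵐ x ∂μ, ∃ g : L2, g =ᵐ[leb] (fun ξ => v (x, ξ)) ∧
      Tendsto (fun j => partialL2 w (ns j) x) atTop (𝓝 g) := by
  obtain ⟨ns, hns, h1⟩ := exists_seq_tendsto_slice
    (fun n => (stronglyMeasurable_partialField w (Finset.range n)).sub h.1) h.2
  refine ⟨ns, hns, ?_⟩
  filter_upwards [h1] with x hx
  have hmv : AEStronglyMeasurable (fun ξ => v (x, ξ)) leb :=
    (h.1.comp_measurable measurable_prodMk_left).aestronglyMeasurable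
  have hp : ∀ n, MemLp (fun ξ => partialField w (Finset.range n) (x, ξ)) 2 leb := fun n =>
    (memLp_congr_ae (coeFn_partialL2 w n x)).1 (Lp.memLp _)
  have hv : MemLp (fun ξ => v (x, ξ)) 2 leb := by
    obtain ⟨j, hj⟩ := (hx.eventually (gt_mem_nhds ENNReal.zero_lt_top)).exists
    have h2 : MemLp (fun ξ => (partialField w (Finset.range (ns j)) - v) (x, ξ)) 2 leb :=
      ⟨((hp _).1.sub hmv), hj⟩
    refine ((hp (ns j)).sub h2).ae_eq (Eventually.of_forall fun ξ => ?_)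
    simp
  refine ⟨hv.toLp, hv.coeFn_toLp, ?_⟩
  rw [Lp.tendsto_Lp_iff_tendsto_eLpNorm']
  refine hx.congr fun j => eLpNorm_congr_ae ?_
  filter_upwards [coeFn_partialL2 w (ns j) x, hv.coeFn_toLp] with ξ h2 h3
  simp only [Pi.sub_apply, h2, h3]

theorem tendsto_partial_sum (x : X) : Tendsto (fun n => ∑ k ∈ Finset.range n,
    ⟪x, dualBasis k⟫ • dualBasis k) atTop (𝓝 x) := by
  have h := tendsto_diagTrunc dualHilbertBasis (c := fun _ _ => 1) (by simp)
    (fun _ => tendsto_const_nhds) x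
  refine h.congr fun n => ?_
  rw [diagTrunc_apply, coe_dualHilbertBasis]
  refine Finset.sum_congr rfl fun k _ => ?_
  rw [one_mul, real_inner_comm]

theorem resolventL2_partial_sum {α : ℝ} (hα : 0 < α) (n : ℕ) (x : X) :
    resolventL2 α (∑ k ∈ Finset.range n, ⟪x, dualBasis k⟫ • dualBasis k) =
      partialL2 (resolventEigenvalue α) n x := by
  rw [map_sum, partialL2]
  refine Finset.sum_congr rfl fun k _ => ?_
  rw [map_smul, resolventL2_dualBasis hα, smul_smul, mul_comm]

/-- The same partial sums have two limits in L²: `resolventL2 α x` by continuity of the resolvent on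
X, and the slice of the field. -/
theorem IsField.ae_eq_resolvent [SFinite μ] {α : ℝ} (hα : 0 < α) {v : X × ℝ → ℝ}
    (h : IsField μ (resolventEigenvalue α) v) :
    ∀ᵐ x ∂μ, resolventL2 α x =ᵐ[leb] fun ξ => v (x, ξ) := by
  obtain ⟨ns, hns, h1⟩ := h.exists_seq
  filter_upwards [h1] with x ⟨g, hg, hlim⟩
  have h2 : Tendsto (fun j => partialL2 (resolventEigenvalue α) (ns j) x) atTop
      (𝓝 (resolventL2 α x)) := by
    simp_rw [← resolventL2_partial_sum hα]
    exact ((resolventL2 α).continuous.tendsto x).comp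
      ((tendsto_partial_sum x).comp hns.tendsto_atTop)
  rw [tendsto_nhds_unique h2 hlim]
  exact hg

theorem inner_partialL2_one (n : ℕ) (x : X) (y : MeanZeroH1) :
    ⟪partialL2 (fun _ => 1) n x, y.toL2⟫ =
      (∑ k ∈ Finset.range n, ⟪x, dualBasis k⟫ • dualBasis k) y := by
  rw [partialL2, sum_inner, sum_apply]
  refine Finset.sum_congr rfl fun k _ => ?_
  rw [real_inner_smul_left, inner_etaL2, one_mul]
  rfl

/-- Zero mean and the pairing with each y pass to the L² limit of the partial sums; L^p
integrability of the slices follows from the moment bound and Fubini's theorem. -/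
theorem IsField.ae_isAdmissible (hμ : IsGaussianMeasure μ Q) {v : X × ℝ → ℝ}
    (h : IsField μ (fun _ => 1) v) {p : ℝ} (hp : 0 < p) :
    ∀ᵐ x ∂μ, IsAdmissible p (fun ξ => v (x, ξ)) x := by
  have := hμ.isProbabilityMeasure
  obtain ⟨ns, hns, h1⟩ := h.exists_seq
  have hp0 : ENNReal.ofReal p ≠ 0 := by simpa using hp
  have h2 := ae_memLp_slice (μ := μ) (ν := leb) h.1 hp0 ENNReal.ofReal_ne_top
    ((h.eLpNorm_le hμ (c := 1) (by simp) hp0 ENNReal.ofReal_ne_top).trans_lt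
        (ENNReal.mul_lt_top ENNReal.ofReal_lt_top (gaussMoment_lt_top (by simp))))
  filter_upwards [h1, h2] with x ⟨g, hg, hlim⟩ hm
  refine ⟨hm, ?_, fun y => ?_⟩
  · have h3 : ⟪g, contL2 continuous_const (g := fun _ => (1 : ℝ))⟫ = 0 := by
      refine tendsto_nhds_unique (hlim.inner tendsto_const_nhds) ?_
      refine tendsto_const_nhds.congr fun j => ?_
      rw [partialL2, sum_inner]
      refine (Finset.sum_eq_zero fun k _ => ?_).symm
      rw [real_inner_smul_left, inner_etaL2_one, mul_zero]
    rw [← L2.integral_mul] at h3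
    rw [← h3]
    refine integral_congr_ae ?_
    filter_upwards [hg, contL2_ae (continuous_const (y := (1 : ℝ)))] with ξ h4 h5
    rw [h4, h5, mul_one]
  · have h3 : ⟪g, y.toL2⟫ = x y := by
      refine tendsto_nhds_unique (hlim.inner tendsto_const_nhds) ?_
      simp_rw [inner_partialL2_one]
      have h4 : Continuous fun z : X => z y := by fun_prop
      exact (h4.tendsto x).comp ((tendsto_partial_sum x).comp hns.tendsto_atTop)
    rw [← h3, ← L2.integral_mul]
    refine integral_congr_ae ?_
    filter_upwards [hg] with ξ h4
    rw [h4]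


/-! ### The inequality `U_α ≤ U` -/

theorem integral_leb_eq (f : ℝ → ℝ) : ∫ ξ, f ξ ∂leb = ∫ ξ in (0 : ℝ)..1, f ξ := by
  rw [intervalIntegral.integral_of_le zero_le_one, integral_Ioc_eq_integral_Ioo]

theorem hasDerivAt_etaFun (k : ℕ) (ξ : ℝ) :
    HasDerivAt (etaFun k) (freq k ^ 2 * sinFun k ξ) ξ :=
  (hasDerivAt_cosFun k ξ).const_mul _

theorem hasDerivAt_sinFun (k : ℕ) (ξ : ℝ) : HasDerivAt (sinFun k) (-etaFun k ξ) ξ := by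
  have h := (((Real.hasDerivAt_sin (freq k * ξ)).comp ξ
    ((hasDerivAt_id ξ).const_mul (freq k))).const_mul √2).neg
  refine h.congr_deriv ?_
  unfold etaFun cosFun
  have := (freq_pos k).ne'
  field_simp

theorem sinFun_zero (k : ℕ) : sinFun k 0 = 0 := by simp [sinFun]

theorem sinFun_one (k : ℕ) : sinFun k 1 = 0 := by
  have := Real.sin_nat_mul_pi (k + 1)
  push_cast at this
  simp [sinFun, freq, this]

/-- Monotonicity of `-u''` with Neumann boundary conditions: `∫ ψ(u)(-u'') = ∫ ψ'(u) u'² ≥ 0`. -/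
theorem integral_comp_mul_nonneg {ψ ψ' : ℝ → ℝ} (hc : Continuous ψ') (h0 : ∀ r, 0 ≤ ψ' r)
    (hψ : ∀ r, HasDerivAt ψ (ψ' r) r) (s : Finset ℕ) (c : ℕ → ℝ) :
    0 ≤ ∫ ξ, ψ (∑ k ∈ s, c k * etaFun k ξ) * (∑ k ∈ s, c k * (freq k ^ 2 * etaFun k ξ)) ∂leb := by
  set u : ℝ → ℝ := fun ξ => ∑ k ∈ s, c k * etaFun k ξ with hu
  set u' : ℝ → ℝ := fun ξ => ∑ k ∈ s, c k * (freq k ^ 2 * sinFun k ξ) with hu'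
  set f : ℝ → ℝ := fun ξ => ∑ k ∈ s, c k * (freq k ^ 2 * etaFun k ξ) with hf
  have hdu : ∀ ξ, HasDerivAt u (u' ξ) ξ := fun ξ =>
    HasDerivAt.fun_sum fun k _ => (hasDerivAt_etaFun k ξ).const_mul (c k)
  have hdu' : ∀ ξ, HasDerivAt u' (-f ξ) ξ := fun ξ => by
    have : HasDerivAt u' (∑ k ∈ s, c k * (freq k ^ 2 * -etaFun k ξ)) ξ :=
      HasDerivAt.fun_sum fun k _ => ((hasDerivAt_sinFun k ξ).const_mul (freq k ^ 2)).const_mul (c k)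
    refine this.congr_deriv ?_
    rw [hf, ← Finset.sum_neg_distrib]
    exact Finset.sum_congr rfl fun k _ => by ring
  have hcf : Continuous f := continuous_finsetSum _ fun k _ =>
    ((continuous_etaFun k).const_mul _).const_mul _
  have hcu' : Continuous u' := continuous_finsetSum _ fun k _ =>
    ((continuous_sinFun k).const_mul _).const_mul _
  have hcu : Continuous u := continuous_iff_continuousAt.2 fun ξ => (hdu ξ).continuousAt
  have hb0 : u' 0 = 0 := Finset.sum_eq_zero fun k _ => by simp [sinFun_zero]
  have hb1 : u' 1 = 0 := Finset.sum_eq_zero fun k _ => by simp [sinFun_one]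
  have hparts := intervalIntegral.integral_mul_deriv_eq_deriv_mul (a := 0) (b := 1)
    (u := fun ξ => ψ (u ξ)) (v := u') (u' := fun ξ => ψ' (u ξ) * u' ξ) (v' := fun ξ => -f ξ)
    (fun ξ _ => (hψ _).comp ξ (hdu ξ)) (fun ξ _ => hdu' ξ)
    (((hc.comp hcu).mul hcu').intervalIntegrable _ _) (hcf.neg.intervalIntegrable _ _)
  rw [hb0, hb1, mul_zero, mul_zero, sub_zero, zero_sub] at hparts
  have h1 : ∫ ξ in (0 : ℝ)..1, ψ (u ξ) * f ξ = ∫ ξ in (0 : ℝ)..1, ψ' (u ξ) * u' ξ * u' ξ := by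
    have : ∀ ξ, ψ (u ξ) * -f ξ = -(ψ (u ξ) * f ξ) := fun ξ => by ring
    simp_rw [this] at hparts
    rw [intervalIntegral.integral_neg] at hparts
    linarith
  rw [integral_leb_eq, h1]
  refine intervalIntegral.integral_nonneg zero_le_one fun ξ _ => ?_
  rw [mul_assoc]
  exact mul_nonneg (h0 _) (mul_self_nonneg _)

section
variable {Φ : ℝ → ℝ} (hΦ : ContDiff ℝ 2 Φ) (hconv : ConvexOn ℝ univ Φ) {α : ℝ} (hα : 0 < α)
include hΦ hconv hα

/-- The subgradient inequality at the smoothed sum leaves ∫ ψ_α(u)(x - u) ≥ 0 to be shown. Since 1 -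
(1 + αω²)⁻¹ = αω²(1 + αω²)⁻¹, the difference x - u is α times -u'', and `integral_comp_mul_nonneg`
applies. -/
theorem integral_moreauYosida_partialL2_le (n : ℕ) (x : X) :
    ∫ ξ, moreauYosida Φ α (partialL2 (resolventEigenvalue α) n x ξ) ∂leb ≤
      ∫ ξ, moreauYosida Φ α (partialL2 (fun _ => 1) n x ξ) ∂leb := by
  have h := isLipschitzSubgradient_moreauYosida hΦ hconv hα
  refine le_trans (le_add_of_nonneg_right ?_) (h.integral_bounds _ _).1
  rw [h.inner_superposition]
  obtain ⟨ψ', hc, h0, hψ⟩ := exists_hasDerivAt_yosida hΦ hconv hα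
  set c : ℕ → ℝ := fun k => resolventEigenvalue α k * ⟪x, dualBasis k⟫ with hc_def
  have hpos := integral_comp_mul_nonneg hc h0 hψ (Finset.range n) c
  have e : ∫ ξ, yosida Φ α (partialL2 (resolventEigenvalue α) n x ξ) *
      (partialL2 (fun _ => 1) n x - partialL2 (resolventEigenvalue α) n x : L2) ξ ∂leb =
      α * ∫ ξ, yosida Φ α (∑ k ∈ Finset.range n, c k * etaFun k ξ) *
        (∑ k ∈ Finset.range n, c k * (freq k ^ 2 * etaFun k ξ)) ∂leb := by
    rw [← integral_const_mul]
    refine integral_congr_ae ?_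
    filter_upwards [coeFn_partialL2 (resolventEigenvalue α) n x, coeFn_partialL2 (fun _ => 1) n x,
      Lp.coeFn_sub (partialL2 (fun _ => 1) n x) (partialL2 (resolventEigenvalue α) n x)]
      with ξ h1 h2 h3
    rw [h3, Pi.sub_apply, h1, h2]
    have e1 : partialField (fun _ => 1) (Finset.range n) (x, ξ) -
        partialField (resolventEigenvalue α) (Finset.range n) (x, ξ) =
        α * ∑ k ∈ Finset.range n, c k * (freq k ^ 2 * etaFun k ξ) := by
      rw [← partialField_sub, partialField, Finset.mul_sum]
      refine Finset.sum_congr rfl fun k _ => ?_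
      have h4 : 1 - resolventEigenvalue α k = α * freq k ^ 2 * resolventEigenvalue α k := by
        have h5 : 1 + α * freq k ^ 2 ≠ 0 := by positivity
        rw [resolventEigenvalue]
        field_simp
        ring
      rw [hc_def, h4]
      ring
    rw [e1]
    simp only [partialField, hc_def]
    ring
  rw [e]
  exact mul_nonneg hα.le hpos

/-- Both sides of the inequality for cosine sums are continuous on L², so it passes to the limit
along a convergent subsequence. -/
theorem ae_UApprox_le {μ : Measure X} [SFinite μ] {v : X × ℝ → ℝ} (h : IsField μ (fun _ => 1) v) :
    ∀ᵐ x ∂μ, MemLp (fun ξ => v (x, ξ)) 2 leb ∧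
      UApprox Φ α x ≤ ∫ ξ, moreauYosida Φ α (v (x, ξ)) ∂leb := by
  have hs := isLipschitzSubgradient_moreauYosida hΦ hconv hα
  obtain ⟨ns, hns, h1⟩ := h.exists_seq
  filter_upwards [h1] with x ⟨g, hg, hlim⟩
  refine ⟨(memLp_congr_ae hg).1 (Lp.memLp g), ?_⟩
  have h2 : Tendsto (fun j => partialL2 (resolventEigenvalue α) (ns j) x) atTop
      (𝓝 (resolventL2 α x)) := by
    simp_rw [← resolventL2_partial_sum hα]
    exact ((resolventL2 α).continuous.tendsto x).comp
      ((tendsto_partial_sum x).comp hns.tendsto_atTop)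
  have h3 := le_of_tendsto_of_tendsto' ((hs.continuous_integral.tendsto _).comp h2)
    ((hs.continuous_integral.tendsto _).comp hlim)
    fun j => integral_moreauYosida_partialL2_le hΦ hconv hα (ns j) x
  refine h3.trans (le_of_eq (integral_congr_ae ?_))
  filter_upwards [hg] with ξ hξ
  rw [hξ]

theorem le_UApprox {c : ℝ} (hc : ∀ t, c ≤ Φ t) (x : X) : c ≤ UApprox Φ α x := by
  have h1 : ∫ _ : ℝ, c ∂leb = c := by simp
  rw [← h1]
  exact integral_mono (integrable_const _)
    ((isLipschitzSubgradient_moreauYosida hΦ hconv hα).integrable_comp (Lp.memLp (resolventL2 α x)))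
    fun ξ => le_moreauYosida hc hα _

theorem ae_UApprox_le_U {C p : ℝ} (hp : 2 ≤ p) (hC : ∀ t, |Φ t| ≤ C * (1 + |t| ^ p))
    {μ : Measure X} (hμ : IsGaussianMeasure μ Q) :
    ∀ᵐ x ∂μ, (UApprox Φ α x : EReal) ≤ U Φ p x := by
  have := hμ.isProbabilityMeasure
  obtain ⟨v, hv⟩ := exists_isField hμ (w := fun _ => 1) (c := 1) (by simp)
  filter_upwards [ae_UApprox_le hΦ hconv hα hv, hv.ae_isAdmissible hμ (p := p) (by linarith)]
    with x ⟨hm, hx⟩ hadm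
  rw [U_eq (by linarith) hadm, EReal.coe_le_coe_iff]
  refine hx.trans (integral_mono
    ((isLipschitzSubgradient_moreauYosida hΦ hconv hα).integrable_comp hm)
    (integrable_comp_of_growth hΦ.continuous (by linarith) hC hadm.1)
    fun ξ => moreauYosida_le hΦ hconv hα _)

end

/-! ### Estimates of slices -/

section
variable {Ω₁ Ω₂ E : Type*} [MeasurableSpace Ω₁] [MeasurableSpace Ω₂] [NormedAddCommGroup E]
  {μ : Measure Ω₁} {ν : Measure Ω₂}

/-- On a probability space the L² norm of a slice is at most its L^q norm, as q ≥ 2, and Fubini's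
theorem finishes. Estimates on X thereby reduce to estimates of fields on X × (0,1). -/
theorem eLpNorm_le_prod [SFinite μ] [IsProbabilityMeasure ν] {f : Ω₁ × Ω₂ → ℝ}
    (hf : StronglyMeasurable f) {g : Ω₁ → E} {q : ℝ≥0∞} (hq2 : 2 ≤ q) (hq : q ≠ ⊤)
    (h : ∀ᵐ x ∂μ, ‖g x‖ₑ ≤ eLpNorm (fun y => f (x, y)) 2 ν) :
    eLpNorm g q μ ≤ eLpNorm f q (μ.prod ν) := by
  have hq0 : q ≠ 0 := (two_pos.trans_le hq2).ne'
  have hq' : 0 < q.toReal := ENNReal.toReal_pos hq0 hq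
  rw [eLpNorm_eq_lintegral_rpow_enorm_toReal hq0 hq, eLpNorm_eq_lintegral_rpow_enorm_toReal hq0 hq,
    lintegral_prod _ (hf.enorm.pow_const _).aemeasurable]
  refine ENNReal.rpow_le_rpow (lintegral_mono_ae ?_) (by positivity)
  filter_upwards [h] with x hx
  have h1 := hx.trans (eLpNorm_le_eLpNorm_of_exponent_le hq2
    (hf.comp_measurable measurable_prodMk_left).aestronglyMeasurable)
  rwa [eLpNorm_eq_lintegral_rpow_enorm_toReal hq0 hq, one_div, ENNReal.le_rpow_inv_iff hq'] at h1

theorem enorm_integral_sub_le [IsProbabilityMeasure ν] {f g e : Ω₂ → ℝ} (hf : Integrable f ν)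
    (hg : Integrable g ν) (he : AEStronglyMeasurable e ν) (h : ∀ᵐ y ∂ν, |f y - g y| ≤ e y) :
    ‖∫ y, f y ∂ν - ∫ y, g y ∂ν‖ₑ ≤ eLpNorm e 2 ν := by
  rw [← integral_sub hf hg]
  refine (enorm_integral_le_lintegral_enorm _).trans ?_
  rw [← eLpNorm_one_eq_lintegral_enorm]
  refine (eLpNorm_mono_ae (g := e) ?_).trans (eLpNorm_le_eLpNorm_of_exponent_le one_le_two he)
  filter_upwards [h] with y hy
  exact hy.trans (le_abs_self _)

/-- Pointwise limit of the finite sums of the basis expansion, each measurable by hypothesis. -/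
theorem aestronglyMeasurable_of_inner {H : Type*} [NormedAddCommGroup H] [InnerProductSpace ℝ H]
    (b : HilbertBasis ℕ ℝ H) {F : Ω₁ → H}
    (h : ∀ k, AEStronglyMeasurable (fun x => ⟪F x, b k⟫) μ) : AEStronglyMeasurable F μ := by
  refine aestronglyMeasurable_of_tendsto_ae atTop
    (f := fun n x => ∑ k ∈ Finset.range n, ⟪F x, b k⟫ • b k)
    (fun n => Finset.aestronglyMeasurable_fun_sum _ fun k _ => (h k).smul_const _)
    (Eventually.of_forall fun x => ?_)
  refine (tendsto_diagTrunc b (c := fun _ _ => 1) (by simp) (fun _ => tendsto_const_nhds)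
    (F x)).congr fun n => ?_
  rw [diagTrunc_apply]
  refine Finset.sum_congr rfl fun k _ => ?_
  rw [one_mul, real_inner_comm]

/-- Hölder's inequality with the exponents 2q and 2q; the L^{2q} norm of an N-th power is the N-th
power of an L^{2qN} norm. -/
theorem eLpNorm_mul_pow_le {f g : Ω₁ → ℝ} (hf : AEStronglyMeasurable f μ)
    (hg : AEStronglyMeasurable g μ) (q : ℝ≥0∞) {N : ℕ} (hN : 0 < N) :
    eLpNorm (fun x => f x * g x ^ N) q μ ≤
      eLpNorm f (q * 2) μ * eLpNorm g (q * 2 * N) μ ^ N := by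
  have : ENNReal.HolderTriple (q * 2) (q * 2) q := ⟨by
    rw [ENNReal.mul_inv (by simp) (by simp), ← mul_add, ENNReal.inv_two_add_inv_two, mul_one]⟩
  have h1 := eLpNorm_smul_le_mul_eLpNorm (p := q * 2) (q := q * 2) (r := q) (hg.pow N) hf
  refine h1.trans (mul_le_mul_right ?_ _)
  have h2 := eLpNorm_norm_rpow (μ := μ) (p := q * 2) g (q := (N : ℝ)) (by exact_mod_cast hN)
  have h3 : eLpNorm (fun x => g x ^ N) (q * 2) μ = eLpNorm (fun x => ‖g x‖ ^ (N : ℝ)) (q * 2) μ := by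
    refine eLpNorm_congr_norm_ae (Eventually.of_forall fun x => ?_)
    rw [Real.rpow_natCast, norm_pow, norm_pow, norm_norm]
  refine le_of_eq ?_
  change eLpNorm (fun x => g x ^ N) (q * 2) μ = _
  rw [h3, h2, ENNReal.rpow_natCast]
  simp

end


/-! ### Convergence of the approximations -/

/-- The variance of the error `x(ξ) - ((I + αB)⁻¹x)(ξ)`, up to a constant. -/
def errorVariance (α : ℝ) : ℝ := ∑' k, (resolventEigenvalue α k - 1) ^ 2 * (freq k ^ 2)⁻¹

/-- Dominated convergence for series: each term tends to 0 and is at most ω_k⁻², since the resolvent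
eigenvalues lie in [0,1]. -/
theorem tendsto_sqrt_errorVariance :
    Tendsto (fun α => √(errorVariance α)) (𝓝[>] 0) (𝓝 0) := by
  have h : Tendsto errorVariance (𝓝[>] 0) (𝓝 (∑' _ : ℕ, (0 : ℝ))) := by
    refine tendsto_tsum_of_dominated_convergence (bound := fun k => (freq k ^ 2)⁻¹)
      summable_inv_freq_sq (fun k => ?_) ?_
    · have h1 : ContinuousAt (fun α : ℝ => (resolventEigenvalue α k - 1) ^ 2 * (freq k ^ 2)⁻¹) 0 := by
        unfold resolventEigenvalue
        refine ContinuousAt.mul (ContinuousAt.pow (ContinuousAt.sub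
          (ContinuousAt.inv₀ (by fun_prop) (by simp)) continuousAt_const) 2) continuousAt_const
      have h2 := h1.tendsto
      simp only [resolventEigenvalue, zero_mul, add_zero, inv_one, sub_self, ne_eq,
        OfNat.ofNat_ne_zero, not_false_eq_true, zero_pow] at h2
      exact h2.mono_left nhdsWithin_le_nhds
    · filter_upwards [self_mem_nhdsWithin] with α hα k
      have hα' : 0 ≤ α := le_of_lt hα
      have h1 := resolventEigenvalue_nonneg hα' k
      have h2 := (le_abs_self _).trans (abs_resolventEigenvalue_le hα' k)
      rw [Real.norm_eq_abs, abs_of_nonneg (by positivity)]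
      exact mul_le_of_le_one_left (by positivity) (by nlinarith)
  have := h.sqrt
  simpa using this

/-- The function that controls the error of the approximation. -/
def errorFun (N : ℕ) (α : ℝ) (v v' : X × ℝ → ℝ) (z : X × ℝ) : ℝ :=
  (|v' z - v z| + √α) * (1 + |v' z| + |v z|) ^ N

section
variable {μ : Measure X} (hμ : IsGaussianMeasure μ Q)
include hμ

theorem IsField.eLpNorm_le_of_abs_le_one {w : ℕ → ℝ} (hw : ∀ k, |w k| ≤ 1)
    {v : X × ℝ → ℝ} (h : IsField μ w v) {r : ℝ≥0∞} (hr0 : r ≠ 0) (hr : r ≠ ⊤) :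
    eLpNorm v r (μ.prod leb) ≤ ENNReal.ofReal √(∑' k, (freq k ^ 2)⁻¹) * gaussMoment r := by
  refine (h.eLpNorm_le hμ hw hr0 hr).trans (mul_le_mul_left ?_ _)
  refine ENNReal.ofReal_le_ofReal (Real.sqrt_le_sqrt ?_)
  refine (summable_weight hw).tsum_le_tsum (fun k => ?_) summable_inv_freq_sq
  exact mul_le_of_le_one_left (by positivity) ((sq_le_one_iff_abs_le_one _).2 (hw k))

/-- Hölder's inequality separates a small factor, controlled by the variance of v' - v and by √α,
from a polynomial factor whose moments are bounded independently of α. -/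
theorem eLpNorm_errorFun_le {α : ℝ} (hα : 0 < α) {v v' : X × ℝ → ℝ}
    (hv : IsField μ (fun _ => 1) v) (hv' : IsField μ (resolventEigenvalue α) v') {N : ℕ}
    (hN : 0 < N) {q : ℝ≥0∞} (hq1 : 1 ≤ q) (hq : q ≠ ⊤) :
    eLpNorm (errorFun N α v v') q (μ.prod leb) ≤
      (ENNReal.ofReal √(errorVariance α) * gaussMoment (q * 2) + ENNReal.ofReal √α) *
      (1 + ENNReal.ofReal √(∑' k, (freq k ^ 2)⁻¹) * gaussMoment (q * 2 * N) +
        ENNReal.ofReal √(∑' k, (freq k ^ 2)⁻¹) * gaussMoment (q * 2 * N)) ^ N := by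
  have := hμ.isProbabilityMeasure
  have hr1 : 1 ≤ q * 2 := hq1.trans (le_mul_of_one_le_right zero_le one_le_two)
  have hN1 : (1 : ℝ≥0∞) ≤ N := by exact_mod_cast hN
  have hs1 : 1 ≤ q * 2 * N := hr1.trans (le_mul_of_one_le_right zero_le hN1)
  have hr : q * 2 ≠ ⊤ := ENNReal.mul_ne_top hq (by simp)
  have hs : q * 2 * N ≠ ⊤ := ENNReal.mul_ne_top hr (by simp)
  have hr0 : q * 2 ≠ 0 := (one_pos.trans_le hr1).ne'
  have hs0 : q * 2 * N ≠ 0 := (one_pos.trans_le hs1).ne'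
  have hm := hv.1.aestronglyMeasurable (μ := μ.prod leb)
  have hm' := hv'.1.aestronglyMeasurable (μ := μ.prod leb)
  have hconst : ∀ (c : ℝ) (s : ℝ≥0∞), s ≠ 0 → 0 ≤ c →
      eLpNorm (fun _ : X × ℝ => c) s (μ.prod leb) = ENNReal.ofReal c := by
    intro c s hs hc
    rw [eLpNorm_const c hs (IsProbabilityMeasure.ne_zero _)]
    simp [Real.enorm_eq_ofReal hc]
  have habs : ∀ (f : X × ℝ → ℝ) (s : ℝ≥0∞),
      eLpNorm (fun z => |f z|) s (μ.prod leb) = eLpNorm f s (μ.prod leb) := fun f s =>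
    eLpNorm_norm f
  refine (eLpNorm_mul_pow_le ((hm'.sub hm).norm.add aestronglyMeasurable_const)
    ((aestronglyMeasurable_const.add hm'.norm).add hm.norm) q hN).trans ?_
  refine mul_le_mul' ?_ (pow_le_pow_left' ?_ N)
  · refine (eLpNorm_add_le (hm'.sub hm).norm aestronglyMeasurable_const hr1).trans ?_
    refine add_le_add ?_ (hconst _ _ hr0 (Real.sqrt_nonneg _)).le
    refine (habs (fun z => v' z - v z) _).trans_le ?_
    refine (hv'.sub hv).eLpNorm_le hμ (c := 2) (fun k => ?_) hr0 hr
    have := abs_resolventEigenvalue_le hα.le k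
    refine (abs_sub _ _).trans ?_
    rw [abs_one]; linarith
  · refine (eLpNorm_add_le (aestronglyMeasurable_const.add hm'.norm) hm.norm hs1).trans ?_
    refine add_le_add ((eLpNorm_add_le aestronglyMeasurable_const hm'.norm hs1).trans
      (add_le_add ?_ ?_)) ?_
    · exact ((hconst 1 _ hs0 zero_le_one).trans (by simp)).le
    · exact (habs _ _).trans_le
        (hv'.eLpNorm_le_of_abs_le_one hμ (abs_resolventEigenvalue_le hα.le) hs0 hs)
    · exact (habs _ _).trans_le (hv.eLpNorm_le_of_abs_le_one hμ (by simp) hs0 hs)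

theorem eLpNorm_errorFun_lt_top {α : ℝ} (hα : 0 < α) {v v' : X × ℝ → ℝ}
    (hv : IsField μ (fun _ => 1) v) (hv' : IsField μ (resolventEigenvalue α) v') {N : ℕ}
    (hN : 0 < N) {q : ℝ≥0∞} (hq1 : 1 ≤ q) (hq : q ≠ ⊤) :
    eLpNorm (errorFun N α v v') q (μ.prod leb) < ⊤ := by
  have h1 : gaussMoment (q * 2) < ⊤ := gaussMoment_lt_top (ENNReal.mul_ne_top hq (by simp))
  have h2 : gaussMoment (q * 2 * N) < ⊤ :=
    gaussMoment_lt_top (ENNReal.mul_ne_top (ENNReal.mul_ne_top hq (by simp)) (by simp))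
  refine (eLpNorm_errorFun_le hμ hα hv hv' hN hq1 hq).trans_lt ?_
  have h3 := ENNReal.mul_lt_top (ENNReal.ofReal_lt_top (r := √(∑' k, (freq k ^ 2)⁻¹))) h2
  exact ENNReal.mul_lt_top (ENNReal.add_lt_top.2
    ⟨ENNReal.mul_lt_top ENNReal.ofReal_lt_top h1, ENNReal.ofReal_lt_top⟩)
    (ENNReal.pow_lt_top (ENNReal.add_lt_top.2 ⟨ENNReal.add_lt_top.2 ⟨by simp, h3⟩, h3⟩))

theorem tendsto_eLpNorm_errorFun {v : X × ℝ → ℝ} {v' : ℝ → X × ℝ → ℝ}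
    (hv : IsField μ (fun _ => 1) v) (hv' : ∀ α > 0, IsField μ (resolventEigenvalue α) (v' α))
    {N : ℕ} (hN : 0 < N) {q : ℝ≥0∞} (hq1 : 1 ≤ q) (hq : q ≠ ⊤) :
    Tendsto (fun α => eLpNorm (errorFun N α v (v' α)) q (μ.prod leb)) (𝓝[>] 0) (𝓝 0) := by
  have h1 : gaussMoment (q * 2) < ⊤ := gaussMoment_lt_top (ENNReal.mul_ne_top hq (by simp))
  have h2 : gaussMoment (q * 2 * N) < ⊤ :=
    gaussMoment_lt_top (ENNReal.mul_ne_top (ENNReal.mul_ne_top hq (by simp)) (by simp))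
  have h3 := ENNReal.mul_lt_top (ENNReal.ofReal_lt_top (r := √(∑' k, (freq k ^ 2)⁻¹))) h2
  have h4 : Tendsto (fun α => ENNReal.ofReal √(errorVariance α)) (𝓝[>] 0) (𝓝 0) := by
    simpa using ENNReal.tendsto_ofReal tendsto_sqrt_errorVariance
  have h5 : Tendsto (fun α => ENNReal.ofReal √α) (𝓝[>] 0) (𝓝 0) := by
    have : Tendsto (fun α : ℝ => √α) (𝓝[>] 0) (𝓝 0) := by
      simpa using (Real.continuous_sqrt.tendsto 0).mono_left nhdsWithin_le_nhds
    simpa using ENNReal.tendsto_ofReal this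
  have h6 := (ENNReal.Tendsto.mul_const h4 (Or.inr h1.ne)).add h5
  have h7 := ENNReal.Tendsto.mul_const h6 (Or.inr (ENNReal.pow_lt_top (n := N)
    (ENNReal.add_lt_top.2 ⟨ENNReal.add_lt_top.2 ⟨ENNReal.one_lt_top, h3⟩, h3⟩)).ne)
  refine tendsto_of_tendsto_of_tendsto_of_le_of_le' tendsto_const_nhds (by simpa using h7)
    (Eventually.of_forall fun _ => zero_le) ?_
  filter_upwards [self_mem_nhdsWithin] with α hα
  exact eLpNorm_errorFun_le hμ hα hv (hv' α hα) hN hq1 hq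

end

theorem stronglyMeasurable_errorFun {N : ℕ} {α : ℝ} {v v' : X × ℝ → ℝ} (hv : StronglyMeasurable v)
    (hv' : StronglyMeasurable v') : StronglyMeasurable (errorFun N α v v') :=
  ((hv'.sub hv).norm.add stronglyMeasurable_const).mul
    (((stronglyMeasurable_const.add hv'.norm).add hv.norm).pow N)

open Classical in
/-- The functional `y ↦ 2^{-1/2} ∫ Φ'(v(x, ξ)) y(ξ) dξ`, which is `Q^{1/2}DU(x)`. -/
def sqrtQGradU (Φ : ℝ → ℝ) (v : X × ℝ → ℝ) (x : X) : X :=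
  if h : MemLp (fun ξ => deriv Φ (v (x, ξ))) 2 leb then
    (√2)⁻¹ • (innerSL ℝ (h.toLp : L2)).comp toL2CLM
  else 0

theorem sqrtQGradU_apply {Φ : ℝ → ℝ} {v : X × ℝ → ℝ} {x : X}
    (h : MemLp (fun ξ => deriv Φ (v (x, ξ))) 2 leb) (y : MeanZeroH1) :
    sqrtQGradU Φ v x y = (√2)⁻¹ * ⟪(h.toLp : L2), y.toL2⟫ := by
  rw [sqrtQGradU, dif_pos h]
  rfl

theorem sqrtQGradU_apply_eq_integral {Φ : ℝ → ℝ} {v : X × ℝ → ℝ} {x : X}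
    (h : MemLp (fun ξ => deriv Φ (v (x, ξ))) 2 leb) (y : MeanZeroH1) :
    sqrtQGradU Φ v x y = (√2)⁻¹ * ∫ ξ, deriv Φ (v (x, ξ)) * y.toL2 ξ ∂leb := by
  rw [sqrtQGradU_apply h, ← L2.integral_mul]
  congr 1
  refine integral_congr_ae ?_
  filter_upwards [h.coeFn_toLp] with ξ hξ
  rw [hξ]

theorem aestronglyMeasurable_sqrtQGradU {μ : Measure X} [SFinite μ] {Φ : ℝ → ℝ}
    (hΦ : ContDiff ℝ 2 Φ) {v : X × ℝ → ℝ} (hv : StronglyMeasurable v)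
    (h : ∀ᵐ x ∂μ, MemLp (fun ξ => deriv Φ (v (x, ξ))) 2 leb) :
    AEStronglyMeasurable (sqrtQGradU Φ v) μ := by
  refine aestronglyMeasurable_of_inner dualHilbertBasis fun k => ?_
  rw [coe_dualHilbertBasis]
  have hm : StronglyMeasurable fun z : X × ℝ => deriv Φ (v z) * (cosBasis k).toL2 z.2 :=
    ((contDiff_deriv_of_contDiff_two hΦ).continuous.comp_stronglyMeasurable hv).mul
      ((Lp.stronglyMeasurable _).comp_measurable measurable_snd)
  have h1 : StronglyMeasurable fun x => ∫ ξ, deriv Φ (v (x, ξ)) * (cosBasis k).toL2 ξ ∂leb :=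
    hm.integral_prod_right'
  refine (h1.const_mul (√2)⁻¹).aestronglyMeasurable.congr ?_
  filter_upwards [h] with x hx
  rw [inner_dualBasis, sqrtQGradU_apply_eq_integral hx]

section
variable {Φ : ℝ → ℝ} (hΦ : ContDiff ℝ 2 Φ) (hconv : ConvexOn ℝ univ Φ)

/-- With Ψ = ψ_α(Rx) and g = Φ'(v), the difference applied to y is 2^{-1/2}(⟪Ψ - g, Ry⟫ + ⟪g, Ry -
y⟫). The bounds ‖Ry‖ ≤ 2‖y‖ and ‖Ry - y‖ ≤ √α‖y‖ give the constant 3 = 2 + 1, and the second term is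
why √α enters the error function. -/
theorem enorm_sqrtQ_gradUApprox_sub_le {α : ℝ} (hα : 0 < α) {v v' : X × ℝ → ℝ} {x : X}
    (hx : resolventL2 α x =ᵐ[leb] fun ξ => v' (x, ξ))
    (h : MemLp (fun ξ => deriv Φ (v (x, ξ))) 2 leb) {e : ℝ → ℝ}
    (he1 : ∀ ξ, |yosida Φ α (v' (x, ξ)) - deriv Φ (v (x, ξ))| ≤ e ξ)
    (he2 : ∀ ξ, √α * |deriv Φ (v (x, ξ))| ≤ e ξ) :
    ‖sqrtQ (gradUApprox hΦ hconv hα x) - sqrtQGradU Φ v x‖ₑ ≤ 3 * eLpNorm e 2 leb := by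
  set Ψ := yosidaL2 hΦ hconv hα (resolventL2 α x) with hΨ
  set g : L2 := h.toLp with hg
  have h1 : ‖sqrtQ (gradUApprox hΦ hconv hα x) - sqrtQGradU Φ v x‖ ≤
      2 * ‖Ψ - g‖ + ‖√α • g‖ := by
    refine ContinuousLinearMap.opNorm_le_bound _ (by positivity) fun y => ?_
    have e1 : (sqrtQ (gradUApprox hΦ hconv hα x) - sqrtQGradU Φ v x) y =
        (√2)⁻¹ * (⟪Ψ - g, (resolvent α (embed y)).toL2⟫ +
          ⟪g, (resolvent α (embed y)).toL2 - y.toL2⟫) := by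
      change sqrtQ (gradUApprox hΦ hconv hα x) y - sqrtQGradU Φ v x y = _
      rw [sqrtQ_gradUApprox_apply, sqrtQGradU_apply h, inner_sub_left, inner_sub_right]
      ring
    have e2 : |(√2)⁻¹| ≤ 1 := by
      rw [abs_of_nonneg (by positivity)]
      exact inv_le_one_of_one_le₀ (Real.one_le_sqrt.2 one_le_two)
    have e3 := abs_real_inner_le_norm (Ψ - g) (resolvent α (embed y)).toL2
    have e4 := abs_real_inner_le_norm g ((resolvent α (embed y)).toL2 - y.toL2)
    have e5 := mul_le_mul_of_nonneg_left (norm_toL2_resolvent_embed_le hα y) (norm_nonneg (Ψ - g))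
    have e6 := mul_le_mul_of_nonneg_left (norm_toL2_resolvent_embed_sub_le hα y) (norm_nonneg g)
    rw [e1, Real.norm_eq_abs, abs_mul, norm_smul, Real.norm_eq_abs, abs_of_nonneg (Real.sqrt_nonneg α)]
    refine (mul_le_of_le_one_left (abs_nonneg _) e2).trans ((abs_add_le _ _).trans ?_)
    nlinarith
  have h2 : ‖Ψ - g‖ₑ ≤ eLpNorm e 2 leb := by
    rw [Lp.enorm_def]
    refine eLpNorm_mono_ae ?_
    filter_upwards [Lp.coeFn_sub Ψ g, coeFn_yosidaL2 hΦ hconv hα (resolventL2 α x), hx,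
      h.coeFn_toLp] with ξ e1 e2 e3 e4
    rw [e1, Pi.sub_apply, hΨ, e2, e3, hg, e4]
    exact (he1 ξ).trans (le_abs_self _)
  have h3 : ‖√α • g‖ₑ ≤ eLpNorm e 2 leb := by
    rw [Lp.enorm_def]
    refine eLpNorm_mono_ae ?_
    filter_upwards [Lp.coeFn_smul (√α) g, h.coeFn_toLp] with ξ e1 e2
    rw [e1, Pi.smul_apply, hg, e2, norm_smul, Real.norm_eq_abs, abs_of_nonneg (Real.sqrt_nonneg α)]
    exact (he2 ξ).trans (le_abs_self _)
  have h4 : ‖sqrtQ (gradUApprox hΦ hconv hα x) - sqrtQGradU Φ v x‖ₑ ≤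
      2 * ‖Ψ - g‖ₑ + ‖√α • g‖ₑ := by
    have e2 : 2 * ENNReal.ofReal ‖Ψ - g‖ = ENNReal.ofReal (2 * ‖Ψ - g‖) := by
      rw [ENNReal.ofReal_mul (by norm_num), ENNReal.ofReal_ofNat]
    rw [← ofReal_norm, ← ofReal_norm, ← ofReal_norm, e2,
      ← ENNReal.ofReal_add (by positivity) (norm_nonneg _)]
    exact ENNReal.ofReal_le_ofReal h1
  calc _ ≤ 2 * ‖Ψ - g‖ₑ + ‖√α • g‖ₑ := h4
    _ ≤ 2 * eLpNorm e 2 leb + eLpNorm e 2 leb := by gcongr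
    _ = 3 * eLpNorm e 2 leb := by ring

end

theorem HasSobolevGradient.mono_exponent {H : Type*} [NormedAddCommGroup H] [InnerProductSpace ℝ H]
    [MeasurableSpace H] [OpensMeasurableSpace H] [SecondCountableTopology H] {μ : Measure H}
    [IsProbabilityMeasure μ] {b : ℕ → H} (hb : Orthonormal ℝ b) {lam : ℕ → ℝ} {θ q r : ℝ}
    (hqr : q ≤ r) {u : H → ℝ} {F : H → H} (h : HasSobolevGradient μ b lam θ r u F) :
    HasSobolevGradient μ b lam θ q u F := by
  have hle := ENNReal.ofReal_le_ofReal hqr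
  obtain ⟨h1, h2, φ, h3, h4, h5⟩ := h
  refine ⟨h1.mono_exponent hle, h2.mono_exponent hle, φ, h3, ?_, ?_⟩
  · exact tendsto_of_tendsto_of_tendsto_of_le_of_le tendsto_const_nhds h4 (fun _ => zero_le)
      fun n => eLpNorm_le_eLpNorm_of_exponent_le hle
        ((h3 n).contDiff.continuous.aestronglyMeasurable.sub h1.1)
  · exact tendsto_of_tendsto_of_tendsto_of_le_of_le tendsto_const_nhds h5 (fun _ => zero_le)
      fun n => eLpNorm_le_eLpNorm_of_exponent_le hle
        (((h3 n).continuous_weightedGradient hb lam θ).aestronglyMeasurable.sub h2.1)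

theorem TendstoSobolev.mono_exponent {H : Type*} [NormedAddCommGroup H] [InnerProductSpace ℝ H]
    [MeasurableSpace H] [OpensMeasurableSpace H] [SecondCountableTopology H] {μ : Measure H}
    [IsProbabilityMeasure μ] {b : ℕ → H} (hb : Orthonormal ℝ b) {lam : ℕ → ℝ} {θ q r : ℝ}
    (hqr : q ≤ r) {Ua : ℝ → H → ℝ} {V : H → EReal} (h : TendstoSobolev μ b lam θ r Ua V) :
    TendstoSobolev μ b lam θ q Ua V := by
  have hle := ENNReal.ofReal_le_ofReal hqr
  obtain ⟨h0, Fa, F, h1, h2, h3, h4⟩ := h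
  refine ⟨h0, Fa, F, fun α hα => (h1 α hα).mono_exponent hb hqr, h2.mono_exponent hb hqr, ?_, ?_⟩
  · refine tendsto_of_tendsto_of_tendsto_of_le_of_le' tendsto_const_nhds h3
      (Eventually.of_forall fun _ => zero_le) ?_
    filter_upwards [self_mem_nhdsWithin] with α hα
    exact eLpNorm_le_eLpNorm_of_exponent_le hle ((h1 α hα).1.1.sub h2.1.1)
  · refine tendsto_of_tendsto_of_tendsto_of_le_of_le' tendsto_const_nhds h4
      (Eventually.of_forall fun _ => zero_le) ?_
    filter_upwards [self_mem_nhdsWithin] with α hα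
    exact eLpNorm_le_eLpNorm_of_exponent_le hle ((h1 α hα).2.1.1.sub h2.2.1.1)


/-- The errors of the Moreau–Yosida approximation of `Φ` are controlled by `C * errorFun N`. -/
structure ErrorBound (Φ : ℝ → ℝ) (C : ℝ) (N : ℕ) : Prop where
  pos : 0 < N
  deriv_le {α : ℝ} : 0 < α → α ≤ 1 → ∀ v v' : X × ℝ → ℝ, ∀ z,
    √α * |deriv Φ (v z)| ≤ C * errorFun N α v v' z
  yosida_sub_le {α : ℝ} : 0 < α → α ≤ 1 → ∀ v v' : X × ℝ → ℝ, ∀ z,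
    |yosida Φ α (v' z) - deriv Φ (v z)| ≤ C * errorFun N α v v' z
  moreauYosida_sub_le {α : ℝ} : 0 < α → α ≤ 1 → ∀ v v' : X × ℝ → ℝ, ∀ z,
    |moreauYosida Φ α (v' z) - Φ (v z)| ≤ C * errorFun N α v v' z

theorem exists_errorBound {Φ : ℝ → ℝ} (hΦ : ContDiff ℝ 2 Φ) (hconv : ConvexOn ℝ univ Φ) {K p : ℝ}
    (hgrowth : ∀ t : ℝ, |iteratedDeriv 2 Φ t| ≤ K * (1 + |t| ^ (p - 2))) (hK : 0 < K) (hp : 2 ≤ p) :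
    ∃ C N, ErrorBound Φ C N := by
  obtain ⟨C, N, hC, hN, h⟩ := exists_growth_bounds hΦ hconv hgrowth hK hp
  -- For α ≤ 1 the linear error α is absorbed in √α, so one error function serves all three
  -- estimates.
  have hsqrt : ∀ {α : ℝ}, 0 < α → α ≤ 1 → α ≤ √α := fun {α} h0 h1 =>
    Real.le_sqrt_of_sq_le (by nlinarith)
  have hle : ∀ {α : ℝ}, 0 < α → α ≤ 1 → ∀ (v v' : X × ℝ → ℝ) z,
      C * ((|v' z - v z| + α) * (1 + |v' z| + |v z|) ^ N) ≤ C * errorFun N α v v' z := by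
    intro α h0 h1 v v' z
    rw [errorFun]
    have := hsqrt h0 h1
    gcongr
  refine ⟨C, N, hN, fun {α} h0 h1 v v' z => ?_, fun h0 h1 v v' z => ?_,
    fun h0 h1 v v' z => ?_⟩
  · have h2 : C * (√α * (1 + |v' z| + |v z|) ^ N) ≤ C * errorFun N α v v' z := by
      rw [errorFun]
      gcongr
      exact le_add_of_nonneg_left (abs_nonneg _)
    refine le_trans ?_ h2
    have := mul_le_mul_of_nonneg_left (h (v' z) (v z) α h0 h1).1 (Real.sqrt_nonneg α)
    linarith
  · exact (h _ _ _ h0 h1).2.1.trans (hle h0 h1 v v' z)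
  · exact (h _ _ _ h0 h1).2.2.trans (hle h0 h1 v v' z)

/-! ### L^q estimates for U_α - U and for the weighted gradients. -/

section
variable {μ : Measure X} (hμ : IsGaussianMeasure μ Q) {Φ : ℝ → ℝ} (hΦ : ContDiff ℝ 2 Φ)
  (hconv : ConvexOn ℝ univ Φ) {C : ℝ} {N : ℕ} (hE : ErrorBound Φ C N)
  {v v' : X × ℝ → ℝ} (hv : IsField μ (fun _ => 1) v)
include hμ hE hv

include hΦ in
-- At α = 1 the first bound in `ErrorBound` dominates |Φ'(v)| by a function with finite moments, so
-- almost every slice is square integrable.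
theorem ae_memLp_deriv_slice :
    ∀ᵐ x ∂μ, MemLp (fun ξ => deriv Φ (v (x, ξ))) 2 leb := by
  have := hμ.isProbabilityMeasure
  obtain ⟨v₁, hv₁⟩ := exists_isField hμ (abs_resolventEigenvalue_le zero_le_one)
  have h1 := eLpNorm_errorFun_lt_top hμ one_pos hv hv₁ hE.pos (q := 2) one_le_two (by simp)
  refine ae_memLp_slice (f := fun z => deriv Φ (v z)) (μ := μ) (ν := leb)
    ((contDiff_deriv_of_contDiff_two hΦ).continuous.comp_stronglyMeasurable hv.1) two_ne_zero
    (by simp) ?_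
  refine (eLpNorm_mono (g := C • errorFun N 1 v v₁) fun z => ?_).trans_lt
    ((eLpNorm_const_smul_le).trans_lt (ENNReal.mul_lt_top enorm_lt_top h1))
  have := hE.deriv_le one_pos le_rfl v v₁ z
  rw [Real.sqrt_one, one_mul] at this
  exact this.trans (le_abs_self _)

variable {p : ℝ} (hp : 2 ≤ p) {C' : ℝ} (hC' : ∀ t, |Φ t| ≤ C' * (1 + |t| ^ p))
  {α : ℝ} (hα : 0 < α) (hα1 : α ≤ 1) (hv' : IsField μ (resolventEigenvalue α) v')
include hα hα1 hv'

include hΦ hconv hp hC' in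
-- For almost every x both functionals are integrals over ξ of functions of the two fields, so the
-- pointwise error bound is integrated.
theorem eLpNorm_UApprox_sub_le {q : ℝ≥0∞} (hq2 : 2 ≤ q) (hq : q ≠ ⊤) :
    eLpNorm (fun x => UApprox Φ α x - (U Φ p x).toReal) q μ ≤
      ‖C‖ₑ * eLpNorm (errorFun N α v v') q (μ.prod leb) := by
  have := hμ.isProbabilityMeasure
  have hm := (stronglyMeasurable_errorFun (N := N) (α := α) hv.1 hv'.1).const_mul C
  refine (eLpNorm_le_prod hm hq2 hq ?_).trans
    (eLpNorm_const_smul_le (c := C) (f := errorFun N α v v'))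
  filter_upwards [hv.ae_isAdmissible hμ (p := p) (by linarith), hv'.ae_eq_resolvent hα]
    with x hadm hx
  have e1 : UApprox Φ α x = ∫ ξ, moreauYosida Φ α (v' (x, ξ)) ∂leb := by
    refine integral_congr_ae ?_
    filter_upwards [hx] with ξ hξ
    rw [← hξ]; rfl
  have i1 : Integrable (fun ξ => moreauYosida Φ α (v' (x, ξ))) leb :=
    (isLipschitzSubgradient_moreauYosida hΦ hconv hα).integrable_comp
      ((memLp_congr_ae hx).1 (Lp.memLp _))
  rw [e1, U_eq (by linarith) hadm, EReal.toReal_coe]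
  exact enorm_integral_sub_le i1
    (integrable_comp_of_growth hΦ.continuous (by linarith) hC' hadm.1)
    (hm.comp_measurable measurable_prodMk_left).aestronglyMeasurable
    (Eventually.of_forall fun ξ => hE.moreauYosida_sub_le hα hα1 v v' (x, ξ))

theorem eLpNorm_sqrtQ_gradUApprox_sub_le {q : ℝ≥0∞} (hq2 : 2 ≤ q) (hq : q ≠ ⊤) :
    eLpNorm (fun x => sqrtQ (gradUApprox hΦ hconv hα x) - sqrtQGradU Φ v x) q μ ≤
      ‖3 * C‖ₑ * eLpNorm (errorFun N α v v') q (μ.prod leb) := by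
  have := hμ.isProbabilityMeasure
  have hm := (stronglyMeasurable_errorFun (N := N) (α := α) hv.1 hv'.1).const_mul (3 * C)
  have h3 : ‖(3 : ℝ)‖ₑ = 3 := by
    rw [Real.enorm_eq_ofReal (by norm_num), ENNReal.ofReal_ofNat]
  have h4 : ∀ᵐ x ∂μ, ‖sqrtQ (gradUApprox hΦ hconv hα x) - sqrtQGradU Φ v x‖ₑ ≤
      eLpNorm (fun ξ => 3 * C * errorFun N α v v' (x, ξ)) 2 leb := by
    filter_upwards [ae_memLp_deriv_slice hμ hΦ hE hv, hv'.ae_eq_resolvent hα] with x hd hx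
    have h5 := enorm_sqrtQ_gradUApprox_sub_le hΦ hconv hα hx hd
      (fun ξ => hE.yosida_sub_le hα hα1 v v' (x, ξ))
      (fun ξ => hE.deriv_le hα hα1 v v' (x, ξ))
    rw [← h3, ← eLpNorm_const_smul] at h5
    simp only [mul_assoc]
    exact h5
  generalize 3 * C = D at hm h4 ⊢
  have h5 := eLpNorm_le_prod (E := X) hm hq2 hq h4
  exact h5.trans (eLpNorm_const_smul_le (c := D) (f := errorFun N α v v'))

end

theorem hasSobolevGradient_UApprox {μ : Measure X} (hμ : IsGaussianMeasure μ Q) {Φ : ℝ → ℝ}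
    (hΦ : ContDiff ℝ 2 Φ) (hconv : ConvexOn ℝ univ Φ) {α : ℝ} (hα : 0 < α) {q : ℝ} (hq : 0 < q) :
    HasSobolevGradient μ dualBasis eigenvalue (1 / 2) q (UApprox Φ α)
      fun x => sqrtQ (gradUApprox hΦ hconv hα x) := by
  have := hμ.isProbabilityMeasure
  obtain ⟨L, hL⟩ := exists_lipschitzWith_gradUApprox hΦ hconv hα
  have h := hasSobolevGradient_of_lipschitz_gradient (H := X) (fun r hr => hμ.memLp r hr)
    dualHilbertBasis (lam := eigenvalue) (θ := 1 / 2) (S := sqrtQ)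
    (fun k => by rw [coe_dualHilbertBasis]; exact sqrtQ_dualBasis k)
    (hasFDerivAt_UApprox hΦ hconv hα) hL hq
  rwa [coe_dualHilbertBasis] at h

theorem aestronglyMeasurable_toReal_U {μ : Measure X} (hμ : IsGaussianMeasure μ Q) {Φ : ℝ → ℝ}
    (hΦ : Continuous Φ) {p : ℝ} (hp : 1 ≤ p) :
    AEStronglyMeasurable (fun x => (U Φ p x).toReal) μ := by
  obtain ⟨v, hv⟩ := exists_isField hμ (w := fun _ => 1) (c := 1) (by simp)
  have h1 : StronglyMeasurable fun x => ∫ ξ, Φ (v (x, ξ)) ∂leb :=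
    (hΦ.comp_stronglyMeasurable hv.1).integral_prod_right'
  refine h1.aestronglyMeasurable.congr ?_
  filter_upwards [hv.ae_isAdmissible hμ (p := p) (by linarith)] with x hx
  rw [U_eq hp hx, EReal.toReal_coe]

theorem ae_U_ne {μ : Measure X} (hμ : IsGaussianMeasure μ Q) (Φ : ℝ → ℝ) {p : ℝ} (hp : 1 ≤ p) :
    ∀ᵐ x ∂μ, U Φ p x ≠ ⊤ ∧ U Φ p x ≠ ⊥ := by
  obtain ⟨v, hv⟩ := exists_isField hμ (w := fun _ => 1) (c := 1) (by simp)
  filter_upwards [hv.ae_isAdmissible hμ (p := p) (by linarith)] with x hx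
  rw [U_eq hp hx]
  exact ⟨EReal.coe_ne_top _, EReal.coe_ne_bot _⟩

theorem memLp_of_eLpNorm_sub_lt_top {Ω E : Type*} [MeasurableSpace Ω] [NormedAddCommGroup E]
    {μ : Measure Ω} {q : ℝ≥0∞} {f g : Ω → E} (hf : MemLp f q μ) (hg : AEStronglyMeasurable g μ)
    (h : eLpNorm (fun x => f x - g x) q μ < ⊤) : MemLp g q μ := by
  have h1 : MemLp (fun x => f x - g x) q μ := ⟨hf.1.sub hg, h⟩
  exact (hf.sub h1).ae_eq (Eventually.of_forall fun x => sub_sub_cancel (f x) (g x))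

/-! ### Convergence in the Sobolev space and conclusion. -/

section
variable {μ : Measure X} (hμ : IsGaussianMeasure μ Q) {Φ : ℝ → ℝ} (hΦ : ContDiff ℝ 2 Φ)
  (hconv : ConvexOn ℝ univ Φ) {K p : ℝ} (hK : 0 < K) (hp : 2 ≤ p)
  (hgrowth : ∀ t : ℝ, |iteratedDeriv 2 Φ t| ≤ K * (1 + |t| ^ (p - 2)))
include hμ hΦ hconv hK hp hgrowth

/-- The error estimates give convergence of values and weighted gradients. The case α = 1 places
both limits in L^q, and closedness along α = 1/(n + 1) identifies the limit of the gradients as the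
weighted gradient of U. -/
theorem tendstoSobolev_of_two_le {q : ℝ} (hq : 2 ≤ q) :
    TendstoSobolev μ dualBasis eigenvalue (1 / 2) q (UApprox Φ) (U Φ p) := by
  have := hμ.isProbabilityMeasure
  obtain ⟨C', hC'⟩ := exists_abs_le_rpow hΦ hgrowth hK hp
  obtain ⟨C, N, hE⟩ := exists_errorBound hΦ hconv hgrowth hK hp
  obtain ⟨v, hv⟩ := exists_isField hμ (w := fun _ => 1) (c := 1) (by simp)
  -- The field is chosen for every real α so that one function of α results; the value 0 for α ≤ 0
  -- is never used.
  have hfield : ∀ α : ℝ, ∃ v', 0 < α → IsField μ (resolventEigenvalue α) v' := fun α => by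
    by_cases hα : 0 < α
    · obtain ⟨v', h⟩ := exists_isField hμ (abs_resolventEigenvalue_le hα.le)
      exact ⟨v', fun _ => h⟩
    · exact ⟨0, fun h => (hα h).elim⟩
  choose v' hv' using hfield
  have hq2 : 2 ≤ ENNReal.ofReal q := by
    rw [← ENNReal.ofReal_ofNat]; exact ENNReal.ofReal_le_ofReal hq
  have hq1 := one_le_two.trans hq2
  have hqt : ENNReal.ofReal q ≠ ⊤ := ENNReal.ofReal_ne_top
  have hlim := tendsto_eLpNorm_errorFun hμ hv (fun α hα => hv' α hα) hE.pos hq1 hqt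
  have hlimc : ∀ c : ℝ, Tendsto (fun α => ‖c‖ₑ * eLpNorm (errorFun N α v (v' α))
      (ENNReal.ofReal q) (μ.prod leb)) (𝓝[>] 0) (𝓝 0) := fun c => by
    simpa using ENNReal.Tendsto.const_mul hlim (Or.inr (enorm_ne_top (x := c)))
  have hsmall : ∀ᶠ α : ℝ in 𝓝[>] 0, 0 < α ∧ α ≤ 1 := by
    filter_upwards [Ioc_mem_nhdsGT (zero_lt_one (α := ℝ))] with α hα using hα
  set Fa : ℝ → X → X := fun α x =>
    if hα : 0 < α then sqrtQ (gradUApprox hΦ hconv hα x) else 0 with hFa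
  have hFa_eq : ∀ {α : ℝ} (hα : 0 < α), Fa α = fun x => sqrtQ (gradUApprox hΦ hconv hα x) :=
    fun hα => funext fun x => dif_pos hα
  have hle1 : ∀ α : ℝ, 0 < α → α ≤ 1 →
      eLpNorm (fun x => UApprox Φ α x - (U Φ p x).toReal) (ENNReal.ofReal q) μ ≤
        ‖C‖ₑ * eLpNorm (errorFun N α v (v' α)) (ENNReal.ofReal q) (μ.prod leb) :=
    fun α hα hα1 => eLpNorm_UApprox_sub_le hμ hΦ hconv hE hv hp hC' hα hα1 (hv' α hα) hq2 hqt
  have hle2 : ∀ α : ℝ, 0 < α → α ≤ 1 →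
      eLpNorm (fun x => Fa α x - sqrtQGradU Φ v x) (ENNReal.ofReal q) μ ≤
        ‖3 * C‖ₑ * eLpNorm (errorFun N α v (v' α)) (ENNReal.ofReal q) (μ.prod leb) :=
    fun α hα hα1 => by
      rw [hFa_eq hα]
      exact eLpNorm_sqrtQ_gradUApprox_sub_le hμ hΦ hconv hE hv hα hα1 (hv' α hα) hq2 hqt
  have hgrad : ∀ α : ℝ, 0 < α →
      HasSobolevGradient μ dualBasis eigenvalue (1 / 2) q (UApprox Φ α) (Fa α) := fun α hα => by
    rw [hFa_eq hα]
    exact hasSobolevGradient_UApprox hμ hΦ hconv hα (by linarith)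
  have hlt := eLpNorm_errorFun_lt_top hμ one_pos hv (hv' 1 one_pos) hE.pos hq1 hqt
  have hU : MemLp (fun x => (U Φ p x).toReal) (ENNReal.ofReal q) μ :=
    memLp_of_eLpNorm_sub_lt_top (hgrad 1 one_pos).1
      (aestronglyMeasurable_toReal_U hμ hΦ.continuous (by linarith))
      ((hle1 1 one_pos le_rfl).trans_lt (ENNReal.mul_lt_top enorm_lt_top hlt))
  have hF : MemLp (sqrtQGradU Φ v) (ENNReal.ofReal q) μ :=
    memLp_of_eLpNorm_sub_lt_top (hgrad 1 one_pos).2.1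
      (aestronglyMeasurable_sqrtQGradU hΦ hv.1 (ae_memLp_deriv_slice hμ hΦ hE hv))
      ((hle2 1 one_pos le_rfl).trans_lt (ENNReal.mul_lt_top enorm_lt_top hlt))
  have ht1 : Tendsto (fun α => eLpNorm (fun x => UApprox Φ α x - (U Φ p x).toReal)
      (ENNReal.ofReal q) μ) (𝓝[>] 0) (𝓝 0) :=
    tendsto_of_tendsto_of_tendsto_of_le_of_le' tendsto_const_nhds (hlimc C)
      (Eventually.of_forall fun _ => zero_le) (hsmall.mono fun α h => hle1 α h.1 h.2)
  have ht2 : Tendsto (fun α => eLpNorm (fun x => Fa α x - sqrtQGradU Φ v x)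
      (ENNReal.ofReal q) μ) (𝓝[>] 0) (𝓝 0) :=
    tendsto_of_tendsto_of_tendsto_of_le_of_le' tendsto_const_nhds (hlimc (3 * C))
      (Eventually.of_forall fun _ => zero_le) (hsmall.mono fun α h => hle2 α h.1 h.2)
  have hseq : Tendsto (fun n : ℕ => 1 / ((n : ℝ) + 1)) atTop (𝓝[>] 0) :=
    tendsto_nhdsWithin_iff.2 ⟨tendsto_one_div_add_atTop_nhds_zero_nat,
      Eventually.of_forall fun n => mem_Ioi.2 (by positivity)⟩
  exact ⟨ae_U_ne hμ Φ (by linarith), Fa, sqrtQGradU Φ v, hgrad,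
    HasSobolevGradient.of_tendsto orthonormal_dualBasis (by linarith)
      (fun n => hgrad (1 / ((n : ℝ) + 1)) (by positivity)) hU hF (ht1.comp hseq) (ht2.comp hseq),
    ht1, ht2⟩

/-- Exponents below 2 follow from the exponent max q 2, because μ is a probability measure. -/
theorem tendstoSobolev_UApprox (q : ℝ) :
    TendstoSobolev μ dualBasis eigenvalue (1 / 2) q (UApprox Φ) (U Φ p) := by
  have := hμ.isProbabilityMeasure
  exact (tendstoSobolev_of_two_le hμ hΦ hconv hK hp hgrowth (le_max_right q 2)).mono_exponent
    orthonormal_dualBasis (le_max_left q 2)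

theorem approximationHypothesis_UApprox (hbdd : BddBelow (range Φ)) :
    ApproximationHypothesis μ dualBasis eigenvalue (U Φ p) (UApprox Φ) where
  ne_bot := U_ne_bot Φ p
  convex := by
    obtain ⟨C, hC⟩ := exists_abs_le_rpow hΦ hgrowth hK hp
    exact convex_epigraph_U hΦ.continuous hconv hp hC
  convex_approx α hα := convexOn_UApprox hΦ hconv hα
  differentiable_approx α hα x := (hasFDerivAt_UApprox hΦ hconv hα x).differentiableAt
  lipschitz_gradient α hα := by
    rw [gradient_UApprox hΦ hconv hα]
    exact exists_lipschitzWith_gradUApprox hΦ hconv hα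
  bounds := by
    obtain ⟨c, hc⟩ := hbdd
    obtain ⟨C, hC⟩ := exists_abs_le_rpow hΦ hgrowth hK hp
    refine ⟨c, fun α hα => ?_⟩
    filter_upwards [ae_UApprox_le_U hΦ hconv hα hp hC hμ] with x hx
    exact ⟨le_UApprox hΦ hconv hα (fun t => hc (mem_range_self t)) x, hx⟩
  -- Any exponent above 2 would do.
  tendsto := ⟨3, by norm_num, tendstoSobolev_UApprox hμ hΦ hconv hK hp hgrowth 3⟩

end

end
end CahnHilliard

theorem lemma4p2 (Φ : ℝ → ℝ) (hΦ : ContDiff ℝ 2 Φ) (hconv : ConvexOn ℝ Set.univ Φ)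
    (hbdd : BddBelow (Set.range Φ)) (K p : ℝ) (hK : 0 < K) (hp : 2 ≤ p)
    (hgrowth : ∀ t : ℝ, |iteratedDeriv 2 Φ t| ≤ K * (1 + |t| ^ (p - 2)))
    (μ : MeasureTheory.Measure CahnHilliard.X)
    (hμ : CahnHilliard.IsGaussianMeasure μ CahnHilliard.Q) :
    CahnHilliard.ApproximationHypothesis μ CahnHilliard.dualBasis CahnHilliard.eigenvalue
        (CahnHilliard.U Φ p) (CahnHilliard.UApprox Φ) ∧
      ∀ q : ℝ, 1 < q →
        CahnHilliard.TendstoSobolev μ CahnHilliard.dualBasis CahnHilliard.eigenvalue (1 / 2) q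
          (CahnHilliard.UApprox Φ) (CahnHilliard.U Φ p) := by
  exact ⟨CahnHilliard.approximationHypothesis_UApprox hμ hΦ hconv hK hp hgrowth hbdd,
    fun q _ => CahnHilliard.tendstoSobolev_UApprox hμ hΦ hconv hK hp hgrowth q⟩
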